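/- **Conventions.** An integral polynomial is $p\in\mathbb{Q}[x]$ with $p(\mathbb{Z})\subseteq\mathbb{Z}$. For $k\ge 0$ put $p^{[k]}=\binom{p}{k}=\frac{p(p-1)\cdots(p-k+1)}{k!}$. For a finite set $P=\{p_1,\dots,p_r\}$ of integral polynomials and $k\ge 1$, let $\Lambda_k(P)$ be the polynomial matrix with $k$ blocks of $r$ rows and with $k$ columns, whose entry in the $l$-th row of block $i$ and in column $j$ is $p_l^{[i-j+1]}$ if $j\le i$ and $0$ if $j>i$. Let $V_k(P)\subseteq\mathbb{R}^{kr}$ be the real span of all columns of $\Lambda_k(P)(x)$, $x\in\mathbb{R}$. The set of $k$-Weyl polynomials of $P$ is $$\mathsf{WP}_k(P)=\{\mathbf v^{T}\Lambda_k(P)\mathbf e_1 : \mathbf v\in\mathbb{R}^r\times V_{k-1}(P)^{\perp}\}\subseteq\mathbb{R}[x],$$ where $\mathbf e_1$ is the first standard basis vector of $\mathbb{R}^k$; for $k=1$ this is the real linear span of $P$. A system $(X,\mu,T)$ is a compact metrizable space $X$ with a Borel probability measure $\mu$ and a $\mu$-preserving homeomorphism $T$. A Kronecker system is an ergodic system in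 which $X$ is a compact abelian group, $\mu$ its Haar measure and $T$ a translation. A Weyl system is an ergodic system in which $X$ is a compact abelian Lie group (a product of a finite-dimensional torus and a finite abelian group), $\mu$ is its Haar measure and $T(x)=a+U(x)$ for some $a\in X$ and some automorphism $U$ of $X$ whose restriction to the identity component is unipotent. It is a $d$-step Weyl system if moreover $(X,T)$ can be realized as a $d$-step nilsystem, i.e. it is conjugate to a left translation on $G/\Gamma$ for some Lie group $G$ with $G_{d+1}=\{1\}$ (where $G_1=G$ and $G_{l+1}=[G_l,G]$) and some discrete cocompact subgroup $\Gamma$. Let $R\subseteq\mathbb{Z}$, let $Q$ be a finite set of integral polynomials and $\mathcal{C}$ a class of systems. $R$ is a set of $Q$-measurable recurrence for $\mathcal{C}$ if for every $(X,\mu,T)\in\mathcal{C}$ and every Borel set $A$ with $\mu(A)>0$ there is $n\in R$ with $\mu\big(A\cap\bigcap_{q\in Q}T^{-q(n)}A\big)>0$. It is a set of $Q$-topological recurrence for $\mathcal{C}$ if for every $(X,\mu,T)\in\mathcal{C}$ and every nonempty open $V\subseteq X$ there is $n\in R$ with $V\cap\bigcap_{q\in Q}T^{-q(n)}V\ne\emptyset$.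 For a possibly infinite set $W$ of real polynomials, $R$ is a set of $W$-measurable (topological) recurrence for $\mathcal{C}$ if it is a set of $Q$-measurable (topological) recurrence for $\mathcal{C}$ for every finite set $Q\subseteq W$ of integral polynomials. **Theorem.** Let $d\ge 1$, let $P$ be a finite set of integral polynomials with zero constant term, and let $R\subseteq\mathbb{Z}$. Then the following are equivalent: 1. $R$ is a set of $P$-measurable recurrence for $d$-step Weyl systems. 2. $R$ is a set of $P$-topological recurrence for $d$-step Weyl systems. 3. $R$ is a set of $\mathsf{WP}_d(P)$-recurrence for Kronecker systems. Here "recurrence" may be read as measurable or as topological recurrence: each of the two properties is equivalent to 1 and 2. -/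

import Mathlib

open MeasureTheory
open scoped Manifold ContDiff

noncomputable section

namespace WeylRecurrence

/-! ### Integral polynomials -/

/-- An integral polynomial: `p ∈ ℚ[x]` with `p(ℤ) ⊆ ℤ`. -/
def IntegralPolynomial : Type :=
  {p : Polynomial ℚ // ∀ n : ℤ, ∃ m : ℤ, p.eval (n : ℚ) = (m : ℚ)}

/-- The value `p(n) ∈ ℤ` of an integral polynomial at `n ∈ ℤ`. -/
def IntegralPolynomial.value (p : IntegralPolynomial) (n : ℤ) : ℤ := (p.2 n).choose

theorem IntegralPolynomial.value_spec (p : IntegralPolynomial) (n : ℤ) :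
    p.1.eval (n : ℚ) = (p.value n : ℚ) := (p.2 n).choose_spec

/-- An integral polynomial seen as a real polynomial. -/
def IntegralPolynomial.toReal (p : IntegralPolynomial) : Polynomial ℝ :=
  p.1.map (algebraMap ℚ ℝ)

/-! ### Weyl polynomials -/

/-- `p^{[k]} = binom(p, k) = p (p - 1) ⋯ (p - k + 1) / k!`, as a real polynomial. -/
def binomPoly (p : IntegralPolynomial) (k : ℕ) : Polynomial ℝ :=
  Polynomial.C ((k.factorial : ℝ)⁻¹) * (descPochhammer ℝ k).comp p.toReal

/-- The matrix `Λ_k(P)`: `k` blocks of rows, each block indexed by `P`, and `k` columns. With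
blocks and columns numbered from `0`, the entry in the row `p` of block `i` and in column `j` is
`p^{[i - j + 1]}` if `j ≤ i`, and `0` otherwise. -/
def Lam (P : Finset IntegralPolynomial) (k : ℕ) :
    Matrix (Fin k × P) (Fin k) (Polynomial ℝ) :=
  fun a j => if j ≤ a.1 then binomPoly a.2 (a.1.val - j.val + 1) else 0

/-- `ℝ-span(M)`: the real span of the columns of a polynomial matrix `M`, evaluated at all real
points. -/
def columnSpan {ι κ : Type} (M : Matrix ι κ (Polynomial ℝ)) : Submodule ℝ (ι → ℝ) :=
  Submodule.span ℝ {w | ∃ (x : ℝ) (j : κ), w = fun i => (M i j).eval x}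

/-- The map `ξ(v) = vᵀ Λ_{k+1}(P) e₁`. -/
def xi (P : Finset IntegralPolynomial) (k : ℕ) (v : Fin (k + 1) × P → ℝ) : Polynomial ℝ :=
  ∑ a, v a • Lam P (k + 1) a 0

/-- The set `WP_k(P)` of `k`-Weyl polynomials generated by `P`, for `k ≥ 1`: the image under `ξ`
of `ℝ^r × ℝ-span(Λ_{k-1}(P))^⊥`, where `r = |P|`. For `k = 1` the second factor is trivial and
this is the real span of `P`. (The value at `k = 0` is a dummy.) -/
def weylPolynomials (P : Finset IntegralPolynomial) : ℕ → Set (Polynomial ℝ)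
  | 0 => {0}
  | k + 1 => {q | ∃ v : Fin (k + 1) × P → ℝ,
      (∀ w ∈ columnSpan (Lam P k), ∑ a : Fin k × P, v (a.1.succ, a.2) * w a = 0) ∧
      q = xi P k v}

/-! ### Systems -/

/-- A system: a homeomorphism `T` of a compact metrizable space `X` with a `T`-invariant Borel
probability measure `μ`. -/
structure System where
  X : Type
  [topX : TopologicalSpace X]
  [compactX : CompactSpace X]
  [metrizableX : TopologicalSpace.MetrizableSpace X]
  [measX : MeasurableSpace X]
  [borelX : BorelSpace X]
  μ : Measure X
  [probX : IsProbabilityMeasure μ]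
  T : X ≃ₜ X
  invariant : MeasurePreserving T μ μ

attribute [instance] System.topX System.compactX System.metrizableX System.measX System.borelX
  System.probX

/-- A Kronecker system: an ergodic translation of a compact abelian group with its Haar measure. -/
def System.IsKronecker (S : System) : Prop :=
  ∃ (_ : AddCommGroup S.X) (_ : IsTopologicalAddGroup S.X),
    S.μ.IsAddHaarMeasure ∧ Ergodic S.T S.μ ∧ ∃ τ : S.X, ∀ x, S.T x = τ + x

/-- A compact abelian Lie group: the product of a finite-dimensional torus and a finite (discrete)
abelian group, up to isomorphism of topological groups. -/
def IsCompactAbelianLieGroup (X : Type) [AddCommGroup X] [TopologicalSpace X] : Prop :=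
  ∃ (m : ℕ) (F : Type) (_ : AddCommGroup F) (_ : Finite F) (_ : TopologicalSpace F)
    (_ : DiscreteTopology F), Nonempty (X ≃ₜ+ (Fin m → UnitAddCircle) × F)

/-- A Weyl system: an ergodic affine transformation `T x = a + U x` of a compact abelian Lie group
with its Haar measure, where `U` is an automorphism whose restriction to the identity component
is unipotent, that is, `(U - id)^k = 0` on the identity component for some `k`. -/
def System.IsWeyl (S : System) : Prop :=
  ∃ (_ : AddCommGroup S.X) (_ : IsTopologicalAddGroup S.X),
    IsCompactAbelianLieGroup S.X ∧ S.μ.IsAddHaarMeasure ∧ Ergodic S.T S.μ ∧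
    ∃ (a : S.X) (U : S.X ≃ₜ+ S.X), (∀ x, S.T x = a + U x) ∧
      ∃ k : ℕ, ∀ x ∈ connectedComponent (0 : S.X), (fun y => U y - y)^[k] x = 0

/-- `G` is a (finite-dimensional, real) Lie group. -/
def IsRealLieGroup (G : Type) [Group G] [TopologicalSpace G] : Prop :=
  ∃ (E : Type) (_ : NormedAddCommGroup E) (_ : NormedSpace ℝ E) (_ : FiniteDimensional ℝ E)
    (H : Type) (_ : TopologicalSpace H) (I : ModelWithCorners ℝ E H) (_ : I.Boundaryless)
    (_ : ChartedSpace H G), LieGroup I ∞ G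

/-- The homeomorphism `T` of `X` can be realized as a `d`-step nilsystem: up to conjugacy, `X` is
`G ⧸ Γ` for a Lie group `G` that is `d`-step nilpotent (`G_{d+1} = 1`, where `G_1 = G` and
`G_{l+1} = [G_l, G]`) and a discrete cocompact subgroup `Γ`, and `T` is the left translation by an
element of `G`. -/
def IsStepNilsystem (d : ℕ) {X : Type} [TopologicalSpace X] (T : X ≃ₜ X) : Prop :=
  ∃ (G : Type) (_ : Group G) (_ : TopologicalSpace G) (_ : IsTopologicalGroup G),
    IsRealLieGroup G ∧ (⊤ : Subgroup G).lowerCentralSeries d = ⊥ ∧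
    ∃ Γ : Subgroup G, DiscreteTopology Γ ∧ CompactSpace (G ⧸ Γ) ∧
      ∃ (g : G) (h : (G ⧸ Γ) ≃ₜ X), ∀ y : G ⧸ Γ, h (g • y) = T (h y)

/-- The class of Kronecker systems. -/
def kroneckerSystems : Set System := {S | S.IsKronecker}

/-- The class of `d`-step Weyl systems. -/
def weylSystems (d : ℕ) : Set System := {S | S.IsWeyl ∧ IsStepNilsystem d S.T}

/-! ### Recurrence -/

/-- `R` is a set of `Q`-measurable recurrence for the class `C`. -/
def MeasurableRecurrence (R : Set ℤ) (Q : Finset IntegralPolynomial) (C : Set System) : Prop :=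
  ∀ S ∈ C, ∀ A : Set S.X, MeasurableSet A → 0 < S.μ A →
    ∃ n ∈ R, 0 < S.μ (A ∩ ⋂ q ∈ Q, (S.T ^ q.value n) ⁻¹' A)

/-- `R` is a set of `Q`-topological recurrence for the class `C`. -/
def TopologicalRecurrence (R : Set ℤ) (Q : Finset IntegralPolynomial) (C : Set System) : Prop :=
  ∀ S ∈ C, ∀ V : Set S.X, IsOpen V → V.Nonempty →
    ∃ n ∈ R, (V ∩ ⋂ q ∈ Q, (S.T ^ q.value n) ⁻¹' V).Nonempty

/-- `R` is a set of `W`-measurable recurrence for the class `C`, where `W` is a possibly infinite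
set of real polynomials: this is asked for every finite set of integral polynomials in `W`. -/
def MeasurableRecurrenceReal (R : Set ℤ) (W : Set (Polynomial ℝ)) (C : Set System) : Prop :=
  ∀ Q : Finset IntegralPolynomial, (∀ q ∈ Q, q.toReal ∈ W) → MeasurableRecurrence R Q C

/-- The topological version of `MeasurableRecurrenceReal`. -/
def TopologicalRecurrenceReal (R : Set ℤ) (W : Set (Polynomial ℝ)) (C : Set System) : Prop :=
  ∀ Q : Finset IntegralPolynomial, (∀ q ∈ Q, q.toReal ∈ W) → TopologicalRecurrence R Q C

end WeylRecurrence

end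

/-!
The recurrence properties are compared through a statement about angles, `BohrRecurrence`: for
finitely many integral `q ∈ WP_d(P)`, finitely many angles `α` and a neighbourhood `U` of `0` in
`ℝ/ℤ`, there is `n ∈ R` such that all the points `q(n) α` lie in `U`. Measurable recurrence implies
topological recurrence because Haar measure charges open sets, so it remains to close the circle:
topological recurrence for either class implies Bohr recurrence, and Bohr recurrence implies
measurable recurrence for both.

*Kronecker systems.* Finitely many angles form a point of a torus; recurrence of the translation by
this point, restricted to the closed subgroup that it generates, is Bohr recurrence
(`bohr_of_topologicalRecurrence_kronecker`). Conversely a set of positive measure meets its small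
translates (`exists_nhds_half_le_measure_inter_translates`), and the times at which a translation of
a compact abelian group returns to a neighbourhood of `0` contain a Bohr set
(`exists_bohr_subset`). The latter follows from Bogolyubov's lemma in cyclic groups by compactness,
and avoids Pontryagin duality.

*From Weyl systems to angles* (`bohr_of_topologicalRecurrence_weyl`). The angles are rational
combinations of `1` and finitely many rationally independent reals `bᵢ`. The unipotent affine map of
`𝕋^κ × ℤ/M` with one Jordan block of size `d` over each `bᵢ / C`, and with the translation by `1` on
`ℤ/M`, is ergodic (`ergodic_affine_prod`) and is a `d`-step nilsystem, as a translation on the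
quotient of `ℝ^κ ⋊ ℤ` by `ℤ^κ ⋊ Mℤ` (`isStepNilsystem_affine`). If an orbit returns near its initial
point at all times `p(n)`, `p ∈ P`, then the displacements at the levels of a Jordan block, with the
weights `v` that define a multiple `D q` of `q ∈ WP_d(P)`, add up to `D q(n)` times the angle: the
terms that depend on the initial point cancel exactly because of the orthogonality relations imposed
on `v` (`sum_smul_affineFlow_shift_sub`). The factor `ℤ/M` makes `q(n)` divisible enough to deal with
denominators.

*From angles to Weyl systems* (`measurableRecurrence_weyl_of_bohr`). On the identity component the
linear part of a `d`-step Weyl system is `1 + N` with `N` nilpotent, and the first point is that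
`N ^ d = 0`. In a group with `G_{d+1} = 1`, the conjugate `γ^d a γ^{-d}` is a word in the conjugates
`γ^j a γ^{-j}` with `j < d`. Hence a small perturbation of a point that is still small at the times
`0, s, …, (d - 1) s` is small at time `d s` (`eventually_iterate_mem_of_isStepNilsystem`). Were
`N ^ (d + 1) w = 0` with `N ^ d w ≠ 0`, perturbations that grow like the falling factorial of degree
`d` would violate this (`iterate_eq_zero_of_small_paths`). Passing to a power of the transformation
and to a coset of the identity component, one is left with an affine map `x ↦ b + x + N x` of a torus
(`exists_return_torus`).

There the joint orbits at the times `0` and `p(n)`, `p ∈ P`, equidistribute, along Bohr sets, to the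
Haar measure of the closed subgroup generated by the orbits of the linear part
(`tendsto_integral_affineFlow`). For a character which is nontrivial on this subgroup the integral
over the orbits vanishes for all but finitely many `n`. For a character which is trivial on it, the
value along the orbit only depends on the translation `b`, and is given by polynomials that turn out
to be `d`-Weyl polynomials (`weightSum_one_mem_weylPolynomials`), so it tends to `1` along Bohr sets.
As the subgroup contains the diagonal, equidistribution implies multiple recurrence
(`eventually_measure_iInter_pos`).
-/

noncomputable section

set_option linter.unusedSectionVars false

namespace WeylRecurrence

/-! ### Iterates of unipotent affine maps -/

/-- A bi-infinite orbit is determined by its recursion: if `f (m + 1) = T (f m)` for all `m ∈ ℤ`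
then `f m = T ^ m (f 0)`. -/
theorem homeomorph_zpow_apply_eq {X : Type*} [TopologicalSpace X] (T : X ≃ₜ X) (f : ℤ → X)
    (hf : ∀ m, f (m + 1) = T (f m)) (m : ℤ) : (T ^ m) (f 0) = f m := by
  induction m using Int.induction_on with
  | zero => simp
  | succ i ih => rw [hf, ← ih, add_comm, zpow_add, zpow_one]; rfl
  | pred i ih =>
    have h := hf (-i - 1)
    rw [sub_add_cancel] at h
    have h2 : (T ^ (-(i : ℤ) - 1)) (f 0) = T.symm ((T ^ (-(i : ℤ))) (f 0)) := by
      rw [sub_eq_neg_add, zpow_add, zpow_neg_one]; rfl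
    rw [h2, ih, h, T.symm_apply_apply]

/-- The iterates of the affine map `x ↦ a + x + N x` with `N ^ d = 0`, in closed form. -/
def affineFlow {X : Type*} [AddCommGroup X] (N : X →+ X) (a : X) (d : ℕ) (m : ℤ) (x : X) : X :=
  ∑ e ∈ Finset.range d, Ring.choose m e • (N^[e]) x +
    ∑ e ∈ Finset.range d, Ring.choose m (e + 1) • (N^[e]) a

theorem affineFlow_zero {X : Type*} [AddCommGroup X] (N : X →+ X) (a : X) {d : ℕ} (hd : 1 ≤ d)
    (x : X) : affineFlow N a d 0 x = x := by
  obtain ⟨k, rfl⟩ := Nat.exists_eq_add_of_le' hd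
  simp [affineFlow, Finset.sum_range_succ']

/-- The recursion of the orbits, by Pascal's rule; `N ^ d = 0` removes the top term. -/
theorem affineFlow_succ {X : Type*} [AddCommGroup X] (N : X →+ X) (a : X) {d : ℕ} (hd : 1 ≤ d)
    (hN : ∀ x, (N^[d]) x = 0) (m : ℤ) (x : X) :
    affineFlow N a d (m + 1) x = a + affineFlow N a d m x + N (affineFlow N a d m x) := by
  obtain ⟨k, rfl⟩ := Nat.exists_eq_add_of_le' hd
  have key : ∀ (y : X) (j : ℕ),
      ∑ e ∈ Finset.range (k + 1), Ring.choose (m + 1) (e + j) • (N^[e]) y =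
      ∑ e ∈ Finset.range (k + 1), Ring.choose m (e + j) • (N^[e]) y +
      ∑ e ∈ Finset.range (k + 1), Ring.choose m (e + j) • N ((N^[e]) y) +
      (Ring.choose (m + 1) j - Ring.choose m j) • y := by
    intro y j
    rw [Finset.sum_range_succ', Finset.sum_range_succ' (fun e => Ring.choose m (e + j) • (N^[e]) y),
      Finset.sum_range_succ (fun e => Ring.choose m (e + j) • N ((N^[e]) y))]
    have h0 : N ((N^[k]) y) = 0 := by rw [← Function.iterate_succ_apply' (⇑N)]; exact hN y
    have h1 : ∀ e : ℕ, Ring.choose (m + 1) (e + 1 + j) • (N^[e + 1]) y =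
        Ring.choose m (e + 1 + j) • (N^[e + 1]) y + Ring.choose m (e + j) • N ((N^[e]) y) := by
      intro e
      rw [show e + 1 + j = (e + j) + 1 by ring, Ring.choose_succ_succ, add_smul,
        Function.iterate_succ_apply', add_comm]
    simp only [h1, Finset.sum_add_distrib, h0, smul_zero, add_zero, sub_smul,
      Function.iterate_zero, id_eq, zero_add]
    abel
  have k0 := key x 0
  have k1 := key a 1
  simp only [add_zero, Ring.choose_zero_right, sub_self, zero_smul, Ring.choose_one_right,
    add_sub_cancel_left, one_smul] at k0 k1
  unfold affineFlow
  rw [k0, k1, map_add, map_sum, map_sum]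
  simp only [map_zsmul]
  abel

theorem homeomorph_zpow_eq_affineFlow {X : Type*} [AddCommGroup X] [TopologicalSpace X]
    (T : X ≃ₜ X) (N : X →+ X) (a : X) (hT : ∀ x, T x = a + x + N x) {d : ℕ} (hd : 1 ≤ d)
    (hN : ∀ x, (N^[d]) x = 0) (m : ℤ) (x : X) : (T ^ m) x = affineFlow N a d m x := by
  have := homeomorph_zpow_apply_eq T (fun m => affineFlow N a d m x)
    (fun m => by rw [hT, affineFlow_succ N a hd hN]) m
  simpa [affineFlow_zero N a hd] using this

/-! ### Integral polynomials and Weyl polynomials -/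

theorem toReal_eval (p : IntegralPolynomial) (t : ℤ) :
    p.toReal.eval (t : ℝ) = (p.value t : ℝ) := by
  have h := p.value_spec t
  have : p.toReal.eval (algebraMap ℚ ℝ (t : ℚ)) = algebraMap ℚ ℝ (p.1.eval (t : ℚ)) := by
    rw [IntegralPolynomial.toReal, Polynomial.eval_map_algebraMap,
      Polynomial.aeval_algebraMap_apply]
    simp
  rw [h] at this
  simpa using this

theorem value_zero {p : IntegralPolynomial} (hp : p.1.coeff 0 = 0) : p.value 0 = 0 := by
  have h := p.value_spec 0
  rw [Int.cast_zero, ← Polynomial.coeff_zero_eq_eval_zero, hp] at h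
  exact_mod_cast h.symm

theorem choose_cast_eq {K : Type*} [Field K] [CharZero K] (m : ℤ) (k : ℕ) :
    ((k.factorial : K)⁻¹) * (descPochhammer K k).eval (m : K) = ((Ring.choose m k : ℤ) : K) := by
  have h := Ring.descPochhammer_eq_factorial_smul_choose (m : ℤ) k
  have h2 : (descPochhammer K k).eval (m : K) = ((descPochhammer ℤ k).eval m : ℤ) := by
    rw [← descPochhammer_map (Int.castRingHom K), Polynomial.eval_map, Polynomial.eval₂_at_intCast]
    simp
  have h3 : ((descPochhammer ℤ k).eval m : ℤ) = (k.factorial : ℤ) * Ring.choose m k := by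
    rw [Polynomial.eval_eq_smeval, h, nsmul_eq_mul]
  rw [h2, h3]
  push_cast
  rw [← mul_assoc, inv_mul_cancel₀ (by exact_mod_cast k.factorial_ne_zero), one_mul]

theorem binomPoly_eval (p : IntegralPolynomial) (k : ℕ) (t : ℤ) :
    (binomPoly p k).eval (t : ℝ) = ((Ring.choose (p.value t) k : ℤ) : ℝ) := by
  rw [binomPoly, Polynomial.eval_mul, Polynomial.eval_C, Polynomial.eval_comp, toReal_eval,
    choose_cast_eq]

theorem real_poly_ext {f g : Polynomial ℝ} (h : ∀ t : ℤ, f.eval (t : ℝ) = g.eval (t : ℝ)) :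
    f = g := by
  refine Polynomial.eq_of_infinite_eval_eq f g ((Set.infinite_range_of_injective
    (Int.cast_injective (α := ℝ))).mono ?_)
  rintro _ ⟨t, rfl⟩
  exact h t

/-- The integral linear combination `∑ v_{i,p} p^{[i+1]}` as an integral polynomial. -/
def binomComb (P : Finset IntegralPolynomial) (k : ℕ) (v : Fin k × P → ℤ) : IntegralPolynomial :=
  ⟨∑ a, (v a : ℚ) • (Polynomial.C (((a.1 + 1 : ℕ).factorial : ℚ)⁻¹) *
      (descPochhammer ℚ (a.1 + 1)).comp a.2.1.1),
    fun n => ⟨∑ a, v a * Ring.choose (a.2.1.value n) (a.1 + 1), by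
    rw [Polynomial.eval_finsetSum]
    push_cast
    refine Finset.sum_congr rfl fun a _ => ?_
    rw [Polynomial.eval_smul, Polynomial.eval_mul, Polynomial.eval_C, Polynomial.eval_comp,
      IntegralPolynomial.value_spec, choose_cast_eq, smul_eq_mul]⟩⟩

theorem binomComb_value (P : Finset IntegralPolynomial) (k : ℕ) (v : Fin k × P → ℤ) (n : ℤ) :
    (binomComb P k v).value n = ∑ a, v a * Ring.choose (a.2.1.value n) (a.1 + 1) := by
  have h := (binomComb P k v).value_spec n
  have h2 : (binomComb P k v).1.eval (n : ℚ) =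
      ((∑ a, v a * Ring.choose (a.2.1.value n) (a.1 + 1) : ℤ) : ℚ) := by
    simp only [binomComb]
    rw [Polynomial.eval_finsetSum]
    push_cast
    refine Finset.sum_congr rfl fun a _ => ?_
    rw [Polynomial.eval_smul, Polynomial.eval_mul, Polynomial.eval_C, Polynomial.eval_comp,
      IntegralPolynomial.value_spec, choose_cast_eq, smul_eq_mul]
  rw [h] at h2
  exact_mod_cast h2

theorem xi_eval (P : Finset IntegralPolynomial) (k : ℕ) (v : Fin (k + 1) × P → ℝ) (t : ℤ) :
    (xi P k v).eval (t : ℝ) = ∑ a, v a * ((Ring.choose (a.2.1.value t) (a.1 + 1) : ℤ) : ℝ) := by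
  rw [xi, Polynomial.eval_finsetSum]
  refine Finset.sum_congr rfl fun a _ => ?_
  simp [Lam, binomPoly_eval]

/-- The orthogonality condition in the definition of Weyl polynomials, in coordinates: it can be
tested on integers, one column at a time. -/
theorem orthogonal_columnSpan_iff (P : Finset IntegralPolynomial) (k : ℕ)
    (v : Fin (k + 1) × P → ℝ) :
    (∀ w ∈ columnSpan (Lam P k), ∑ a : Fin k × P, v (a.1.succ, a.2) * w a = 0) ↔
    ∀ (j : Fin k) (t : ℤ), ∑ a : Fin k × P, v (a.1.succ, a.2) *
      ((if j ≤ a.1 then Ring.choose (a.2.1.value t) (a.1.val - j.val + 1) else 0 : ℤ) : ℝ) = 0 := by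
  constructor
  · intro h j t
    have := h _ (Submodule.subset_span ⟨(t : ℝ), j, rfl⟩)
    rw [← this]
    refine Finset.sum_congr rfl fun a _ => ?_
    congr 1
    simp only [Lam]
    split_ifs <;> simp [binomPoly_eval]
  · intro h w hw
    induction hw using Submodule.span_induction with
    | mem w hw =>
      obtain ⟨x, j, rfl⟩ := hw
      have h0 : ∑ a : Fin k × P, v (a.1.succ, a.2) • Lam P k a j = 0 := by
        refine real_poly_ext fun t => ?_
        rw [Polynomial.eval_finsetSum, Polynomial.eval_zero, ← h j t]
        refine Finset.sum_congr rfl fun a _ => ?_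
        simp only [Lam]
        split_ifs <;> simp [binomPoly_eval]
      have h1 := congrArg (Polynomial.eval x) h0
      rw [Polynomial.eval_finsetSum, Polynomial.eval_zero] at h1
      simpa using h1
    | zero => simp
    | add x y _ _ hx hy => simp [mul_add, Finset.sum_add_distrib, hx, hy]
    | smul c x _ hx =>
      simp only [Pi.smul_apply, smul_eq_mul, mul_left_comm _ c]
      rw [← Finset.mul_sum, hx, mul_zero]

/-- Every `p ∈ P` is a Weyl polynomial of `P`. -/
theorem toReal_mem_weylPolynomials {P : Finset IntegralPolynomial} {p : IntegralPolynomial}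
    (hp : p ∈ P) (k : ℕ) : p.toReal ∈ weylPolynomials P (k + 1) := by
  classical
  refine ⟨fun a => if a = (0, ⟨p, hp⟩) then 1 else 0, fun w _ => ?_, ?_⟩
  · refine Finset.sum_eq_zero fun a _ => ?_
    have : ((a.1.succ, a.2) : Fin (k + 1) × P) ≠ (0, ⟨p, hp⟩) := fun h =>
      Fin.succ_ne_zero _ (congrArg Prod.fst h)
    simp only [if_neg this, zero_mul]
  · refine real_poly_ext fun t => ?_
    rw [xi_eval, toReal_eval]
    simp

/-- A linear system with rational coefficients that has a real solution has an integral solution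
of a multiple: for an integral Weyl polynomial `q`, some positive multiple `D q` is an integral
combination of binomials of `P` satisfying the orthogonality conditions. -/
theorem exists_int_weights {P : Finset IntegralPolynomial} {k : ℕ} {q : IntegralPolynomial}
    (hq : q.toReal ∈ weylPolynomials P (k + 1)) :
    ∃ (D : ℕ) (v : Fin (k + 1) × P → ℤ), 0 < D ∧
      (∀ t : ℤ, D * q.value t = ∑ a, v a * Ring.choose (a.2.1.value t) (a.1 + 1)) ∧
      ∀ (j : Fin k) (t : ℤ), ∑ a : Fin k × P, v (a.1.succ, a.2) *
        (if j ≤ a.1 then Ring.choose (a.2.1.value t) (a.1.val - j.val + 1) else 0) = 0 := by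
  classical
  obtain ⟨v, hv, hqv⟩ := hq
  rw [orthogonal_columnSpan_iff] at hv
  -- a `ℚ`-linear retraction of `ℚ ⊆ ℝ` turns the real solution into a rational one
  obtain ⟨φ, hφ⟩ := LinearMap.exists_leftInverse_of_injective (Algebra.linearMap ℚ ℝ)
    (LinearMap.ker_eq_bot.mpr (algebraMap ℚ ℝ).injective)
  have hφ1 : ∀ r : ℚ, φ (r : ℝ) = r := fun r => by
    have := LinearMap.congr_fun hφ r
    simpa using this
  have hφm : ∀ (x : ℝ) (m : ℤ), φ (x * (m : ℝ)) = φ x * m := fun x m => by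
    have := φ.map_smul (m : ℚ) x
    rw [Rat.smul_def, smul_eq_mul] at this
    rw [mul_comm, mul_comm (φ x)]
    simpa using this
  have hq' : ∀ t : ℤ, (q.value t : ℚ) =
      ∑ a, φ (v a) * ((Ring.choose (a.2.1.value t) (a.1 + 1) : ℤ) : ℚ) := fun t => by
    have h := congrArg (fun f => φ (f.eval (t : ℝ))) hqv
    simp only [toReal_eval, xi_eval, map_sum, hφm] at h
    rw [← h]
    have := hφ1 (q.value t)
    simpa using this.symm
  have hv' : ∀ (j : Fin k) (t : ℤ), ∑ a : Fin k × P, φ (v (a.1.succ, a.2)) *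
      ((if j ≤ a.1 then Ring.choose (a.2.1.value t) (a.1.val - j.val + 1) else 0 : ℤ) : ℚ) = 0 := by
    intro j t
    have h := congrArg φ (hv j t)
    rw [map_sum, map_zero] at h
    rw [← h]
    exact Finset.sum_congr rfl fun a _ => (hφm _ _).symm
  obtain ⟨⟨D, hD⟩, hDv⟩ := IsLocalization.exist_integer_multiples_of_finite (nonZeroDivisors ℤ)
    (fun a => φ (v a))
  choose w hw using hDv
  have hD0 : D ≠ 0 := nonZeroDivisors.ne_zero hD
  have hw' : ∀ a, (w a : ℚ) = D * φ (v a) := fun a => by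
    have := hw a
    simpa [zsmul_eq_mul] using this
  refine ⟨(D * D).toNat, fun a => D * w a, ?_, fun t => ?_, fun j t => ?_⟩
  · have : 0 < D * D := mul_self_pos.mpr hD0
    omega
  · rw [Int.toNat_of_nonneg (mul_self_nonneg D)]
    have : ((D * D * q.value t : ℤ) : ℚ) =
        ((∑ a, D * w a * Ring.choose (a.2.1.value t) (a.1 + 1) : ℤ) : ℚ) := by
      push_cast
      rw [hq', Finset.mul_sum]
      refine Finset.sum_congr rfl fun a _ => ?_
      rw [hw']; ring
    exact_mod_cast this
  · have : ((∑ a : Fin k × P, D * w (a.1.succ, a.2) *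
        (if j ≤ a.1 then Ring.choose (a.2.1.value t) (a.1.val - j.val + 1) else 0) : ℤ) : ℚ) =
        D * D * ∑ a : Fin k × P, φ (v (a.1.succ, a.2)) *
      ((if j ≤ a.1 then Ring.choose (a.2.1.value t) (a.1.val - j.val + 1) else 0 : ℤ) : ℚ) := by
      rw [Finset.mul_sum, Int.cast_sum]
      refine Finset.sum_congr rfl fun a _ => ?_
      rw [Int.cast_mul, Int.cast_mul, hw']; ring
    rw [hv', mul_zero] at this
    exact_mod_cast this

/-! ### Bohr recurrence -/

/-- `R` is a set of `W`-Bohr recurrence: for finitely many integral polynomials `q ∈ W` and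
finitely many angles `α` there is `n ∈ R` with every `q(n) α` close to `0` modulo `1`. -/
def BohrRecurrence (R : Set ℤ) (W : Set (Polynomial ℝ)) : Prop :=
  ∀ Q : Finset IntegralPolynomial, (∀ q ∈ Q, q.toReal ∈ W) →
    ∀ (F : Finset UnitAddCircle), ∀ U ∈ nhds (0 : UnitAddCircle),
      ∃ n ∈ R, ∀ q ∈ Q, ∀ α ∈ F, q.value n • α ∈ U

/-! ### Characters of compact abelian groups -/

section Characters

variable {X : Type*} [AddCommGroup X] [TopologicalSpace X]

/-- The complex-valued function `x ↦ exp(2πi χ(x))` of a character `χ : X → ℝ/ℤ`. -/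
def expChar (χ : X →ₜ+ UnitAddCircle) : C(X, ℂ) where
  toFun x := (AddCircle.toCircle (χ x) : ℂ)
  continuous_toFun := continuous_subtype_val.comp (AddCircle.continuous_toCircle.comp
    (map_continuous χ))

theorem expChar_apply (χ : X →ₜ+ UnitAddCircle) (x : X) :
    expChar χ x = (AddCircle.toCircle (χ x) : ℂ) := rfl

theorem expChar_add (χ ψ : X →ₜ+ UnitAddCircle) : expChar (χ + ψ) = expChar χ * expChar ψ := by
  ext x
  simp [expChar_apply, AddCircle.toCircle_add]

theorem expChar_zero : expChar (0 : X →ₜ+ UnitAddCircle) = 1 := by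
  ext x
  simp [expChar_apply]

theorem norm_expChar_apply (χ : X →ₜ+ UnitAddCircle) (x : X) : ‖expChar χ x‖ = 1 :=
  Circle.norm_coe _

theorem expChar_apply_add (χ : X →ₜ+ UnitAddCircle) (x y : X) :
    expChar χ (x + y) = expChar χ x * expChar χ y := by
  simp [expChar_apply, AddCircle.toCircle_add]

/-- The continuous characters of `X` separate points. -/
def CharactersSeparate (X : Type*) [AddCommGroup X] [TopologicalSpace X] : Prop :=
  ∀ x : X, x ≠ 0 → ∃ χ : X →ₜ+ UnitAddCircle, χ x ≠ 0

/-- If the characters separate points, trigonometric polynomials are dense in `C(X, ℂ)`. -/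
theorem span_expChar_closure_eq_top [CompactSpace X] (hX : CharactersSeparate X) :
    (Submodule.span ℂ (Set.range (expChar (X := X)))).topologicalClosure = ⊤ := by
  let S : StarSubalgebra ℂ C(X, ℂ) :=
    { toSubalgebra := Algebra.adjoin ℂ (Set.range expChar)
      star_mem' := by
        change Algebra.adjoin ℂ (Set.range expChar) ≤ star (Algebra.adjoin ℂ (Set.range expChar))
        refine Algebra.adjoin_le ?_
        rintro _ ⟨χ, rfl⟩
        refine Algebra.subset_adjoin ⟨-χ, ?_⟩
        ext x
        change ((AddCircle.toCircle (-χ x) : Circle) : ℂ) = _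
        rw [AddCircle.toCircle_neg, Circle.coe_inv_eq_conj]
        rfl }
  have hS : S.toSubalgebra.toSubmodule = Submodule.span ℂ (Set.range expChar) := by
    apply Algebra.adjoin_eq_span_of_subset
    refine .trans (fun x => Submonoid.closure_induction (fun _ => id) ⟨0, expChar_zero⟩ ?_)
      Submodule.subset_span
    rintro _ _ _ _ ⟨χ, rfl⟩ ⟨ψ, rfl⟩
    exact ⟨χ + ψ, expChar_add χ ψ⟩
  have hsep : S.SeparatesPoints := by
    intro x y hxy
    obtain ⟨χ, hχ⟩ := hX (x - y) (sub_ne_zero.mpr hxy)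
    refine ⟨_, ⟨expChar χ, Algebra.subset_adjoin ⟨χ, rfl⟩, rfl⟩, ?_⟩
    intro h
    have h2 := AddCircle.injective_toCircle one_ne_zero (Circle.coe_injective h)
    rw [map_sub, h2, sub_self] at hχ
    exact hχ rfl
  have h := ContinuousMap.starSubalgebra_topologicalClosure_eq_top_of_separatesPoints S hsep
  rw [← hS]
  exact congrArg (Subalgebra.toSubmodule <| StarSubalgebra.toSubalgebra ·) h

theorem exists_trigPoly_near [CompactSpace X] (hX : CharactersSeparate X) (F : C(X, ℂ)) {ε : ℝ}
    (hε : 0 < ε) : ∃ t ∈ Submodule.span ℂ (Set.range (expChar (X := X))), ‖F - t‖ < ε := by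
  have hF : F ∈ (Submodule.span ℂ (Set.range (expChar (X := X)))).topologicalClosure := by
    rw [span_expChar_closure_eq_top hX]; trivial
  obtain ⟨t, ht, hd⟩ := Metric.mem_closure_iff.mp hF ε hε
  exact ⟨t, ht, by rwa [dist_eq_norm] at hd⟩

variable [IsTopologicalAddGroup X] [CompactSpace X] [MeasurableSpace X] [BorelSpace X]
  (μ : Measure X)

theorem integrable_continuousMap [IsFiniteMeasure μ] {E : Type*} [NormedAddCommGroup E]
    [SecondCountableTopology E] [TopologicalSpace.PseudoMetrizableSpace X] (F : C(X, E)) :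
    Integrable F μ :=
  Integrable.of_bound F.continuous.aestronglyMeasurable ‖F‖ (.of_forall F.norm_coe_le_norm)

theorem integral_expChar_of_ne_zero [μ.IsAddLeftInvariant] (χ : X →ₜ+ UnitAddCircle)
    (hχ : χ ≠ 0) : ∫ x, expChar χ x ∂μ = 0 := by
  obtain ⟨y, hy⟩ : ∃ y, χ y ≠ 0 := by
    by_contra! h
    exact hχ (ContinuousAddMonoidHom.ext h)
  have h := integral_add_left_eq_self (μ := μ) (fun x => expChar χ x) y
  simp only [expChar_apply_add] at h
  rw [integral_const_mul] at h
  have h1 : expChar χ y ≠ 1 := by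
    intro h1
    refine hy (AddCircle.injective_toCircle one_ne_zero (Circle.coe_injective ?_))
    rw [AddCircle.toCircle_zero]
    exact h1
  have h2 : (expChar χ y - 1) * ∫ x, expChar χ x ∂μ = 0 := by rw [sub_mul, one_mul, h, sub_self]
  exact (mul_eq_zero.mp h2).resolve_left (sub_ne_zero.mpr h1)

theorem integral_expChar_zero [IsProbabilityMeasure μ] :
    ∫ x, expChar (0 : X →ₜ+ UnitAddCircle) x ∂μ = 1 := by
  simp [expChar_zero]

theorem exists_continuous_near_indicator [TopologicalSpace.MetrizableSpace X]
    [IsProbabilityMeasure μ] {A : Set X} (hA : MeasurableSet A) {ε : ℝ} (hε : 0 < ε) :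
    ∃ g : C(X, ℝ), (∀ x, 0 ≤ g x) ∧ (∀ x, g x ≤ 1) ∧
      ∫ x, |A.indicator (fun _ => (1 : ℝ)) x - g x| ∂μ ≤ ε := by
  have hint : Integrable (A.indicator (fun _ => (1 : ℝ))) μ := (integrable_const 1).indicator hA
  obtain ⟨g, hg, hgi⟩ := hint.exists_boundedContinuous_integral_sub_le hε
  refine ⟨⟨fun x => max 0 (min 1 (g x)), by fun_prop⟩, fun x => le_max_left _ _,
    fun x => max_le zero_le_one (min_le_left _ _), le_trans (integral_mono_of_nonneg
      (.of_forall fun x => abs_nonneg _) (hint.sub hgi).norm (.of_forall fun x => ?_)) hg⟩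
  simp only [ContinuousMap.coe_mk, Pi.sub_apply, Real.norm_eq_abs]
  by_cases hx : x ∈ A
  · rw [Set.indicator_of_mem hx]
    rw [abs_le]
    rcases max_cases 0 (min 1 (g x)) with ⟨h1, h2⟩ | ⟨h1, h2⟩ <;>
    rcases min_cases 1 (g x) with ⟨h3, h4⟩ | ⟨h3, h4⟩ <;>
    rcases abs_cases (1 - g x) with ⟨h5, h6⟩ | ⟨h5, h6⟩ <;>
    constructor <;> linarith
  · rw [Set.indicator_of_notMem hx]
    rw [abs_le]
    rcases max_cases 0 (min 1 (g x)) with ⟨h1, h2⟩ | ⟨h1, h2⟩ <;>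
    rcases min_cases 1 (g x) with ⟨h3, h4⟩ | ⟨h3, h4⟩ <;>
    rcases abs_cases (0 - g x) with ⟨h5, h6⟩ | ⟨h5, h6⟩ <;>
    constructor <;> linarith

/-- A character is orthogonal to the trigonometric polynomials in which its inverse does not
occur. -/
theorem integral_trigPoly_mul_expChar_eq_zero [TopologicalSpace.MetrizableSpace X]
    [IsFiniteMeasure μ] [μ.IsAddLeftInvariant]
    {s : Set (X →ₜ+ UnitAddCircle)} {t : C(X, ℂ)} (ht : t ∈ Submodule.span ℂ (expChar '' s))
    {χ : X →ₜ+ UnitAddCircle} (hχ : -χ ∉ s) : ∫ x, t x * expChar χ x ∂μ = 0 := by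
  have hi : ∀ F : C(X, ℂ), Integrable (fun x => F x * expChar χ x) μ := fun F =>
    integrable_continuousMap μ (F * expChar χ)
  induction ht using Submodule.span_induction with
  | mem t ht =>
    obtain ⟨ψ, hψ, rfl⟩ := ht
    have : ψ + χ ≠ 0 := fun h => hχ (by rwa [← eq_neg_of_add_eq_zero_left h])
    rw [← integral_expChar_of_ne_zero μ _ this, expChar_add]
    rfl
  | zero => simp
  | add f g _ _ hf hg =>
    simp only [ContinuousMap.add_apply, add_mul]
    rw [integral_add (hi f) (hi g), hf, hg, add_zero]
  | smul c f _ hf =>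
    simp only [ContinuousMap.smul_apply, smul_eq_mul, mul_assoc]
    rw [integral_const_mul, hf, mul_zero]

theorem mem_span_image_finset {ι R M : Type*} [Semiring R] [AddCommMonoid M] [Module R M]
    {f : ι → M} {t : M} (ht : t ∈ Submodule.span R (Set.range f)) :
    ∃ s : Finset ι, t ∈ Submodule.span R (f '' s) := by
  classical
  obtain ⟨T, hT, htT⟩ := Submodule.mem_span_finite_of_mem_span ht
  obtain ⟨s, -, hs⟩ := Finset.subset_set_image_iff.mp (by simpa [Set.image_univ] using hT :
    (T : Set M) ⊆ f '' Set.univ)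
  refine ⟨s, ?_⟩
  rw [← Finset.coe_image, hs]
  exact htT

/-- A Riemann–Lebesgue lemma: along infinitely many distinct characters, the Fourier coefficients
of an indicator function cannot stay away from `0`. -/
theorem setIntegral_expChar_eq_zero_of_injective [TopologicalSpace.MetrizableSpace X]
    (hX : CharactersSeparate X)
    [IsProbabilityMeasure μ] [μ.IsAddLeftInvariant] {A : Set X} (hA : MeasurableSet A)
    (χ : ℕ → (X →ₜ+ UnitAddCircle)) (hχ : Function.Injective χ) (c : ℝ)
    (hc : ∀ n, ‖∫ x in A, expChar (χ n) x ∂μ‖ = c) : c = 0 := by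
  have hc0 : 0 ≤ c := by rw [← hc 0]; exact norm_nonneg _
  refine le_antisymm (le_of_forall_pos_le_add fun ε hε => ?_) hc0
  obtain ⟨g, -, -, hg⟩ := exists_continuous_near_indicator μ hA (half_pos hε)
  let gC : C(X, ℂ) := ⟨fun x => (g x : ℂ), by fun_prop⟩
  obtain ⟨t, ht, hgt⟩ := exists_trigPoly_near hX gC (half_pos hε)
  obtain ⟨s, hs⟩ := mem_span_image_finset ht
  -- the approximating trigonometric polynomial involves only finitely many characters
  obtain ⟨n, hn⟩ : ∃ n, -χ n ∉ (s : Set (X →ₜ+ UnitAddCircle)) := by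
    by_contra! h
    exact Set.infinite_range_of_injective (neg_injective.comp hχ)
      (s.finite_toSet.subset (Set.range_subset_iff.mpr h))
  have h0 := integral_trigPoly_mul_expChar_eq_zero μ hs hn
  have hindi : Integrable (A.indicator (fun _ => (1 : ℝ))) μ := (integrable_const 1).indicator hA
  have hgi : Integrable g μ := integrable_continuousMap μ g
  have h1 : ∫ x in A, expChar (χ n) x ∂μ =
      ∫ x, (((A.indicator (fun _ => (1 : ℝ)) x : ℝ) : ℂ) - t x) * expChar (χ n) x ∂μ := by
    have e1 : Integrable (fun x =>
        ((A.indicator (fun _ => (1 : ℝ)) x : ℝ) : ℂ) * expChar (χ n) x) μ := by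
      refine (hindi.ofReal (𝕜 := ℂ)).mul_bdd (c := 1)
        (expChar (χ n)).continuous.aestronglyMeasurable
        (.of_forall fun x => (norm_expChar_apply _ _).le)
    have e2 : Integrable (fun x => t x * expChar (χ n) x) μ :=
      integrable_continuousMap μ (t * expChar (χ n))
    simp only [sub_mul]
    rw [integral_sub e1 e2, h0, sub_zero, ← integral_indicator hA]
    refine integral_congr_ae (.of_forall fun x => ?_)
    by_cases hx : x ∈ A <;> simp [hx]
  rw [← hc n, h1]
  have hi : Integrable (fun x => |A.indicator (fun _ => (1 : ℝ)) x - g x| + ε / 2) μ :=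
    (hindi.sub hgi).abs.add (integrable_const _)
  refine (norm_integral_le_of_norm_le hi (.of_forall fun x => ?_)).trans ?_
  · rw [norm_mul, norm_expChar_apply, mul_one]
    calc ‖((A.indicator (fun _ => (1 : ℝ)) x : ℝ) : ℂ) - t x‖
        = ‖((A.indicator (fun _ => (1 : ℝ)) x - g x : ℝ) : ℂ) + (gC - t) x‖ := by
          congr 1; simp [gC]
      _ ≤ _ := by
          refine (norm_add_le _ _).trans (add_le_add ?_ ?_)
          · rw [Complex.norm_real, Real.norm_eq_abs]
          · exact ((gC - t).norm_coe_le_norm x).trans hgt.le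
  · have e3 : Integrable (fun x => |A.indicator (fun _ => (1 : ℝ)) x - g x|) μ :=
      (hindi.sub hgi).abs
    rw [integral_add e3 (integrable_const _)]
    simp only [integral_const, probReal_univ, one_smul]
    linarith

/-- Finite measures with the same Fourier coefficients agree. -/
theorem measure_ext_of_expChar [TopologicalSpace.MetrizableSpace X] (hX : CharactersSeparate X)
    (ν : Measure X) [IsFiniteMeasure μ] [IsFiniteMeasure ν]
    (h : ∀ χ : X →ₜ+ UnitAddCircle, ∫ x, expChar χ x ∂μ = ∫ x, expChar χ x ∂ν) : μ = ν := by
  have hspan : ∀ t ∈ Submodule.span ℂ (Set.range (expChar (X := X))),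
      ∫ x, t x ∂μ = ∫ x, t x ∂ν := by
    intro t ht
    induction ht using Submodule.span_induction with
    | mem t ht => obtain ⟨χ, rfl⟩ := ht; exact h χ
    | zero => simp
    | add f g _ _ hf hg =>
      simp only [ContinuousMap.add_apply]
      rw [integral_add (integrable_continuousMap μ f) (integrable_continuousMap μ g),
        integral_add (integrable_continuousMap ν f) (integrable_continuousMap ν g), hf, hg]
    | smul c f _ hf =>
      simp only [ContinuousMap.smul_apply, smul_eq_mul]
      rw [integral_const_mul, integral_const_mul, hf]
  have happ : ∀ (F t : C(X, ℂ)) (κ : Measure X) [IsFiniteMeasure κ],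
      ‖∫ x, F x ∂κ - ∫ x, t x ∂κ‖ ≤ ‖F - t‖ * κ.real Set.univ := fun F t κ _ => by
    rw [← integral_sub (integrable_continuousMap κ F) (integrable_continuousMap κ t)]
    exact norm_integral_le_of_norm_le_const (.of_forall (F - t).norm_coe_le_norm)
  have hall : ∀ F : C(X, ℂ), ∫ x, F x ∂μ = ∫ x, F x ∂ν := by
    intro F
    refine sub_eq_zero.mp (norm_le_zero_iff.mp (le_of_forall_pos_le_add fun ε hε => ?_))
    have hC : 0 < μ.real Set.univ + ν.real Set.univ + 1 := by positivity
    obtain ⟨t, ht, hFt⟩ := exists_trigPoly_near hX F (div_pos hε hC)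
    have h1 := happ F t μ
    have h2 := happ F t ν
    rw [← hspan t ht] at h2
    calc ‖∫ x, F x ∂μ - ∫ x, F x ∂ν‖ =
        ‖(∫ x, F x ∂μ - ∫ x, t x ∂μ) - (∫ x, F x ∂ν - ∫ x, t x ∂μ)‖ := by congr 1; ring
      _ ≤ ‖F - t‖ * (μ.real Set.univ + ν.real Set.univ + 1) := by
          refine (norm_sub_le _ _).trans ?_
          nlinarith [norm_nonneg (F - t)]
      _ ≤ 0 + ε := by
          rw [zero_add, ← le_div_iff₀ hC]
          exact hFt.le
  refine ext_of_forall_integral_eq_of_IsFiniteMeasure fun f => ?_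
  have := hall ⟨fun x => (f x : ℂ), by fun_prop⟩
  simp only [ContinuousMap.coe_mk] at this
  rw [integral_complex_ofReal, integral_complex_ofReal] at this
  exact_mod_cast this

/-- A criterion for ergodicity of an affine map `x ↦ a + U x`: every nontrivial character either
has an infinite orbit under `U`, or is fixed by `U` and does not vanish at `a`. -/
theorem ergodic_affine [TopologicalSpace.MetrizableSpace X] (hX : CharactersSeparate X)
    [IsProbabilityMeasure μ] [μ.IsAddLeftInvariant] (a : X) (U : X →ₜ+ X) (T : X → X)
    (hTU : ∀ x, T x = a + U x) (hT : MeasurePreserving T μ μ)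
    (hχ : ∀ χ : X →ₜ+ UnitAddCircle, χ ≠ 0 →
      (Function.Injective fun n : ℕ => (fun ψ : X →ₜ+ UnitAddCircle => ψ.comp U)^[n] χ) ∨
      (χ.comp U = χ ∧ χ a ≠ 0)) : Ergodic T μ := by
  refine ⟨hT, ⟨fun A hA hTA => ?_⟩⟩
  -- the invariance of `A` relates the Fourier coefficients of its indicator at `χ` and `χ ∘ U`
  have hcomp : ∀ χ : X →ₜ+ UnitAddCircle,
      ∫ x in A, expChar χ x ∂μ = expChar χ a * ∫ x in A, expChar (χ.comp U) x ∂μ := by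
    intro χ
    have h := setIntegral_map (μ := μ) (g := T) hA
      (by rw [hT.map_eq]; exact (expChar χ).continuous.aestronglyMeasurable)
      hT.measurable.aemeasurable
    rw [hT.map_eq, hTA] at h
    rw [h, ← integral_const_mul]
    refine integral_congr_ae (.of_forall fun x => ?_)
    simp only [hTU, expChar_apply_add]
    rfl
  have hzero : ∀ χ : X →ₜ+ UnitAddCircle, χ ≠ 0 → ∫ x in A, expChar χ x ∂μ = 0 := by
    intro χ h0
    rcases hχ χ h0 with hinj | ⟨hfix, ha⟩
    · rw [← norm_eq_zero]
      refine setIntegral_expChar_eq_zero_of_injective μ hX hA _ hinj _ fun n => ?_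
      induction n with
      | zero => rfl
      | succ n ih =>
        rw [← ih, Function.iterate_succ_apply', hcomp ((fun ψ => ψ.comp U)^[n] χ), norm_mul,
          norm_expChar_apply, one_mul]
    · have h := hcomp χ
      rw [hfix] at h
      have h1 : expChar χ a ≠ 1 := by
        intro h1
        refine ha (AddCircle.injective_toCircle one_ne_zero (Circle.coe_injective ?_))
        rw [AddCircle.toCircle_zero]
        exact h1
      have h2 : (expChar χ a - 1) * ∫ x in A, expChar χ x ∂μ = 0 := by
        rw [sub_mul, one_mul, ← h, sub_self]
      exact (mul_eq_zero.mp h2).resolve_left (sub_ne_zero.mpr h1)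
  -- only the trivial Fourier coefficient is left, so `A` is independent of every event, also of `A`
  have hmeas : μ.restrict A = μ A • μ := by
    have := μ.smul_finite (measure_ne_top μ A)
    refine measure_ext_of_expChar _ hX _ fun χ => ?_
    rw [integral_smul_measure]
    by_cases h0 : χ = 0
    · simp [h0, expChar_zero, Measure.real]
    · rw [hzero χ h0, integral_expChar_of_ne_zero μ χ h0, smul_zero]
  have hAA : μ A = μ A * μ A := by
    have := congrArg (fun ν => ν A) hmeas
    simpa using this
  rw [Filter.eventuallyConst_set']
  rcases eq_or_ne (μ A) 0 with h0 | h0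
  · exact Or.inl (ae_eq_empty.mpr h0)
  · have h1 : μ A = 1 := by
      have := ENNReal.mul_right_inj h0 (measure_ne_top μ A) (b := μ A) (c := 1)
      exact this.mp (by rw [← hAA, mul_one])
    exact Or.inr (ae_eq_univ.mpr ((prob_compl_eq_zero_iff hA).mpr h1))

end Characters

/-! ### Bohr neighbourhoods in monothetic groups -/

/-- Bogolyubov's lemma in `ℤ/N`: if `B` has density at least `1 / (4 s)`, then `B + B - B - B`
contains a Bohr set with at most `64 s²` frequencies, namely the large Fourier coefficients of
`B`. -/
theorem bogolyubov_zmod (N : ℕ) [NeZero N] (B : Finset (ZMod N)) (s : ℕ) (hs : 0 < s)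
    (hB : N ≤ 4 * s * B.card) :
    ∃ S : Finset (ZMod N), S.card ≤ 64 * s ^ 2 ∧ ∀ m : ZMod N,
      (∀ r ∈ S, 1 / 2 ≤ (ZMod.stdAddChar (r * m)).re) →
      ∃ a ∈ B, ∃ b ∈ B, ∃ c ∈ B, ∃ d ∈ B, a + b - c - d = m := by
  classical
  set ψ : AddChar (ZMod N) ℂ := ZMod.stdAddChar
  have hψ : ψ.IsPrimitive := ZMod.isPrimitive_stdAddChar N
  have hconj : ∀ x, (starRingEnd ℂ) (ψ x) = ψ (-x) := fun x =>
    (AddChar.map_neg_eq_conj ψ x).symm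
  have hN : 0 < N := Nat.pos_of_ne_zero (NeZero.ne N)
  have hB0 : 0 < B.card := by
    rcases Nat.eq_zero_or_pos B.card with h | h
    · rw [h] at hB; omega
    · exact h
  -- the Fourier transform of the indicator function of `B`
  let f : ZMod N → ℂ := fun r => ∑ b ∈ B, ψ (r * b)
  have hf0 : f 0 = B.card := by simp [f]
  have hnf : ∀ r, ((‖f r‖ ^ 2 : ℝ) : ℂ) = ∑ a ∈ B, ∑ b ∈ B, ψ (r * (a - b)) := fun r => by
    rw [← Complex.normSq_eq_norm_sq, ← Complex.mul_conj, map_sum, Finset.sum_mul_sum]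
    refine Finset.sum_congr rfl fun a _ => Finset.sum_congr rfl fun b _ => ?_
    rw [hconj, ← AddChar.map_add_eq_mul]
    congr 1; ring
  have hsum : ∀ x : ZMod N, ∑ r, ψ (r * x) = if x = 0 then (N : ℂ) else 0 := fun x => by
    rw [AddChar.sum_mulShift x hψ, ZMod.card]
    split_ifs <;> simp
  -- Parseval
  have hpars : ∑ r, ‖f r‖ ^ 2 = N * B.card := by
    have : ((∑ r, ‖f r‖ ^ 2 : ℝ) : ℂ) = N * B.card := by
      rw [Complex.ofReal_sum]
      simp only [hnf]
      rw [Finset.sum_comm]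
      simp only [Finset.sum_comm (s := Finset.univ) (t := B), hsum, sub_eq_zero]
      simp [mul_comm]
    exact_mod_cast this
  have hBr : (0 : ℝ) < B.card := by exact_mod_cast hB0
  have hsr : (0 : ℝ) < s := by exact_mod_cast hs
  have hNB : (N : ℝ) ≤ 4 * s * B.card := by exact_mod_cast hB
  -- the frequencies with `‖f r‖ ^ 2 ≥ |B| ^ 2 / (16 s)`; Parseval bounds their number
  let S : Finset (ZMod N) := Finset.univ.filter fun r => (B.card : ℝ) ^ 2 ≤ 16 * s * ‖f r‖ ^ 2
  refine ⟨S, ?_, fun m hm => ?_⟩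
  · have h1 : (S.card : ℝ) * (B.card : ℝ) ^ 2 ≤ 16 * s * (N * B.card) := by
      rw [← hpars, Finset.mul_sum, ← nsmul_eq_mul]
      refine (Finset.card_nsmul_le_sum S (fun r => 16 * s * ‖f r‖ ^ 2) _
        fun r hr => (Finset.mem_filter.mp hr).2).trans ?_
      exact Finset.sum_le_sum_of_subset_of_nonneg (Finset.subset_univ _)
        fun r _ _ => by positivity
    have h2 : (S.card : ℝ) * (B.card : ℝ) ^ 2 ≤ (64 * s ^ 2) * (B.card : ℝ) ^ 2 := by
      refine h1.trans ?_
      have := mul_le_mul_of_nonneg_left hNB (by positivity : (0 : ℝ) ≤ 16 * s * B.card)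
      nlinarith
    have h3 := le_of_mul_le_mul_right h2 (by positivity)
    exact_mod_cast h3
  · by_contra! hno
    -- `∑ᵣ ‖f r‖ ^ 4 ψ (- r m)` is `N` times the number of representations of `m`
    have hzero : ∑ r, ((‖f r‖ ^ 4 : ℝ) : ℂ) * ψ (r * (-m)) = 0 := by
      have h4 : ∀ r, ((‖f r‖ ^ 4 : ℝ) : ℂ) * ψ (r * (-m)) =
          ∑ a ∈ B, ∑ c ∈ B, ∑ b ∈ B, ∑ d ∈ B, ψ (r * (a + b - c - d - m)) := fun r => by
        rw [show ‖f r‖ ^ 4 = ‖f r‖ ^ 2 * ‖f r‖ ^ 2 by ring, Complex.ofReal_mul, hnf]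
        simp only [Finset.sum_mul, Finset.mul_sum]
        refine Finset.sum_congr rfl fun a _ => Finset.sum_congr rfl fun c _ =>
          Finset.sum_congr rfl fun b _ => Finset.sum_congr rfl fun d _ => ?_
        rw [← AddChar.map_add_eq_mul, ← AddChar.map_add_eq_mul]
        congr 1; ring
      simp only [h4]
      simp only [Finset.sum_comm (s := Finset.univ) (t := B), hsum]
      refine Finset.sum_eq_zero fun a ha => Finset.sum_eq_zero fun c hc =>
        Finset.sum_eq_zero fun b hb => Finset.sum_eq_zero fun d hd => ?_
      rw [if_neg]
      intro h
      exact hno a ha b hb c hc d hd (sub_eq_zero.mp h)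
    have hre : ∑ r, ‖f r‖ ^ 4 * (ψ (r * m)).re = 0 := by
      have := congrArg Complex.re hzero
      rw [Complex.re_sum, Complex.zero_re] at this
      rw [← this]
      refine Finset.sum_congr rfl fun r _ => ?_
      rw [Complex.re_ofReal_mul, mul_neg, ← hconj, Complex.conj_re]
    -- the frequency `0` contributes at least `|B| ^ 4 / 2`, the other large ones are nonnegative,
    -- and the small ones are controlled by Parseval, so the sum is positive
    have hge : ∀ r, (if r = 0 then (B.card : ℝ) ^ 4 / 2 else 0) -
        (B.card : ℝ) ^ 2 / (16 * s) * ‖f r‖ ^ 2 ≤ ‖f r‖ ^ 4 * (ψ (r * m)).re := by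
      intro r
      by_cases hr : r ∈ S
      · have h1 := hm r hr
        have h2 : (if r = 0 then (B.card : ℝ) ^ 4 / 2 else 0) ≤ ‖f r‖ ^ 4 * (1 / 2) := by
          split_ifs with h
          · rw [h, hf0, Complex.norm_natCast]; linarith
          · positivity
        have h3 := mul_le_mul_of_nonneg_left h1 (by positivity : 0 ≤ ‖f r‖ ^ 4)
        have h4 : 0 ≤ (B.card : ℝ) ^ 2 / (16 * s) * ‖f r‖ ^ 2 := by positivity
        linarith
      · have h0 : r ≠ 0 := by
          rintro rfl
          refine hr (Finset.mem_filter.mpr ⟨Finset.mem_univ _, ?_⟩)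
          rw [hf0, Complex.norm_natCast]
          have : (1 : ℝ) ≤ s := by exact_mod_cast hs
          nlinarith [sq_nonneg (B.card : ℝ)]
        have h1 : 16 * s * ‖f r‖ ^ 2 < (B.card : ℝ) ^ 2 := by
          by_contra! h
          exact hr (Finset.mem_filter.mpr ⟨Finset.mem_univ _, h⟩)
        have h2 : ‖f r‖ ^ 2 ≤ (B.card : ℝ) ^ 2 / (16 * s) := by
          rw [le_div_iff₀ (by positivity)]; linarith
        have h3 : -1 ≤ (ψ (r * m)).re := by
          have h4 := Complex.abs_re_le_norm (ψ (r * m))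
          rw [AddChar.norm_apply] at h4
          exact (abs_le.mp h4).1
        rw [if_neg h0]
        have h5 := mul_le_mul_of_nonneg_left h3 (by positivity : 0 ≤ ‖f r‖ ^ 4)
        have h6 := mul_le_mul_of_nonneg_right h2 (by positivity : 0 ≤ ‖f r‖ ^ 2)
        nlinarith
    have htot := Finset.sum_le_sum fun r (_ : r ∈ Finset.univ) => hge r
    rw [hre, Finset.sum_sub_distrib, Finset.sum_ite_eq' Finset.univ 0, if_pos (Finset.mem_univ _),
      ← Finset.mul_sum, hpars] at htot
    have h7 : (B.card : ℝ) ^ 2 / (16 * s) * (N * B.card) ≤ (B.card : ℝ) ^ 4 / 4 := by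
      rw [div_mul_eq_mul_div, div_le_iff₀ (by positivity)]
      have := mul_le_mul_of_nonneg_left hNB (by positivity : (0 : ℝ) ≤ (B.card : ℝ) ^ 3)
      nlinarith
    have h8 : (0 : ℝ) < (B.card : ℝ) ^ 4 := by positivity
    linarith

/-- In a compact abelian group the return times of a translation to a neighbourhood of `0` contain
a Bohr set. The frequencies are limits of those given by Bogolyubov's lemma on longer and longer
intervals. -/
theorem exists_bohr_subset {X : Type*} [AddCommGroup X] [TopologicalSpace X]
    [IsTopologicalAddGroup X] [CompactSpace X] (τ : X) {O : Set X} (hO : O ∈ nhds (0 : X)) :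
    ∃ F : Finset UnitAddCircle, ∃ U ∈ nhds (0 : UnitAddCircle),
      ∀ m : ℤ, (∀ α ∈ F, m • α ∈ U) → m • τ ∈ O := by
  classical
  obtain ⟨V, hV, hVO⟩ : ∃ V ∈ nhds (0 : X), ∀ a ∈ V, ∀ b ∈ V, ∀ c ∈ V, ∀ d ∈ V,
      a + b - c - d ∈ O := by
    have hc : Continuous fun p : X × X × X × X => p.1 + p.2.1 - p.2.2.1 - p.2.2.2 := by fun_prop
    have h0 := hc.tendsto (0, 0, 0, 0)
    simp only [add_zero, sub_zero] at h0
    have h1 := h0 hO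
    rw [nhds_prod_eq, nhds_prod_eq, nhds_prod_eq] at h1
    have h2 := Filter.mem_map.mp h1
    obtain ⟨V1, h1, W1, hW1, hs1⟩ := Filter.mem_prod_iff.mp h2
    obtain ⟨V2, h2, W2, hW2, hs2⟩ := Filter.mem_prod_iff.mp hW1
    obtain ⟨V3, h3, V4, h4, hs3⟩ := Filter.mem_prod_iff.mp hW2
    refine ⟨V1 ∩ V2 ∩ V3 ∩ V4, by simp only [Filter.inter_mem_iff]; tauto,
      fun a ha b hb c hc d hd => ?_⟩
    exact hs1 (a := (a, b, c, d)) ⟨ha.1.1.1, hs2 ⟨hb.1.1.2, hs3 ⟨hc.1.2, hd.2⟩⟩⟩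
  -- by pigeonhole, one of the finitely many translates of `V` contains a positive proportion of any
  -- stretch of the orbit of `τ`
  obtain ⟨t, ht⟩ : ∃ t : Finset X, ∀ x : X, ∃ c ∈ t, x - c ∈ V := by
    obtain ⟨t, -, ht⟩ := isCompact_univ.elim_nhds_subcover (fun c : X => {x | x - c ∈ V})
      (fun c _ => (continuous_id.sub continuous_const).continuousAt (by simpa using hV))
    exact ⟨t, fun x => by simpa using ht (Set.mem_univ x)⟩
  choose cl hclt hclV using ht
  have hs : 0 < t.card := Finset.card_pos.mpr ⟨_, hclt 0⟩
  set s := t.card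
  -- the approximate frequencies at scale `L`
  have hL : ∀ L : ℕ, ∃ α : Fin (64 * s ^ 2) → UnitAddCircle, 0 < L → ∀ m : ℤ, |m| ≤ L →
      (∀ i, 1 / 2 ≤ (AddCircle.toCircle (m • α i) : ℂ).re) → m • τ ∈ O := by
    intro L
    rcases Nat.eq_zero_or_pos L with h0 | hL0
    · exact ⟨0, fun h => absurd h (by omega)⟩
    obtain ⟨c, -, hc⟩ := Finset.exists_le_card_fiber_of_nsmul_le_card_of_maps_to
      (s := Finset.range L) (t := t) (f := fun b => cl (b • τ)) (b := (L / s : ℚ))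
      (fun b _ => hclt _) (Finset.card_pos.mp hs)
      (by rw [Finset.card_range, nsmul_eq_mul, mul_div_cancel₀ _ (by positivity)])
    set B₀ := (Finset.range L).filter fun b => cl (b • τ) = c
    have hB₀ : ∀ b ∈ B₀, b < L ∧ b • τ - c ∈ V := fun b hb => by
      have h := Finset.mem_filter.mp hb
      exact ⟨Finset.mem_range.mp h.1, by rw [← h.2]; exact hclV _⟩
    -- modulo `4 L` the sums `b₁ + b₂ - b₃ - b₄` of numbers below `L` do not wrap around
    have : NeZero (4 * L) := ⟨by omega⟩
    let B : Finset (ZMod (4 * L)) := B₀.image (Nat.cast : ℕ → ZMod (4 * L))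
    have hcard : B.card = B₀.card := by
      refine Finset.card_image_of_injOn fun b hb b' hb' h => ?_
      have := (ZMod.natCast_eq_natCast_iff' b b' _).mp h
      rwa [Nat.mod_eq_of_lt (by have := (hB₀ b hb).1; omega),
        Nat.mod_eq_of_lt (by have := (hB₀ b' hb').1; omega)] at this
    obtain ⟨S, hScard, hS⟩ := bogolyubov_zmod (4 * L) B s hs (by
      rw [hcard]
      rw [div_le_iff₀ (by positivity)] at hc
      have : L ≤ B₀.card * s := by exact_mod_cast hc
      calc 4 * L ≤ 4 * (B₀.card * s) := by omega
        _ = 4 * s * B₀.card := by ring)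
    have hemb : Nonempty (S ↪ Fin (64 * s ^ 2)) :=
      Function.Embedding.nonempty_of_card_le (by simpa using hScard)
    obtain ⟨j⟩ := hemb
    refine ⟨Function.extend j (fun r => ZMod.toAddCircle r.1) 0, fun _ m hmL hm => ?_⟩
    obtain ⟨x1, h1, x2, h2, x3, h3, x4, h4, hx⟩ := hS (m : ZMod (4 * L)) (fun r hr => by
      have := hm (j ⟨r, hr⟩)
      rw [j.injective.extend_apply] at this
      rw [mul_comm r, ← zsmul_eq_mul]
      change 1 / 2 ≤ (AddCircle.toCircle (ZMod.toAddCircle (m • r)) : ℂ).re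
      rwa [map_zsmul])
    obtain ⟨b1, hb1, rfl⟩ := Finset.mem_image.mp h1
    obtain ⟨b2, hb2, rfl⟩ := Finset.mem_image.mp h2
    obtain ⟨b3, hb3, rfl⟩ := Finset.mem_image.mp h3
    obtain ⟨b4, hb4, rfl⟩ := Finset.mem_image.mp h4
    have hm' : (b1 : ℤ) + b2 - b3 - b4 = m := by
      have h5 : (((b1 : ℤ) + b2 - b3 - b4 : ℤ) : ZMod (4 * L)) = (m : ZMod (4 * L)) := by
        push_cast; exact hx
      rw [ZMod.intCast_eq_intCast_iff_dvd_sub] at h5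
      have g1 := (hB₀ b1 hb1).1
      have g2 := (hB₀ b2 hb2).1
      have g3 := (hB₀ b3 hb3).1
      have g4 := (hB₀ b4 hb4).1
      have h6 := abs_le.mp hmL
      have h7 := Int.eq_zero_of_abs_lt_dvd h5 (by rw [abs_lt]; push_cast; omega)
      omega
    have := hVO _ (hB₀ b1 hb1).2 _ (hB₀ b2 hb2).2 _ (hB₀ b3 hb3).2 _ (hB₀ b4 hb4).2
    rw [← hm']
    convert this using 1
    simp only [sub_smul, add_smul, natCast_zsmul]
    abel
  choose α hα using hL
  -- the number of frequencies does not depend on `L`, so they have a cluster point as `L → ∞`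
  obtain ⟨β, hβ⟩ : ∃ β, MapClusterPt β Filter.atTop α := by
    obtain ⟨β, -, hβ⟩ := isCompact_univ (X := Fin (64 * s ^ 2) → UnitAddCircle)
      (f := Filter.map α Filter.atTop) (by simp)
    exact ⟨β, hβ⟩
  have hcont : Continuous fun x : UnitAddCircle => (AddCircle.toCircle x : ℂ).re :=
    Complex.continuous_re.comp (continuous_subtype_val.comp AddCircle.continuous_toCircle)
  have hU : ∀ᶠ x in nhds (0 : UnitAddCircle), 1 / 2 < (AddCircle.toCircle x : ℂ).re :=
    hcont.continuousAt.eventually (lt_mem_nhds (by simp; norm_num))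
  refine ⟨Finset.univ.image β, _, hU, fun m hm => ?_⟩
  have h1 : ∀ᶠ γ in nhds β, ∀ i, 1 / 2 < (AddCircle.toCircle (m • γ i) : ℂ).re := by
    rw [Filter.eventually_all]
    intro i
    have : Continuous fun γ : Fin (64 * s ^ 2) → UnitAddCircle =>
      (AddCircle.toCircle (m • γ i) : ℂ).re := hcont.comp (by fun_prop)
    exact this.continuousAt.eventually
      (lt_mem_nhds (hm _ (Finset.mem_image_of_mem _ (Finset.mem_univ i))))
  obtain ⟨L, hL1, hL2⟩ := ((hβ.frequently h1).and_eventually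
    (Filter.eventually_ge_atTop (m.natAbs + 1))).exists
  exact hα L (by omega) m (by rw [Int.abs_eq_natAbs]; omega) fun i => (hL1 i).le

/-! ### Recurrence for Kronecker systems is Bohr recurrence -/

section Translates

variable {X : Type*} [AddCommGroup X] [TopologicalSpace X] [IsTopologicalAddGroup X]
  [CompactSpace X] [TopologicalSpace.MetrizableSpace X] [MeasurableSpace X] [BorelSpace X]
  (μ : Measure X) [IsFiniteMeasure μ] [μ.IsAddLeftInvariant]

open scoped Pointwise in
theorem eventually_measure_diff_translate_lt {A : Set X} (hA : MeasurableSet A) {δ : ENNReal}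
    (hδ : δ ≠ 0) : ∀ᶠ h in nhds (0 : X), μ (A \ (fun x => h + x) ⁻¹' A) < δ := by
  let _ := TopologicalSpace.metrizableSpaceMetric X
  have hδ2 : δ / 2 ≠ 0 := by simpa using hδ
  obtain ⟨K, hKA, hK, hAK⟩ := hA.exists_isClosed_sdiff_lt (μ := μ) (measure_ne_top μ A) hδ2
  have h1 := tendsto_measure_vadd_sdiff_isCompact_isClosed (μ := μ) hK.isCompact hK
  filter_upwards [h1.eventually (gt_mem_nhds (pos_iff_ne_zero.mpr hδ2))] with h hh
  have hsub : A \ (fun x => h + x) ⁻¹' A ⊆ (A \ K) ∪ (fun x => h + x) ⁻¹' ((h +ᵥ K) \ K) := by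
    intro x hx
    by_cases hxK : x ∈ K
    · exact Or.inr ⟨Set.vadd_mem_vadd_set hxK, fun h' => hx.2 (hKA h')⟩
    · exact Or.inl ⟨hx.1, hxK⟩
  calc μ (A \ (fun x => h + x) ⁻¹' A) ≤ μ (A \ K) + μ ((fun x => h + x) ⁻¹' ((h +ᵥ K) \ K)) :=
        (measure_mono hsub).trans (measure_union_le _ _)
    _ < δ / 2 + δ / 2 := by
        rw [measure_preimage_add]
        exact ENNReal.add_lt_add hAK hh
    _ = δ := ENNReal.add_halves δ

/-- Finitely many small translates of a set of positive measure meet in a substantial set. -/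
theorem exists_nhds_half_le_measure_inter_translates {A : Set X} (hA : MeasurableSet A)
    (ι : Type*) [Fintype ι] : ∃ O ∈ nhds (0 : X), ∀ h : ι → X, (∀ i, h i ∈ O) →
      μ.real A / 2 ≤ μ.real (A ∩ ⋂ i, (fun x => h i + x) ⁻¹' A) := by
  rcases eq_or_ne (μ A) 0 with h0 | h0
  · exact ⟨Set.univ, Filter.univ_mem, fun h _ => by simp [Measure.real, h0]⟩
  have hpos : 0 < μ.real A := ENNReal.toReal_pos h0 (measure_ne_top _ _)
  have hδ : 0 < μ.real A / (2 * (Fintype.card ι + 1)) := by positivity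
  refine ⟨_, eventually_measure_diff_translate_lt μ hA
    (δ := ENNReal.ofReal (μ.real A / (2 * (Fintype.card ι + 1)))) (by simpa using hδ),
    fun h hh => ?_⟩
  have hsub : A ⊆ (A ∩ ⋂ i, (fun x => h i + x) ⁻¹' A) ∪ ⋃ i, A \ (fun x => h i + x) ⁻¹' A := by
    intro x hx
    by_cases hx' : ∀ i, h i + x ∈ A
    · exact Or.inl ⟨hx, Set.mem_iInter.mpr hx'⟩
    · push Not at hx'
      obtain ⟨i, hi⟩ := hx'
      exact Or.inr (Set.mem_iUnion.mpr ⟨i, hx, hi⟩)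
  have h1 : μ.real A ≤ μ.real (A ∩ ⋂ i, (fun x => h i + x) ⁻¹' A) +
      ∑ i, μ.real (A \ (fun x => h i + x) ⁻¹' A) :=
    (measureReal_mono hsub).trans ((measureReal_union_le _ _).trans
      (add_le_add le_rfl (measureReal_iUnion_fintype_le _)))
  have h2 : ∑ i, μ.real (A \ (fun x => h i + x) ⁻¹' A) ≤
      ∑ _i : ι, μ.real A / (2 * (Fintype.card ι + 1)) :=
    Finset.sum_le_sum fun i _ => ENNReal.toReal_le_of_le_ofReal hδ.le (hh i).le
  have h3 : ∑ _i : ι, μ.real A / (2 * (Fintype.card ι + 1)) ≤ μ.real A / 2 := by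
    rw [Finset.sum_const, Finset.card_univ, nsmul_eq_mul, mul_div_assoc', div_le_div_iff₀
      (by positivity) (by positivity)]
    nlinarith
  linarith

end Translates

/-- The Haar probability measure of a compact abelian group. -/
def haarProb (X : Type*) [AddCommGroup X] [TopologicalSpace X] [IsTopologicalAddGroup X]
    [CompactSpace X] [MeasurableSpace X] [BorelSpace X] : Measure X :=
  Measure.addHaarMeasure ⊤

section HaarProb

variable (X : Type*) [AddCommGroup X] [TopologicalSpace X] [IsTopologicalAddGroup X]
    [CompactSpace X] [MeasurableSpace X] [BorelSpace X]

instance : (haarProb X).IsAddHaarMeasure := by unfold haarProb; infer_instance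

instance : IsProbabilityMeasure (haarProb X) :=
  ⟨by
    have := Measure.addHaarMeasure_self (K₀ := (⊤ : TopologicalSpace.PositiveCompacts X))
    simpa [haarProb] using this⟩

end HaarProb

theorem zpow_translation {X : Type*} [AddCommGroup X] [TopologicalSpace X] (T : X ≃ₜ X) (τ : X)
    (hT : ∀ x, T x = τ + x) (m : ℤ) (x : X) : (T ^ m) x = m • τ + x := by
  have := homeomorph_zpow_apply_eq T (fun m : ℤ => m • τ + x)
    (fun m => by rw [hT, add_smul, one_smul]; abel) m
  simpa using this

/-- The return times of a translation to a small neighbourhood of `0` contain a Bohr set, and a set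
of positive measure meets its small translates. -/
theorem measurableRecurrence_kronecker_of_bohr {R : Set ℤ} {W : Set (Polynomial ℝ)}
    (h : BohrRecurrence R W) : MeasurableRecurrenceReal R W kroneckerSystems := by
  rintro Q hQ S ⟨_, _, hHaar, -, τ, hτ⟩ A hA hμA
  obtain ⟨O, hO, hOA⟩ := exists_nhds_half_le_measure_inter_translates S.μ hA Q
  obtain ⟨F, U, hU, hF⟩ := exists_bohr_subset τ hO
  obtain ⟨n, hn, hnq⟩ := h Q hQ F U hU
  refine ⟨n, hn, ?_⟩
  have h1 := hOA (fun q => q.1.value n • τ) fun q => hF _ (hnq q.1 q.2)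
  have h2 : 0 < S.μ.real A := ENNReal.toReal_pos hμA.ne' (measure_ne_top _ _)
  have h3 : A ∩ ⋂ q ∈ Q, (S.T ^ q.value n) ⁻¹' A =
      A ∩ ⋂ q : Q, (fun x => q.1.value n • τ + x) ⁻¹' A := by
    ext x
    simp [zpow_translation S.T τ hτ]
  rw [h3]
  exact (ENNReal.toReal_pos_iff.mp (lt_of_lt_of_le (half_pos h2) h1)).1

theorem topologicalRecurrence_of_measurable {R : Set ℤ} {Q : Finset IntegralPolynomial}
    {C : Set System} (hC : ∀ S ∈ C, S.μ.IsOpenPosMeasure) (h : MeasurableRecurrence R Q C) :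
    TopologicalRecurrence R Q C := by
  intro S hS V hV hne
  have := hC S hS
  obtain ⟨n, hn, hpos⟩ := h S hS V hV.measurableSet (hV.measure_pos S.μ hne)
  exact ⟨n, hn, nonempty_of_measure_ne_zero hpos.ne'⟩

theorem isOpenPosMeasure_of_isKronecker {S : System} (h : S.IsKronecker) :
    S.μ.IsOpenPosMeasure := by
  obtain ⟨_, _, hHaar, -⟩ := h
  infer_instance

theorem isOpenPosMeasure_of_isWeyl {S : System} (h : S.IsWeyl) : S.μ.IsOpenPosMeasure := by
  obtain ⟨_, _, _, hHaar, -⟩ := h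
  infer_instance

/-- Recurrence for Kronecker systems, applied to a translation with dense orbits, which is ergodic
for Haar measure. -/
theorem exists_return_of_denseRange {R : Set ℤ} {Q : Finset IntegralPolynomial}
    (h : TopologicalRecurrence R Q kroneckerSystems) {X : Type} [AddCommGroup X]
    [TopologicalSpace X] [IsTopologicalAddGroup X] [CompactSpace X]
    [TopologicalSpace.MetrizableSpace X] {τ : X} (hτ : DenseRange fun m : ℤ => m • τ)
    {V : Set X} (hV : IsOpen V) (hne : V.Nonempty) :
    ∃ n ∈ R, ∃ x ∈ V, ∀ q ∈ Q, q.value n • τ + x ∈ V := by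
  borelize X
  have herg : Ergodic (fun x => τ + x) (haarProb X) := ergodic_add_left_of_denseRange_zsmul hτ _
  obtain ⟨n, hn, x, hxV, hx⟩ := h
    { X := X
      μ := haarProb X
      T := Homeomorph.addLeft τ
      invariant := herg.toMeasurePreserving }
    ⟨inferInstance, inferInstance, inferInstanceAs (haarProb X).IsAddHaarMeasure, herg, τ,
      fun x => rfl⟩ V hV hne
  refine ⟨n, hn, x, hxV, fun q hq => ?_⟩
  rw [← zpow_translation (Homeomorph.addLeft τ) τ (fun _ => rfl) (q.value n) x]
  exact Set.mem_iInter₂.mp hx q hq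

/-- Any translation of a compact metrizable abelian group returns near `0`: restrict it to the
closed subgroup that it generates. -/
theorem exists_return_near_zero {R : Set ℤ} {Q : Finset IntegralPolynomial}
    (h : TopologicalRecurrence R Q kroneckerSystems) {Y : Type} [AddCommGroup Y]
    [TopologicalSpace Y] [IsTopologicalAddGroup Y] [CompactSpace Y]
    [TopologicalSpace.MetrizableSpace Y] (τ : Y) {V : Set Y} (hV : IsOpen V) (h0 : (0 : Y) ∈ V) :
    ∃ n ∈ R, ∃ x ∈ V, ∀ q ∈ Q, q.value n • τ + x ∈ V := by
  let H : AddSubgroup Y := (AddSubgroup.zmultiples τ).topologicalClosure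
  have hHc : IsClosed (H : Set Y) := AddSubgroup.isClosed_topologicalClosure _
  have : CompactSpace H := isCompact_iff_compactSpace.mp hHc.isCompact
  have : TopologicalSpace.MetrizableSpace H := Topology.IsEmbedding.subtypeVal.metrizableSpace
  let τ' : H := ⟨τ, AddSubgroup.le_topologicalClosure _ (AddSubgroup.mem_zmultiples τ)⟩
  have hdense : DenseRange fun m : ℤ => m • τ' := by
    intro x
    rw [closure_subtype]
    have hx : (x : Y) ∈ closure (AddSubgroup.zmultiples τ : Set _) := x.2
    refine closure_mono ?_ hx
    rintro _ ⟨m, rfl⟩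
    exact ⟨m • τ', ⟨m, rfl⟩, rfl⟩
  obtain ⟨n, hn, x, hxV, hx⟩ := exists_return_of_denseRange h hdense
    (hV.preimage continuous_subtype_val) ⟨0, h0⟩
  exact ⟨n, hn, x, hxV, hx⟩

/-- Finitely many angles are a point of a torus, whose translation returns near `0`. -/
theorem bohr_of_topologicalRecurrence_kronecker {R : Set ℤ} {W : Set (Polynomial ℝ)}
    (h : TopologicalRecurrenceReal R W kroneckerSystems) : BohrRecurrence R W := by
  intro Q hQ F U hU
  let τ : F → UnitAddCircle := fun α => α.1
  have hsub : Filter.Tendsto (fun x : UnitAddCircle × UnitAddCircle => x.1 - x.2)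
      (nhds 0 ×ˢ nhds 0) (nhds 0) := by
    rw [← nhds_prod_eq]
    exact Continuous.tendsto' (by fun_prop) _ _ (sub_zero 0)
  obtain ⟨V₀, hV₀, hVU⟩ := Filter.mem_prod_same_iff.mp (hsub hU)
  obtain ⟨V, hVV, hV, h0⟩ := mem_nhds_iff.mp hV₀
  obtain ⟨n, hn, x, hxV, hx⟩ := exists_return_near_zero (h Q hQ) τ
    (V := Set.univ.pi fun _ => V) (isOpen_set_pi Set.finite_univ fun _ _ => hV) (fun _ _ => h0)
  refine ⟨n, hn, fun q hq α hα => ?_⟩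
  have e1 : q.value n • α + x ⟨α, hα⟩ ∈ V := hx q hq ⟨α, hα⟩ trivial
  have e2 : x ⟨α, hα⟩ ∈ V := hxV ⟨α, hα⟩ trivial
  -- the return is of some point near `0`; its displacement is the difference of two small elements
  have := hVU (Set.mk_mem_prod (hVV e1) (hVV e2))
  rwa [Set.mem_preimage, add_sub_cancel_right] at this

/-! ### Growth of perturbations in nilsystems -/

section Nil

variable {G : Type*} [Group G] [TopologicalSpace G] [IsTopologicalGroup G]

open scoped commutatorElement in
/-- In a group with `G_{d+1} = 1` the element `γ ^ d a γ ^ (-d)` is a word in the elements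
`γ ^ j a γ ^ (-j)`, `j < d`, so it is close to `1` when they are. The induction passes from `a` to
the commutator `a⁻¹ γ a γ⁻¹`, which lies one step further down the lower central series. -/
theorem exists_nhds_conj_mem {d : ℕ} (hG : (⊤ : Subgroup G).lowerCentralSeries d = ⊥) :
    ∀ e ≤ d, ∀ W ∈ nhds (1 : G), ∃ W' ∈ nhds (1 : G), ∀ γ a : G,
      a ∈ (⊤ : Subgroup G).lowerCentralSeries (d - e) →
      (∀ j < e, γ ^ j * a * (γ ^ j)⁻¹ ∈ W') → γ ^ e * a * (γ ^ e)⁻¹ ∈ W := by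
  intro e
  induction e with
  | zero =>
    intro _ W hW
    refine ⟨W, hW, fun γ a ha _ => ?_⟩
    rw [Nat.sub_zero, hG, Subgroup.mem_bot] at ha
    simpa [ha] using mem_of_mem_nhds hW
  | succ e ih =>
    intro he W hW
    obtain ⟨W1, hW1, hmul⟩ : ∃ W1 ∈ nhds (1 : G), ∀ a ∈ W1, ∀ b ∈ W1, a * b ∈ W := by
      have hc : Filter.Tendsto (fun x : G × G => x.1 * x.2) (nhds 1 ×ˢ nhds 1) (nhds 1) := by
        rw [← nhds_prod_eq]
        exact Continuous.tendsto' (by fun_prop) _ _ (mul_one 1)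
      obtain ⟨V, hV, h⟩ := Filter.mem_prod_same_iff.mp (hc hW)
      exact ⟨V, hV, fun a ha b hb => h (Set.mk_mem_prod ha hb)⟩
    obtain ⟨W2, hW2, hih⟩ := ih (by omega) W1 hW1
    obtain ⟨W3, hW3, hdiv⟩ : ∃ W3 ∈ nhds (1 : G), ∀ a ∈ W3, ∀ b ∈ W3, a⁻¹ * b ∈ W2 := by
      have hc : Filter.Tendsto (fun x : G × G => x.1⁻¹ * x.2) (nhds 1 ×ˢ nhds 1) (nhds 1) := by
        rw [← nhds_prod_eq]
        exact Continuous.tendsto' (by fun_prop) _ _ (by simp)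
      obtain ⟨V, hV, h⟩ := Filter.mem_prod_same_iff.mp (hc hW2)
      exact ⟨V, hV, fun a ha b hb => h (Set.mk_mem_prod ha hb)⟩
    refine ⟨W1 ∩ W3, Filter.inter_mem hW1 hW3, fun γ a ha hj => ?_⟩
    have hc : a⁻¹ * γ * a * γ⁻¹ ∈ (⊤ : Subgroup G).lowerCentralSeries (d - e) := by
      have h1 : ⁅a⁻¹, γ⁆ ∈ (⊤ : Subgroup G).lowerCentralSeries (d - (e + 1) + 1) :=
        Subgroup.commutator_mem_commutator (inv_mem ha) (Subgroup.mem_top γ)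
      rw [show d - (e + 1) + 1 = d - e by omega, commutatorElement_def, inv_inv] at h1
      exact h1
    have h2 : ∀ j : ℕ, γ ^ j * (a⁻¹ * γ * a * γ⁻¹) * (γ ^ j)⁻¹ =
        (γ ^ j * a * (γ ^ j)⁻¹)⁻¹ * (γ ^ (j + 1) * a * (γ ^ (j + 1))⁻¹) := fun j => by
      rw [pow_succ]; group
    have h3 := hih γ _ hc fun j hje => by
      rw [h2]
      exact hdiv _ (hj j (by omega)).2 _ (hj (j + 1) (by omega)).2
    have h4 := hmul _ (hj e (by omega)).1 _ h3
    rwa [h2, mul_inv_cancel_left] at h4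

variable (Γ : Subgroup G) [DiscreteTopology Γ] [CompactSpace (G ⧸ Γ)]

/-- Near the identity, a group acts freely on its quotient by a discrete cocompact subgroup, and
uniformly so. -/
theorem exists_nhds_smul_injective : ∃ W ∈ nhds (1 : G), IsOpen W ∧
    (∀ p : G ⧸ Γ, ∀ w ∈ W, w • p = p → w = 1) ∧
    (∀ p : G ⧸ Γ, ∀ v ∈ W, ∀ w ∈ W, v • p = w • p → v = w) := by
  obtain ⟨V, hV, hVΓ⟩ : ∃ V ∈ nhds (1 : G), ∀ γ ∈ Γ, γ ∈ V → γ = 1 := by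
    have h1 : ({1} : Set Γ) ∈ nhds (1 : Γ) := by simp
    rw [nhds_subtype_eq_comap, Filter.mem_comap] at h1
    obtain ⟨V, hV, h⟩ := h1
    exact ⟨V, hV, fun γ hγ hγV => congrArg Subtype.val (h (a := ⟨γ, hγ⟩) hγV)⟩
  have hloc : ∀ p : G ⧸ Γ, ∀ᶠ x : G × (G ⧸ Γ) in nhds (1, p), x.1 • x.2 = x.2 → x.1 = 1 := by
    intro p
    induction p using QuotientGroup.induction_on with
    | H k =>
      have hq : Filter.map (Prod.map id ((↑) : G → G ⧸ Γ)) (nhds ((1 : G), k)) =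
          nhds ((1 : G), (k : G ⧸ Γ)) :=
        IsOpenMap.map_nhds_eq (IsOpenMap.id.prodMap QuotientGroup.isOpenMap_coe)
          (continuous_id.prodMap QuotientGroup.continuous_mk).continuousAt
      rw [← hq, Filter.eventually_map]
      have hc : Filter.Tendsto (fun x : G × G => x.2⁻¹ * x.1 * x.2) (nhds (1, k)) (nhds 1) :=
        Continuous.tendsto' (by fun_prop) _ _ (by simp)
      filter_upwards [hc hV] with x hx hfix
      have h1 : x.2⁻¹ * (x.1 * x.2) ∈ Γ := by
        have : ((x.1 * x.2 : G) : G ⧸ Γ) = (x.2 : G ⧸ Γ) := hfix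
        exact QuotientGroup.eq.mp this.symm
      have h2 := hVΓ _ h1 (by rw [← mul_assoc]; exact hx)
      have h3 : x.1 * x.2 = x.2 := by
        rw [inv_mul_eq_one] at h2; exact h2.symm
      exact mul_eq_right.mp h3
  have hunif : ∀ᶠ w in nhds (1 : G), ∀ p ∈ (Set.univ : Set (G ⧸ Γ)), w • p = p → w = 1 :=
    isCompact_univ.eventually_forall_of_forall_eventually fun p _ => hloc p
  obtain ⟨V', hV', hdiv⟩ : ∃ V' ∈ nhds (1 : G), ∀ a ∈ V', ∀ b ∈ V', ∀ p : G ⧸ Γ,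
      (a⁻¹ * b) • p = p → a⁻¹ * b = 1 := by
    have hc : Filter.Tendsto (fun x : G × G => x.1⁻¹ * x.2) (nhds 1 ×ˢ nhds 1) (nhds 1) := by
      rw [← nhds_prod_eq]
      exact Continuous.tendsto' (by fun_prop) _ _ (by simp)
    obtain ⟨V, hV, h⟩ := Filter.mem_prod_same_iff.mp (hc hunif)
    exact ⟨V, hV, fun a ha b hb p => h (Set.mk_mem_prod ha hb) p trivial⟩
  obtain ⟨W, hWV, hWo, h1W⟩ := mem_nhds_iff.mp (Filter.inter_mem hV' hunif)
  refine ⟨W, hWo.mem_nhds h1W, hWo, fun p w hw h => (hWV hw).2 p trivial h,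
    fun p v hv w hw h => ?_⟩
  have h2 := hdiv v (hWV hv).1 w (hWV hw).1 p (by rw [mul_smul, ← h, inv_smul_smul])
  exact inv_mul_eq_one.mp h2

/-- Points of `X ≃ G / Γ` that differ by a small element are moved into each other by a small
element of `G`, uniformly. -/
theorem exists_nhds_eq_smul {X : Type*} [AddCommGroup X] [TopologicalSpace X]
    [IsTopologicalAddGroup X] [CompactSpace X] (h : (G ⧸ Γ) ≃ₜ X) {W : Set G}
    (hW : W ∈ nhds (1 : G)) :
    ∃ O ∈ nhds (0 : X), ∀ x : X, ∀ v ∈ O, ∃ w ∈ W, h.symm (x + v) = w • h.symm x := by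
  have hdiag : ∀ p : G ⧸ Γ, ∀ᶠ x : (G ⧸ Γ) × (G ⧸ Γ) in nhds (p, p), ∃ w ∈ W, x.2 = w • x.1 := by
    intro p
    induction p using QuotientGroup.induction_on with
    | H k =>
      have hq : Filter.map (Prod.map ((↑) : G → G ⧸ Γ) ((↑) : G → G ⧸ Γ)) (nhds (k, k)) =
          nhds ((k : G ⧸ Γ), (k : G ⧸ Γ)) :=
        IsOpenMap.map_nhds_eq (QuotientGroup.isOpenMap_coe.prodMap QuotientGroup.isOpenMap_coe)
          (QuotientGroup.continuous_mk.prodMap QuotientGroup.continuous_mk).continuousAt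
      rw [← hq, Filter.eventually_map]
      have hc : Filter.Tendsto (fun x : G × G => x.2 * x.1⁻¹) (nhds (k, k)) (nhds 1) :=
        Continuous.tendsto' (by fun_prop) _ _ (by simp)
      filter_upwards [hc hW] with x hx
      refine ⟨x.2 * x.1⁻¹, hx, ?_⟩
      change (x.2 : G ⧸ Γ) = ((x.2 * x.1⁻¹ * x.1 : G) : G ⧸ Γ)
      rw [inv_mul_cancel_right]
  have hloc : ∀ x : X, ∀ᶠ y : X × X in nhds (0, x), ∃ w ∈ W,
      h.symm (y.2 + y.1) = w • h.symm y.2 := by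
    intro x
    have hc : Filter.Tendsto (fun y : X × X => (h.symm y.2, h.symm (y.2 + y.1))) (nhds (0, x))
        (nhds (h.symm x, h.symm x)) :=
      Continuous.tendsto' (by fun_prop) _ _ (by simp)
    exact hc.eventually (hdiag (h.symm x))
  have hunif : ∀ᶠ v in nhds (0 : X), ∀ x ∈ (Set.univ : Set X), ∃ w ∈ W,
      h.symm (x + v) = w • h.symm x :=
    isCompact_univ.eventually_forall_of_forall_eventually fun x _ => hloc x
  exact ⟨_, hunif, fun x v hv => hv x trivial⟩

/-- Small elements of `G` move all points of `X ≃ G / Γ` by small amounts. -/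
theorem exists_nhds_smul_sub_mem {X : Type*} [AddCommGroup X] [TopologicalSpace X]
    [IsTopologicalAddGroup X] (h : (G ⧸ Γ) ≃ₜ X) {O : Set X} (hO : O ∈ nhds (0 : X)) :
    ∃ W ∈ nhds (1 : G), ∀ w ∈ W, ∀ p : G ⧸ Γ, h (w • p) - h p ∈ O := by
  have hloc : ∀ p : G ⧸ Γ, ∀ᶠ x : G × (G ⧸ Γ) in nhds (1, p), h (x.1 • x.2) - h x.2 ∈ O := by
    intro p
    have hc : Filter.Tendsto (fun x : G × (G ⧸ Γ) => h (x.1 • x.2) - h x.2) (nhds (1, p))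
        (nhds 0) := Continuous.tendsto' (by fun_prop) _ _ (by simp)
    exact hc.eventually hO
  have hunif : ∀ᶠ w in nhds (1 : G), ∀ p ∈ (Set.univ : Set (G ⧸ Γ)), h (w • p) - h p ∈ O :=
    isCompact_univ.eventually_forall_of_forall_eventually fun p _ => hloc p
  exact ⟨_, hunif, fun w hw p => hw p trivial⟩

/-- A continuous path in `G / Γ` that stays within `W • p` lifts to a continuous path in `W`. -/
theorem continuous_lift {W : Set G} (hW : IsOpen W) {p : G ⧸ Γ}
    (hinj : ∀ v ∈ W, ∀ w ∈ W, v • p = w • p → v = w) {I : Type*} [TopologicalSpace I] (b : I → G)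
    (hbW : ∀ t, b t ∈ W) (hb : Continuous fun t => b t • p) : Continuous b := by
  have hopen : IsOpenMap fun w : G => w • p := by
    induction p using QuotientGroup.induction_on with
    | H k => exact QuotientGroup.isOpenMap_coe.comp (isOpenMap_mul_right k)
  have hcont : Continuous fun w : G => w • p := by fun_prop
  have hemb : Topology.IsOpenEmbedding fun w : W => (w : G) • p :=
    Topology.IsOpenEmbedding.of_continuous_injective_isOpenMap
      (hcont.comp continuous_subtype_val)
      (fun v w h => Subtype.ext (hinj v v.2 w w.2 h)) (hopen.comp hW.isOpenMap_subtype_val)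
  have : Continuous fun t => (⟨b t, hbW t⟩ : W) := hemb.isInducing.continuous_iff.mpr hb
  exact continuous_subtype_val.comp this

end Nil

/-- In a `d`-step nilsystem realized by an affine map with linear part `U`, a path of perturbations
that stays small at the times `0, n, …, (d - 1) n` is small at time `d n`. -/
theorem eventually_iterate_mem_of_isStepNilsystem {X : Type} [AddCommGroup X]
    [TopologicalSpace X] [IsTopologicalAddGroup X] [CompactSpace X] {T : X ≃ₜ X} {a : X}
    {U : X →+ X} (hT : ∀ x, T x = a + U x) {d : ℕ} (hd : 1 ≤ d) (hnil : IsStepNilsystem d T)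
    (n : ℕ → ℕ) (y : ℕ → unitInterval → X) (hyc : ∀ s, Continuous (y s)) (hy0 : ∀ s, y s 0 = 0)
    (hsmall : ∀ j < d, ∀ O ∈ nhds (0 : X), ∀ᶠ s in Filter.atTop, ∀ t, (U^[j * n s]) (y s t) ∈ O)
    {O : Set X} (hO : O ∈ nhds (0 : X)) :
    ∀ᶠ s in Filter.atTop, (U^[d * n s]) (y s 1) ∈ O := by
  obtain ⟨G, _, _, _, -, hG, Γ, hΓ, hcpt, g, h, hg⟩ := hnil
  have hUT : ∀ (m : ℕ) (x v : X), (T^[m]) (x + v) = (T^[m]) x + (U^[m]) v := by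
    intro m
    induction m with
    | zero => intro x v; rfl
    | succ m ih =>
      intro x v
      rw [Function.iterate_succ_apply', Function.iterate_succ_apply', Function.iterate_succ_apply',
        ih, hT, hT, map_add, add_assoc]
  have hgT : ∀ (m : ℕ) (p : G ⧸ Γ), h (g ^ m • p) = (T^[m]) (h p) := by
    intro m
    induction m with
    | zero => intro p; simp
    | succ m ih => intro p; rw [Function.iterate_succ_apply', pow_succ', mul_smul, hg, ih]
  have hgT' : ∀ (m : ℕ) (x : X), g ^ m • h.symm x = h.symm ((T^[m]) x) := fun m x => by
    rw [← h.symm_apply_apply (g ^ m • h.symm x), hgT, h.apply_symm_apply]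
  obtain ⟨W, hW1, hWo, hWfix, hWinj⟩ := exists_nhds_smul_injective Γ
  obtain ⟨W₁, hW₁, hW₁O⟩ := exists_nhds_smul_sub_mem Γ h hO
  obtain ⟨W₂, hW₂, hconj⟩ := exists_nhds_conj_mem hG d le_rfl W₁ hW₁
  obtain ⟨O', hO', hO'W⟩ := exists_nhds_eq_smul Γ h (Filter.inter_mem hW1 hW₂)
  have hall : ∀ᶠ s in Filter.atTop, ∀ j < d, ∀ t, (U^[j * n s]) (y s t) ∈ O' :=
    (Filter.eventually_all_finite (Set.finite_lt_nat d)).mpr fun j hj => hsmall j hj O' hO'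
  filter_upwards [hall] with s hs
  set γ := g ^ n s
  -- the orbit of the base point, and the orbits of its perturbations
  let p : ℕ → G ⧸ Γ := fun j => h.symm ((T^[j * n s]) 0)
  let q : ℕ → unitInterval → G ⧸ Γ := fun j t => h.symm ((T^[j * n s]) (y s t))
  have hp : ∀ j, γ ^ j • p 0 = p j := fun j => by
    simp only [p, γ, ← pow_mul, hgT', zero_mul, Function.iterate_zero, id]
    rw [mul_comm]
  have hq : ∀ j t, γ ^ j • q 0 t = q j t := fun j t => by
    simp only [q, γ, ← pow_mul, hgT', zero_mul, Function.iterate_zero, id]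
    rw [mul_comm]
  have hq0 : ∀ j, q j 0 = p j := fun j => by simp only [q, p, hy0]
  have hex : ∀ j, ∃ b : unitInterval → G, j < d → ∀ t, b t ∈ W ∩ W₂ ∧ q j t = b t • p j := by
    intro j
    by_cases hj : j < d
    · have := fun t => hO'W ((T^[j * n s]) 0) _ (hs j hj t)
      choose b hb using this
      refine ⟨b, fun _ t => ⟨(hb t).1, ?_⟩⟩
      rw [← (hb t).2, ← hUT, zero_add]
    · exact ⟨fun _ => 1, fun h => absurd h hj⟩
  choose b hb using hex
  have hqc : ∀ j, Continuous (q j) := fun j =>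
    h.symm.continuous.comp ((T.continuous.iterate _).comp (hyc s))
  have hbc : ∀ j < d, Continuous (b j) := fun j hj =>
    continuous_lift Γ hWo (hWinj (p j)) (b j) (fun t => (hb j hj t).1.1) (by
      simp only [← (hb j hj _).2]; exact hqc j)
  have hb0 : ∀ j < d, b j 0 = 1 := fun j hj =>
    hWfix (p j) _ (hb j hj 0).1.1 (by rw [← (hb j hj 0).2, hq0])
  -- conjugating the lift at time `0` gives the lift at time `j n`
  have hconjb : ∀ j < d, ∀ t, γ ^ j * b 0 t * (γ ^ j)⁻¹ = b j t := by
    intro j hj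
    let c : unitInterval → G := fun t => (b j t)⁻¹ * (γ ^ j * b 0 t * (γ ^ j)⁻¹)
    have hcc : Continuous c := by
      have h1 := hbc j hj
      have h2 := hbc 0 hd
      fun_prop
    have hcfix : ∀ t, c t • p j = p j := fun t => by
      have e1 : (γ ^ j * b 0 t * (γ ^ j)⁻¹) • p j = q j t := by
        rw [← hp j, mul_smul, inv_smul_smul, mul_smul, ← (hb 0 hd t).2, hq]
      simp only [c]
      rw [mul_smul, e1, (hb j hj t).2, inv_smul_smul]
    -- `c` takes values in the stabilizer of `p j`, which is discrete
    have hloc : IsLocallyConstant c := by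
      refine IsLocallyConstant.iff_eventually_eq c |>.mpr fun t₀ => ?_
      have h1 : Filter.Tendsto (fun t => c t * (c t₀)⁻¹) (nhds t₀) (nhds 1) :=
        Continuous.tendsto' (by fun_prop) _ _ (mul_inv_cancel _)
      filter_upwards [h1 hW1] with t ht
      have h2 := hWfix (p j) _ ht (by rw [mul_smul, inv_smul_eq_iff.mpr (hcfix t₀).symm, hcfix])
      exact mul_inv_eq_one.mp h2
    intro t
    have h1 : c t = c 0 := hloc.apply_eq_of_isPreconnected isPreconnected_univ trivial trivial
    have h2 : c 0 = 1 := by simp [c, hb0 j hj, hb0 0 hd]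
    rw [h2] at h1
    exact (inv_mul_eq_one.mp h1).symm
  have hfin : γ ^ d * b 0 1 * (γ ^ d)⁻¹ ∈ W₁ := by
    refine hconj γ (b 0 1) ?_ fun j hj => ?_
    · rw [Nat.sub_self, Subgroup.lowerCentralSeries_zero]; trivial
    · rw [hconjb j hj]; exact (hb j hj 1).1.2
  have h1 := hW₁O _ hfin (p d)
  have h2 : (γ ^ d * b 0 1 * (γ ^ d)⁻¹) • p d = q d 1 := by
    rw [← hp d, mul_smul, inv_smul_smul, mul_smul, ← (hb 0 hd 1).2, hq]
  rw [h2] at h1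
  simp only [q, p, h.apply_symm_apply] at h1
  have h3 := hUT (d * n s) 0 (y s 1)
  rw [zero_add] at h3
  rwa [h3, add_sub_cancel_left] at h1

/-! ### Endomorphisms of tori -/

section Torus

variable {κ : Type*} [Fintype κ]

/-- The character `x ↦ ∑ kᵢ xᵢ` of the torus `(ℝ/ℤ)^κ`. -/
def torusChar (k : κ → ℤ) : (κ → UnitAddCircle) →ₜ+ UnitAddCircle where
  toFun x := ∑ i, k i • x i
  map_zero' := by simp
  map_add' x y := by simp [Finset.sum_add_distrib]
  continuous_toFun := by fun_prop

theorem torusChar_apply (k : κ → ℤ) (x : κ → UnitAddCircle) : torusChar k x = ∑ i, k i • x i := rfl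

theorem expChar_torusChar (k : κ → ℤ) : expChar (torusChar k) = UnitAddTorus.mFourier k := by
  ext x
  rw [expChar_apply, torusChar_apply, UnitAddTorus.mFourier, ContinuousMap.coe_mk]
  simp only [fourier_apply]
  induction (Finset.univ : Finset κ) using Finset.cons_induction with
  | empty => simp
  | cons a s ha ih => rw [Finset.sum_cons, Finset.prod_cons, AddCircle.toCircle_add, ← ih]; rfl

/-- Every continuous character of a torus is given by an integer vector: it cannot be orthogonal
to all of these. -/
theorem exists_eq_torusChar (χ : (κ → UnitAddCircle) →ₜ+ UnitAddCircle) :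
    ∃ k : κ → ℤ, χ = torusChar k := by
  by_contra! hχ
  let μ := haarProb (κ → UnitAddCircle)
  have hmem : expChar χ ∈
      (Submodule.span ℂ (expChar '' Set.range (torusChar (κ := κ)))).topologicalClosure := by
    have h1 : expChar '' Set.range (torusChar (κ := κ)) =
        Set.range (UnitAddTorus.mFourier (d := κ)) := by
      rw [← Set.range_comp]
      exact congrArg Set.range (funext expChar_torusChar)
    rw [h1, UnitAddTorus.span_mFourier_closure_eq_top]
    trivial
  obtain ⟨t, ht, hd⟩ := Metric.mem_closure_iff.mp hmem (1 / 2) (by norm_num)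
  rw [dist_eq_norm] at hd
  have h0 : ∫ x, t x * expChar (-χ) x ∂μ = 0 :=
    integral_trigPoly_mul_expChar_eq_zero μ ht (χ := -χ) (by
      rw [neg_neg]; rintro ⟨k, hk⟩; exact hχ k hk.symm)
  have h1 : ∫ x, (expChar χ - t) x * expChar (-χ) x ∂μ = 1 := by
    have e : ∀ x, (expChar χ - t) x * expChar (-χ) x = 1 - t x * expChar (-χ) x := fun x => by
      have : expChar χ x * expChar (-χ) x = 1 := by
        rw [← ContinuousMap.mul_apply, ← expChar_add, add_neg_cancel, expChar_zero]; rfl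
      rw [ContinuousMap.sub_apply, sub_mul, this]
    have hi : Integrable (fun x => t x * expChar (-χ) x) μ :=
      integrable_continuousMap μ (t * expChar (-χ))
    simp only [e]
    rw [integral_sub (integrable_const _) hi, h0]
    simp
  have h2 : ‖∫ x, (expChar χ - t) x * expChar (-χ) x ∂μ‖ ≤ 1 / 2 * μ.real Set.univ := by
    refine norm_integral_le_of_norm_le_const (.of_forall fun x => ?_)
    rw [norm_mul, norm_expChar_apply, mul_one]
    exact ((expChar χ - t).norm_coe_le_norm x).trans hd.le
  rw [h1] at h2
  norm_num at h2

/-- There is a point of infinite order on the circle. -/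
theorem exists_zsmul_ne_zero : ∃ α : UnitAddCircle, ∀ k : ℤ, k • α = 0 → k = 0 := by
  refine ⟨((√2 : ℝ) : UnitAddCircle), fun k hk => ?_⟩
  by_contra h0
  rw [← AddCircle.coe_zsmul, AddCircle.coe_eq_zero_iff] at hk
  obtain ⟨n, hn⟩ := hk
  have hirr := irrational_sqrt_two.intCast_mul h0
  refine hirr ⟨n, ?_⟩
  simpa using hn

theorem torusChar_injective : Function.Injective (torusChar (κ := κ)) := by
  classical
  intro k l h
  obtain ⟨α, hα⟩ := exists_zsmul_ne_zero
  funext i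
  have h1 := DFunLike.congr_fun h (Pi.single i α)
  rw [torusChar_apply, torusChar_apply, ← sub_eq_zero, ← Finset.sum_sub_distrib,
    Finset.sum_eq_single i] at h1
  · rw [Pi.single_eq_same, ← sub_smul] at h1
    exact sub_eq_zero.mp (hα _ h1)
  · intro j _ hj
    rw [Pi.single_eq_of_ne hj]; simp
  · simp

theorem charactersSeparate_torus : CharactersSeparate (κ → UnitAddCircle) := by
  classical
  intro x hx
  obtain ⟨i, hi⟩ := Function.ne_iff.mp hx
  refine ⟨torusChar (Pi.single i 1), ?_⟩
  rw [torusChar_apply, Finset.sum_eq_single i]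
  · simpa using hi
  · intro j _ hj; simp [Pi.single_eq_of_ne hj]
  · simp

/-- The covering map `ℝ^κ → (ℝ/ℤ)^κ`. -/
def toTorus (κ : Type*) : (κ → ℝ) →+ (κ → UnitAddCircle) where
  toFun r i := (r i : UnitAddCircle)
  map_zero' := by ext; simp
  map_add' x y := by ext; simp

theorem continuous_toTorus : Continuous (toTorus κ) :=
  continuous_pi fun i => (AddCircle.continuous_mk' 1).comp (continuous_apply i)

theorem toTorus_surjective : Function.Surjective (toTorus κ) := fun x => by
  choose r hr using fun i => QuotientAddGroup.mk_surjective (x i)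
  exact ⟨r, funext hr⟩

theorem eq_zero_of_toTorus_smul {v : κ → ℝ} (h : ∀ c : ℝ, toTorus κ (c • v) = 0) : v = 0 := by
  funext i
  by_contra hi
  have h1 := congrFun (h (1 / (2 * v i))) i
  have h2 : ((1 / 2 : ℝ) : UnitAddCircle) = 0 := by
    refine Eq.trans ?_ h1
    change _ = (((1 / (2 * v i)) * v i : ℝ) : UnitAddCircle)
    congr 1
    have : v i ≠ 0 := hi
    field_simp
  rw [AddCircle.coe_eq_zero_iff] at h2
  obtain ⟨n, hn⟩ := h2
  have h3 : (2 * n : ℝ) = 1 := by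
    have : (n : ℝ) = 1 / 2 := by simpa using hn
    linarith
  have h4 : 2 * n = 1 := by exact_mod_cast h3
  omega

/-- Every continuous endomorphism of a torus lifts to a linear map. -/
theorem exists_linear_lift (u : (κ → UnitAddCircle) →ₜ+ (κ → UnitAddCircle)) :
    ∃ L : (κ → ℝ) →ₗ[ℝ] (κ → ℝ), ∀ r, toTorus κ (L r) = u (toTorus κ r) := by
  have hi : ∀ i, ∃ k : κ → ℤ, ∀ x, u x i = ∑ j, k j • x j := fun i => by
    obtain ⟨k, hk⟩ := exists_eq_torusChar
      ({ toFun := fun x => u x i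
         map_zero' := by simp
         map_add' := by simp
         continuous_toFun := by fun_prop } : (κ → UnitAddCircle) →ₜ+ UnitAddCircle)
    exact ⟨k, fun x => DFunLike.congr_fun hk x⟩
  choose k hk using hi
  refine ⟨LinearMap.pi fun i => ∑ j, (k i j : ℝ) • LinearMap.proj j, fun r => ?_⟩
  funext i
  rw [hk]
  have h1 : (LinearMap.pi (fun i => ∑ j, (k i j : ℝ) • LinearMap.proj (R := ℝ) (φ := fun _ => ℝ) j) :
      (κ → ℝ) →ₗ[ℝ] (κ → ℝ)) r i = ∑ j, k i j • r j := by
    simp [LinearMap.pi_apply, LinearMap.sum_apply]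
  have h2 : ∀ (s : κ → ℝ) j, toTorus κ s j = ((s j : ℝ) : UnitAddCircle) := fun s j => rfl
  rw [h2, h1]
  simp only [h2, ← AddCircle.coe_zsmul]
  exact map_sum (QuotientAddGroup.mk' (AddSubgroup.zmultiples (1 : ℝ))) _ _

end Torus

/-! ### The unipotency degree of a Weyl nilsystem -/

section Degree

/-- The falling factorial `x (x - 1) ⋯ (x - d + 1)` on the scale `s`. -/
def scaledFalling (d s : ℕ) : Polynomial ℝ :=
  (descPochhammer ℝ d).comp (Polynomial.C ((s : ℝ)⁻¹) * Polynomial.X)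

/-- The vector `∑ᵢ (Δⁱ g)(m) N^{d-i} w`, where `g(m)` is the falling factorial of degree `d` at
`m / s`. It is an orbit of the unipotent map `1 + N` when `N^{d+1} w = 0`. -/
def perturbation {E : Type*} [AddCommGroup E] [Module ℝ E] (N : E →ₗ[ℝ] E) (w : E) (d s : ℕ)
    (m : ℕ) : E :=
  ∑ i ∈ Finset.range (d + 1),
    ((fwdDiff (1 : ℝ))^[i] (fun x => (scaledFalling d s).eval x)) (m : ℝ) • (N ^ (d - i)) w

/-- The perturbations form an orbit of `1 + N`. -/
theorem perturbation_succ {E : Type*} [AddCommGroup E] [Module ℝ E] (N : E →ₗ[ℝ] E) {w : E}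
    {d : ℕ} (hw : (N ^ (d + 1)) w = 0) (s m : ℕ) :
    perturbation N w d s (m + 1) = perturbation N w d s m + N (perturbation N w d s m) := by
  set f : ℝ → ℝ := fun x => (scaledFalling d s).eval x
  have hdeg : (scaledFalling d s).natDegree < d + 1 := by
    refine Nat.lt_succ_of_le (Polynomial.natDegree_comp_le.trans ?_)
    rw [descPochhammer_natDegree]
    exact (Nat.mul_le_mul_left d ((Polynomial.natDegree_C_mul_le _ _).trans
      Polynomial.natDegree_X_le)).trans (mul_one d).le
  have hz : ((fwdDiff (1 : ℝ))^[d + 1] f) = 0 := Polynomial.fwdDiff_iter_eq_zero_of_degree_lt hdeg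
  have hstep : ∀ i, ((fwdDiff (1 : ℝ))^[i] f) ((m + 1 : ℕ) : ℝ) =
      ((fwdDiff (1 : ℝ))^[i] f) (m : ℝ) + ((fwdDiff (1 : ℝ))^[i + 1] f) (m : ℝ) := fun i => by
    rw [Function.iterate_succ_apply', fwdDiff]
    push_cast; ring
  have h1 : perturbation N w d s (m + 1) = perturbation N w d s m +
      ∑ i ∈ Finset.range (d + 1), ((fwdDiff (1 : ℝ))^[i + 1] f) (m : ℝ) • (N ^ (d - i)) w := by
    unfold perturbation
    rw [← Finset.sum_add_distrib]
    refine Finset.sum_congr rfl fun i _ => ?_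
    rw [← add_smul]
    congr 1
    exact hstep i
  have h2 : N (perturbation N w d s m) =
      ∑ i ∈ Finset.range (d + 1), ((fwdDiff (1 : ℝ))^[i] f) (m : ℝ) • (N ^ (d + 1 - i)) w := by
    unfold perturbation
    rw [map_sum]
    refine Finset.sum_congr rfl fun i hi => ?_
    rw [map_smul, ← Module.End.mul_apply, ← pow_succ',
      Nat.sub_add_comm (Nat.lt_succ_iff.mp (Finset.mem_range.mp hi))]
  rw [h1, h2, Finset.sum_range_succ, Finset.sum_range_succ' (fun i =>
    ((fwdDiff (1 : ℝ))^[i] f) (m : ℝ) • (N ^ (d + 1 - i)) w), hz, Nat.sub_zero, hw]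
  simp

/-- At the times `j s` the perturbation tends to `j (j - 1) ⋯ (j - d + 1) N^d w` as `s → ∞`. So it
is small at the times `0, s, …, (d - 1) s`, but close to `d! N^d w` at the time `d s`. -/
theorem tendsto_perturbation {E : Type*} [NormedAddCommGroup E] [NormedSpace ℝ E]
    (N : E →ₗ[ℝ] E) (w : E) (d j : ℕ) :
    Filter.Tendsto (fun s => perturbation N w d s (j * s)) Filter.atTop
      (nhds ((descPochhammer ℝ d).eval (j : ℝ) • (N ^ d) w)) := by
  have hterm : ∀ i, Filter.Tendsto (fun s : ℕ =>
      ((fwdDiff (1 : ℝ))^[i] (fun x => (scaledFalling d s).eval x)) ((j * s : ℕ) : ℝ)) Filter.atTop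
      (nhds (if i = 0 then (descPochhammer ℝ d).eval (j : ℝ) else 0)) := by
    intro i
    -- an iterated difference is a combination of values of the falling factorial at points
    -- that all tend to `j`
    have hlim : (if i = 0 then (descPochhammer ℝ d).eval (j : ℝ) else 0) =
        ∑ k ∈ Finset.range (i + 1), ((-1 : ℤ) ^ (i - k) * i.choose k) •
          (descPochhammer ℝ d).eval (j : ℝ) := by
      have := fwdDiff_iter_eq_sum_shift (1 : ℝ)
        (fun _ : ℝ => (descPochhammer ℝ d).eval (j : ℝ)) i 0
      rw [← this]
      rcases i with _ | i
      · simp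
      · rw [if_neg (by omega), Function.iterate_succ_apply, fwdDiff_const]
        have : ∀ i, ((fwdDiff (1 : ℝ))^[i] (fun _ : ℝ => (0 : ℝ))) = fun _ => 0 := by
          intro i
          induction i with
          | zero => rfl
          | succ i ih => rw [Function.iterate_succ_apply, fwdDiff_const, ih]
        rw [this]
    rw [hlim]
    simp only [fwdDiff_iter_eq_sum_shift]
    refine tendsto_finsetSum _ fun k _ => Filter.Tendsto.const_smul ?_ _
    have h1 : Filter.Tendsto (fun s : ℕ => (s : ℝ)⁻¹ * (((j * s : ℕ) : ℝ) + k • (1 : ℝ)))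
        Filter.atTop (nhds (j : ℝ)) := by
      have h2 : Filter.Tendsto (fun s : ℕ => (j : ℝ) + (s : ℝ)⁻¹ * k) Filter.atTop
          (nhds ((j : ℝ) + 0 * k)) :=
        tendsto_const_nhds.add (tendsto_inv_atTop_nhds_zero_nat.mul_const _)
      rw [zero_mul, add_zero] at h2
      refine h2.congr' ?_
      filter_upwards [Filter.eventually_gt_atTop 0] with s hs
      have : (s : ℝ) ≠ 0 := by positivity
      push_cast
      field_simp
      simp
    have h3 := ((descPochhammer ℝ d).continuous.tendsto (j : ℝ)).comp h1
    refine h3.congr fun s => ?_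
    simp [scaledFalling]
  have hsum : (descPochhammer ℝ d).eval (j : ℝ) • (N ^ d) w = ∑ i ∈ Finset.range (d + 1),
      (if i = 0 then (descPochhammer ℝ d).eval (j : ℝ) else 0) • (N ^ (d - i)) w := by
    rw [Finset.sum_range_succ']
    simp
  rw [hsum]
  exact tendsto_finsetSum _ fun i _ => (hterm i).smul_const _

variable {κ : Type*} [Fintype κ]

/-- If small paths of perturbations on a torus that are small at the times `0, s, …, (d - 1) s` are
small at time `d s`, then the unipotent map `1 + N` on the torus has `N ^ d = 0`. -/
theorem iterate_eq_zero_of_small_paths {d : ℕ} (u : (κ → UnitAddCircle) →ₜ+ (κ → UnitAddCircle))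
    (N : (κ → UnitAddCircle) →ₜ+ (κ → UnitAddCircle)) (hN : ∀ x, u x = x + N x)
    {k : ℕ} (hk : ∀ x, (N^[k]) x = 0)
    (hpath : ∀ y : ℕ → unitInterval → (κ → UnitAddCircle), (∀ s, Continuous (y s)) →
      (∀ s, y s 0 = 0) → (∀ j < d, ∀ O ∈ nhds (0 : κ → UnitAddCircle), ∀ᶠ s in Filter.atTop,
        ∀ t, (u^[j * s]) (y s t) ∈ O) →
      ∀ O ∈ nhds (0 : κ → UnitAddCircle), ∀ᶠ s in Filter.atTop, (u^[d * s]) (y s 1) ∈ O)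
    (x : κ → UnitAddCircle) : (N^[d]) x = 0 := by
  obtain ⟨L, hL⟩ := exists_linear_lift N
  have hLi : ∀ (i : ℕ) (r), toTorus κ ((L ^ i) r) = (N^[i]) (toTorus κ r) := by
    intro i
    induction i with
    | zero => intro r; rfl
    | succ i ih =>
      intro r
      rw [pow_succ', Module.End.mul_apply, hL, ih, Function.iterate_succ_apply']
  have hLk : ∀ r, (L ^ k) r = 0 := fun r =>
    eq_zero_of_toTorus_smul fun c => by rw [← map_smul, hLi, hk]
  -- at time `d s` the perturbation by `w` tends to `d! L^d w`, and to `0` modulo integers, so the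
  -- limit is an integer vector; the same holds for all real multiples of `w`, so it vanishes
  have hker : ∀ w, (L ^ (d + 1)) w = 0 → (L ^ d) w = 0 := by
    have key : ∀ w, (L ^ (d + 1)) w = 0 →
        toTorus κ ((descPochhammer ℝ d).eval (d : ℝ) • (L ^ d) w) = 0 := by
      intro w hw
      have hu : ∀ (t : ℝ) (s m : ℕ), (u^[m]) (toTorus κ (t • perturbation L w d s 0)) =
          toTorus κ (t • perturbation L w d s m) := by
        intro t s m
        induction m with
        | zero => rfl
        | succ m ih =>
          rw [Function.iterate_succ_apply', ih, hN, ← hL, ← map_add, perturbation_succ L hw,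
            smul_add, map_smul]
      have hlim := hpath (fun s t => toTorus κ ((t : ℝ) • perturbation L w d s 0))
        (fun s => continuous_toTorus.comp (by fun_prop)) (fun s => by simp) (fun j hj O hO => by
          simp only [hu]
          have hO' : toTorus κ ⁻¹' O ∈ nhds (0 : κ → ℝ) :=
            continuous_toTorus.continuousAt.preimage_mem_nhds (by rwa [map_zero])
          obtain ⟨ε, hε, hball⟩ := Metric.mem_nhds_iff.mp hO'
          have h1 := tendsto_perturbation L w d j
          rw [descPochhammer_eval_coe_nat_of_lt hj, zero_smul] at h1
          filter_upwards [h1 (Metric.ball_mem_nhds 0 hε)] with s hs t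
          refine hball ?_
          rw [Set.mem_preimage, mem_ball_zero_iff] at hs
          rw [mem_ball_zero_iff, norm_smul, Real.norm_eq_abs, abs_of_nonneg t.2.1]
          exact (mul_le_of_le_one_left (norm_nonneg _) t.2.2).trans_lt hs)
      have hu1 := hu 1
      simp only [one_smul] at hu1
      simp only [Set.Icc.coe_one, one_smul, hu1] at hlim
      exact tendsto_nhds_unique ((continuous_toTorus.tendsto _).comp (tendsto_perturbation L w d d))
        (fun O hO => hlim O hO)
    intro w hw
    have h1 : (descPochhammer ℝ d).eval (d : ℝ) • (L ^ d) w = 0 :=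
      eq_zero_of_toTorus_smul fun c => by
        rw [smul_comm, ← map_smul]
        exact key _ (by rw [map_smul, hw, smul_zero])
    refine (smul_eq_zero.mp h1).resolve_left ?_
    rw [descPochhammer_eval_eq_descFactorial, Nat.descFactorial_self]
    exact_mod_cast d.factorial_ne_zero
  -- the kernels of the powers of `L` no longer grow from the exponent `d` on
  have hdesc : ∀ j w, (L ^ (d + j)) w = 0 → (L ^ d) w = 0 := by
    intro j
    induction j with
    | zero => intro w h; exact h
    | succ j ih =>
      intro w h
      refine hker w ?_
      have := ih (L w) (by
        rw [← Module.End.mul_apply, ← pow_succ]; exact h)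
      rw [pow_succ, Module.End.mul_apply]
      exact this
  obtain ⟨r, rfl⟩ := toTorus_surjective x
  rw [← hLi, hdesc k r (by rw [pow_add, Module.End.mul_apply, hLk, map_zero]), map_zero]

end Degree

/-! ### The Bohr filter -/

/-- The filter on `ℤ` generated by the Bohr sets `{n | q(n) α ∈ U}`, where `q ∈ W` is an integral
polynomial, `α` an angle and `U` a neighbourhood of `0`. -/
def bohrFilter (W : Set (Polynomial ℝ)) : Filter ℤ where
  sets := {s | ∃ Q : Finset IntegralPolynomial, (∀ q ∈ Q, q.toReal ∈ W) ∧
    ∃ F : Finset UnitAddCircle, ∃ U ∈ nhds (0 : UnitAddCircle),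
      ∀ n, (∀ q ∈ Q, ∀ α ∈ F, q.value n • α ∈ U) → n ∈ s}
  univ_sets := ⟨∅, by simp, ∅, Set.univ, Filter.univ_mem, fun _ _ => trivial⟩
  sets_of_superset := by
    rintro s t ⟨Q, hQ, F, U, hU, h⟩ hst
    exact ⟨Q, hQ, F, U, hU, fun n hn => hst (h n hn)⟩
  inter_sets := by
    classical
    rintro s t ⟨Q, hQ, F, U, hU, h⟩ ⟨Q', hQ', F', U', hU', h'⟩
    refine ⟨Q ∪ Q', fun q hq => (Finset.mem_union.mp hq).elim (hQ q) (hQ' q), F ∪ F', U ∩ U',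
      Filter.inter_mem hU hU', fun n hn => ⟨h n fun q hq α hα => ?_, h' n fun q hq α hα => ?_⟩⟩
    · exact (hn q (Finset.mem_union_left _ hq) α (Finset.mem_union_left _ hα)).1
    · exact (hn q (Finset.mem_union_right _ hq) α (Finset.mem_union_right _ hα)).2

theorem tendsto_bohrFilter {W : Set (Polynomial ℝ)} {q : IntegralPolynomial} (hq : q.toReal ∈ W)
    (α : UnitAddCircle) :
    Filter.Tendsto (fun n => q.value n • α) (bohrFilter W) (nhds 0) := fun U hU =>
  ⟨{q}, by simpa using hq, {α}, U, hU, fun n hn => hn q (by simp) α (by simp)⟩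

theorem BohrRecurrence.frequently {R : Set ℤ} {W : Set (Polynomial ℝ)} (h : BohrRecurrence R W) :
    ∃ᶠ n in bohrFilter W, n ∈ R := by
  rintro ⟨Q, hQ, F, U, hU, hn⟩
  obtain ⟨n, hnR, hnU⟩ := h Q hQ F U hU
  exact hn n hnU hnR

/-- Bohr recurrence holds along large `n`, unless all polynomials vanish at some `n ∈ R`: a fixed
`n` with `p(n) ≠ 0` is excluded by the Bohr set of `p` and an irrational angle. -/
theorem frequently_bohrFilter_cofinite {R : Set ℤ} {W : Set (Polynomial ℝ)}
    (h : ∃ᶠ n in bohrFilter W, n ∈ R) {P : Finset IntegralPolynomial}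
    (hPW : ∀ p ∈ P, p.toReal ∈ W) (hR : ¬∃ n ∈ R, ∀ p ∈ P, p.value n = 0) :
    ∃ᶠ n in bohrFilter W ⊓ Filter.cofinite, n ∈ R := by
  obtain ⟨α, hα⟩ := exists_zsmul_ne_zero
  push Not at hR
  intro hev
  rw [Filter.eventually_inf] at hev
  obtain ⟨s, hs, t, ht, hst⟩ := hev
  have hne : ∀ᶠ n in bohrFilter W, ∀ n₀ ∈ tᶜ, n = n₀ → n ∉ R := by
    refine (Filter.eventually_all_finite (Filter.mem_cofinite.mp ht)).mpr fun n₀ _ => ?_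
    by_cases h0 : n₀ ∈ R
    · obtain ⟨p, hp, hpn⟩ := hR n₀ h0
      have h1 : p.value n₀ • α ≠ 0 := fun h => hpn (hα _ h)
      filter_upwards [(tendsto_bohrFilter (hPW p hp) α).eventually_ne h1.symm] with n hn hnn
      exact absurd (by rw [hnn]) hn
    · exact .of_forall fun n hn => by rwa [hn]
  refine h ?_
  filter_upwards [hs, hne] with n hns hn
  by_cases hnt : n ∈ t
  · exact hst n ⟨hns, hnt⟩
  · exact hn n hnt rfl

/-- Bohr sets contain divisibility conditions. -/
theorem eventually_dvd_bohrFilter {W : Set (Polynomial ℝ)} {p : IntegralPolynomial}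
    (hp : p.toReal ∈ W) {M : ℕ} (hM : 0 < M) :
    ∀ᶠ n in bohrFilter W, (M : ℤ) ∣ p.value n := by
  -- the Bohr set of the angle `1 / M`, in a neighbourhood that excludes its nonzero multiples
  have : NeZero M := ⟨hM.ne'⟩
  have hfin : (Set.range (ZMod.toAddCircle (N := M)) \ {0}).Finite :=
    (Set.finite_range _).sdiff
  have hU : (Set.range (ZMod.toAddCircle (N := M)) \ {0})ᶜ ∈ nhds (0 : UnitAddCircle) :=
    hfin.isClosed.isOpen_compl.mem_nhds (by simp)
  filter_upwards [tendsto_bohrFilter hp (ZMod.toAddCircle (1 : ZMod M)) hU] with n hn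
  rw [Set.mem_preimage, ← map_zsmul, zsmul_one] at hn
  by_contra hdvd
  refine hn ⟨⟨_, rfl⟩, fun h0 => hdvd ?_⟩
  rw [Set.mem_singleton_iff, ← map_zero (ZMod.toAddCircle (N := M))] at h0
  exact (ZMod.intCast_zmod_eq_zero_iff_dvd _ _).mp (ZMod.toAddCircle_injective M h0)

/-! ### Characters along polynomial orbits of unipotent affine maps -/

section Weights

variable {κ : Type*} [Fintype κ]

theorem torusChar_add (k l : κ → ℤ) : torusChar (k + l) = torusChar k + torusChar l := by
  ext x
  simp only [torusChar_apply, ContinuousAddMonoidHom.add_apply, Pi.add_apply, add_smul,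
    Finset.sum_add_distrib]

/-- The dual of a continuous endomorphism of a torus. -/
theorem exists_dual (N : (κ → UnitAddCircle) →ₜ+ (κ → UnitAddCircle)) :
    ∃ ν : (κ → ℤ) →+ (κ → ℤ), ∀ k x, torusChar k (N x) = torusChar (ν k) x := by
  have h : ∀ k, ∃ l, (torusChar k).comp N = torusChar l := fun k => exists_eq_torusChar _
  choose ν hν using h
  refine ⟨AddMonoidHom.mk' ν fun k l => torusChar_injective ?_, fun k x =>
    DFunLike.congr_fun (hν k) x⟩
  rw [torusChar_add, ← hν, ← hν, ← hν, torusChar_add]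
  rfl

theorem torusChar_iterate {N : (κ → UnitAddCircle) →ₜ+ (κ → UnitAddCircle)}
    {ν : (κ → ℤ) →+ (κ → ℤ)} (hν : ∀ k x, torusChar k (N x) = torusChar (ν k) x) (e : ℕ)
    (k : κ → ℤ) (x : κ → UnitAddCircle) : torusChar k ((N^[e]) x) = torusChar ((ν^[e]) k) x := by
  induction e generalizing x with
  | zero => rfl
  | succ e ih => rw [Function.iterate_succ_apply, ih, hν, Function.iterate_succ_apply']

/-- The polynomials in `P` together with `0`, as functions on `ℤ`. -/
def optionValue (P : Finset IntegralPolynomial) (i : Option P) (t : ℤ) : ℤ :=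
  i.elim 0 fun p => p.1.value t

/-- The integer vector `∑ᵢ ∑_{e < d} binom(pᵢ(t), e + r) ν^e kᵢ`, where `pᵢ` runs over `P ∪ {0}`.
For `r = 0` and `r = 1` these are the characters of the initial point and of the translation that occur
when the characters `kᵢ` are summed along a joint orbit at the times `pᵢ(t)`. -/
def weightSum (P : Finset IntegralPolynomial) (d : ℕ) (ν : (κ → ℤ) →+ (κ → ℤ))
    (k : Option P → κ → ℤ) (r : ℕ) (t : ℤ) : κ → ℤ :=
  ∑ i, ∑ e ∈ Finset.range d, Ring.choose (optionValue P i t) (e + r) • (ν^[e]) (k i)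

theorem exists_binom_poly (P : Finset IntegralPolynomial) (i : Option P) (e : ℕ) :
    ∃ f : Polynomial ℚ, ∀ t : ℤ,
      f.eval (t : ℚ) = ((Ring.choose (optionValue P i t) e : ℤ) : ℚ) := by
  rcases i with _ | p
  · exact ⟨Polynomial.C ((Ring.choose (0 : ℤ) e : ℤ) : ℚ), fun t => by
      rw [Polynomial.eval_C]; rfl⟩
  · refine ⟨Polynomial.C ((e.factorial : ℚ)⁻¹) * (descPochhammer ℚ e).comp p.1.1, fun t => ?_⟩
    rw [Polynomial.eval_mul, Polynomial.eval_C, Polynomial.eval_comp,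
      IntegralPolynomial.value_spec, choose_cast_eq]
    rfl

/-- A polynomial weight that is not identically zero vanishes only finitely often. -/
theorem finite_weightSum_eq_zero (P : Finset IntegralPolynomial) (d : ℕ) (ν : (κ → ℤ) →+ (κ → ℤ))
    (k : Option P → κ → ℤ) {t₀ : ℤ} (h : weightSum P d ν k 0 t₀ ≠ 0) :
    {t | weightSum P d ν k 0 t = 0}.Finite := by
  obtain ⟨c, hc⟩ := Function.ne_iff.mp h
  choose f hf using exists_binom_poly P
  let g : Polynomial ℚ := ∑ i, ∑ e ∈ Finset.range d,
    f i e * Polynomial.C (((ν^[e]) (k i) c : ℤ) : ℚ)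
  have hg : ∀ t : ℤ, g.eval (t : ℚ) = ((weightSum P d ν k 0 t c : ℤ) : ℚ) := fun t => by
    simp only [g, weightSum, Polynomial.eval_finsetSum, Polynomial.eval_mul, Polynomial.eval_C, hf,
      Finset.sum_apply, Pi.smul_apply, smul_eq_mul, add_zero]
    push_cast
    rfl
  have hg0 : g ≠ 0 := fun h0 => hc (by
    have := hg t₀
    rw [h0, Polynomial.eval_zero] at this
    exact_mod_cast this.symm)
  refine Set.Finite.of_finite_image (f := ((↑) : ℤ → ℚ)) (g.roots.toFinset.finite_toSet.subset ?_)
    (Int.cast_injective.injOn)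
  rintro _ ⟨t, ht, rfl⟩
  rw [Finset.mem_coe, Multiset.mem_toFinset, Polynomial.mem_roots hg0, Polynomial.IsRoot.def, hg]
  rw [Set.mem_ofPred_eq] at ht
  rw [ht]
  rfl

/-- If the linear part of a polynomial orbit is annihilated by a character, then the character
evaluates its translation part by Weyl polynomials. -/
theorem weightSum_one_mem_weylPolynomials {P : Finset IntegralPolynomial}
    (hP : ∀ p ∈ P, p.1.coeff 0 = 0) {d : ℕ} {ν : (κ → ℤ) →+ (κ → ℤ)}
    (hν : ∀ k, (ν^[d + 1]) k = 0) {k : Option P → κ → ℤ}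
    (h : ∀ t, weightSum P (d + 1) ν k 0 t = 0) (c : κ) :
    ∃ q : IntegralPolynomial, q.toReal ∈ weylPolynomials P (d + 1) ∧
      ∀ t, q.value t = weightSum P (d + 1) ν k 1 t c := by
  have hνs : ∀ j e x, (ν^[e + j]) x = (ν^[j]) ((ν^[e]) x) := fun j e x => by
    rw [add_comm, Function.iterate_add_apply]
  have hν0 : ∀ e, d + 1 ≤ e → ∀ x, (ν^[e]) x = 0 := fun e he x => by
    obtain ⟨j, rfl⟩ := Nat.exists_eq_add_of_le he
    rw [hνs, hν, iterate_map_zero]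
  have hnone : ∀ t, optionValue P none t = 0 := fun t => rfl
  have hsome : ∀ (p : P) t, optionValue P (some p) t = p.1.value t := fun p t => rfl
  have hzero : ∀ i, optionValue P i 0 = 0 := by
    rintro (_ | p)
    · rfl
    · exact value_zero (hP p.1 p.2)
  -- the nonconstant part of the annihilation condition
  have hpos : ∀ t, ∑ p : P, ∑ e ∈ Finset.range d,
      Ring.choose (p.1.value t) (e + 1) • (ν^[e + 1]) (k (some p)) = 0 := fun t => by
    -- at `t = 0` only the terms with `e = 0` remain
    have h1 : ∑ i, k i = 0 := by
      rw [← h 0]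
      unfold weightSum
      refine Finset.sum_congr rfl fun i _ => ?_
      rw [Finset.sum_range_succ', hzero]
      simp
    have h2 := h t
    unfold weightSum at h2
    simp only [Finset.sum_range_succ' _ d, Finset.sum_add_distrib, add_zero,
      Ring.choose_zero_right, one_smul, Function.iterate_zero, id_eq, h1] at h2
    rw [Fintype.sum_option] at h2
    simpa [hnone, hsome] using h2
  refine ⟨binomComb P (d + 1) fun a => (ν^[a.1]) (k (some a.2)) c, ⟨fun a =>
    (((ν^[a.1]) (k (some a.2)) c : ℤ) : ℝ), ?_, ?_⟩, fun t => ?_⟩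
  · refine (orthogonal_columnSpan_iff P d fun a =>
      (((ν^[a.1]) (k (some a.2)) c : ℤ) : ℝ)).mpr fun j t => ?_
    -- the orthogonality to the column `j` is the image of the annihilation condition under `ν ^ j`
    have h3 : ∑ p : P, ∑ e ∈ Finset.range d,
        Ring.choose (p.1.value t) (e + 1) • (ν^[e + 1 + j]) (k (some p)) = 0 := by
      let E : AddMonoid.End (κ → ℤ) := ν
      have hE : ∀ (e : ℕ) x, (ν^[e]) x = (E ^ e) x := fun e x =>
        (congrFun (AddMonoid.End.coe_pow _ E e) x).symm
      have := congrArg (ν^[(j : ℕ)]) (hpos t)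
      rw [iterate_map_zero, hE, map_sum] at this
      rw [← this]
      refine Finset.sum_congr rfl fun p _ => ?_
      rw [map_sum]
      refine Finset.sum_congr rfl fun e _ => ?_
      rw [map_zsmul, ← hE, hνs]
    have h4 : ∀ p : P, ∑ e ∈ Finset.range d,
        Ring.choose (p.1.value t) (e + 1) • (ν^[e + 1 + j]) (k (some p)) =
        ∑ i : Fin d, (if j ≤ i then Ring.choose (p.1.value t) (i.val - j.val + 1) else 0) •
          (ν^[i.val + 1]) (k (some p)) := fun p => by
      symm
      refine (Fin.sum_univ_eq_sum_range (fun i => (if j.val ≤ i then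
        Ring.choose (p.1.value t) (i - j.val + 1) else 0) • (ν^[i + 1]) (k (some p))) d).trans ?_
      have hjd : d = j + (d - j) := by have := j.2; omega
      rw [Finset.range_eq_Ico, ← Finset.sum_Ico_consecutive _ (Nat.zero_le j) j.2.le,
        Finset.sum_eq_zero (s := Finset.Ico 0 (j : ℕ)), zero_add, Finset.sum_Ico_eq_sum_range,
        ← Finset.sum_Ico_consecutive _ (Nat.zero_le (d - j)) (Nat.sub_le d j),
        Finset.sum_eq_zero (s := Finset.Ico (d - j : ℕ) d), add_zero, ← Finset.range_eq_Ico]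
      · refine Finset.sum_congr rfl fun e _ => ?_
        rw [if_pos (by omega), Nat.add_sub_cancel_left]
        congr 2
        omega
      · intro e he
        rw [Finset.mem_Ico] at he
        rw [hν0 _ (by omega), smul_zero]
      · intro e he
        rw [Finset.mem_Ico] at he
        rw [if_neg (by omega), zero_smul]
    simp only [h4] at h3
    have h5 := congrFun h3 c
    have h6 : ∑ a : Fin d × P, (ν^[a.1.val + 1]) (k (some a.2)) c *
        (if j ≤ a.1 then Ring.choose (a.2.1.value t) (a.1.val - j.val + 1) else 0) = 0 := by
      rw [Fintype.sum_prod_type_right]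
      rw [Finset.sum_apply] at h5
      refine Eq.trans (Finset.sum_congr rfl fun p _ => ?_) h5
      rw [Finset.sum_apply]
      refine Finset.sum_congr rfl fun i _ => ?_
      rw [Pi.smul_apply, smul_eq_mul, mul_comm]
    have h7 := congrArg (Int.cast : ℤ → ℝ) h6
    rw [Int.cast_sum, Int.cast_zero] at h7
    refine Eq.trans (Finset.sum_congr rfl fun a _ => ?_) h7
    rw [Int.cast_mul]
    rfl
  · refine real_poly_ext fun t => ?_
    rw [toReal_eval, xi_eval, binomComb_value]
    push_cast
    rfl
  · rw [binomComb_value, weightSum, Fintype.sum_option, Fintype.sum_prod_type_right]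
    simp only [hnone, hsome, Ring.choose_zero_succ, zero_smul, Finset.sum_const_zero, zero_add,
      Finset.sum_apply, Pi.smul_apply, smul_eq_mul]
    refine Finset.sum_congr rfl fun p _ => ?_
    rw [← Fin.sum_univ_eq_sum_range (fun e => Ring.choose (p.1.value t) (e + 1) *
      (ν^[e]) (k (some p)) c) (d + 1)]
    exact Finset.sum_congr rfl fun i _ => mul_comm _ _

end Weights

/-! ### Multiple recurrence from equidistribution in a closed subgroup -/

theorem abs_prod_sub_prod_le {ι : Type*} (s : Finset ι) {a b : ι → ℝ}
    (ha : ∀ i, a i ∈ Set.Icc (0 : ℝ) 1) (hb : ∀ i, b i ∈ Set.Icc (0 : ℝ) 1) :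
    |∏ i ∈ s, a i - ∏ i ∈ s, b i| ≤ ∑ i ∈ s, |a i - b i| := by
  classical
  induction s using Finset.induction_on with
  | empty => simp
  | insert i s hi ih =>
    rw [Finset.prod_insert hi, Finset.prod_insert hi, Finset.sum_insert hi]
    have h1 : a i * ∏ j ∈ s, a j - b i * ∏ j ∈ s, b j =
        (a i - b i) * ∏ j ∈ s, a j + b i * (∏ j ∈ s, a j - ∏ j ∈ s, b j) := by ring
    rw [h1]
    refine (abs_add_le _ _).trans (add_le_add ?_ ?_)
    · rw [abs_mul]
      refine mul_le_of_le_one_right (abs_nonneg _) ?_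
      rw [abs_of_nonneg (Finset.prod_nonneg fun j _ => (ha j).1)]
      exact Finset.prod_le_one (fun j _ => (ha j).1) fun j _ => (ha j).2
    · rw [abs_mul, abs_of_nonneg (hb i).1]
      exact (mul_le_of_le_one_left (abs_nonneg _) (hb i).2).trans ih

section Positivity

variable {X : Type*} [TopologicalSpace X] [CompactSpace X] [TopologicalSpace.MetrizableSpace X]
  [MeasurableSpace X] [BorelSpace X] (μ : Measure X) [IsProbabilityMeasure μ]
  {ι : Type*} [Fintype ι]

/-- Replacing the indicator function of `A` by a continuous function changes a multiple correlation
by at most the `L¹` distance times the number of factors. -/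
theorem abs_measureReal_iInter_sub_integral_prod_le {A : Set X} (hA : MeasurableSet A)
    {g : C(X, ℝ)} (hg0 : ∀ x, 0 ≤ g x) (hg1 : ∀ x, g x ≤ 1) {θ : ι → X → X}
    (hθ : ∀ i, MeasurePreserving (θ i) μ μ) :
    |μ.real (⋂ i, θ i ⁻¹' A) - ∫ x, ∏ i, g (θ i x) ∂μ| ≤
      Fintype.card ι * ∫ x, |A.indicator (fun _ => (1 : ℝ)) x - g x| ∂μ := by
  have hI : ∀ x, A.indicator (fun _ => (1 : ℝ)) x ∈ Set.Icc (0 : ℝ) 1 := fun x => by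
    by_cases hx : x ∈ A <;> simp [hx]
  have hAm : Measurable (A.indicator fun _ => (1 : ℝ)) := measurable_const.indicator hA
  have hgm : Measurable g := g.continuous.measurable
  have hbdd : ∀ {f : X → ℝ}, Measurable f → (∀ x, |f x| ≤ 1) → Integrable f μ := fun hf h =>
    Integrable.of_bound hf.aestronglyMeasurable 1 (.of_forall h)
  have h0 : (⋂ i, θ i ⁻¹' A).indicator (fun _ => (1 : ℝ)) =
      fun x => ∏ i, A.indicator (fun _ => (1 : ℝ)) (θ i x) := by
    funext x
    by_cases hx : ∀ i, θ i x ∈ A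
    · simp [hx]
    · obtain ⟨i, hi⟩ := not_forall.mp hx
      rw [Set.indicator_of_notMem (by simpa using hx)]
      exact (Finset.prod_eq_zero (Finset.mem_univ i) (by simp [hi])).symm
  have h1 : μ.real (⋂ i, θ i ⁻¹' A) =
      ∫ x, ∏ i, A.indicator (fun _ => (1 : ℝ)) (θ i x) ∂μ := by
    rw [← h0, integral_indicator_const _ (.iInter fun i => (hθ i).measurable hA), smul_eq_mul,
      mul_one]
  have hi1 : Integrable (fun x => ∏ i, A.indicator (fun _ => (1 : ℝ)) (θ i x)) μ := by
    refine hbdd (Finset.measurable_prod _ fun i _ => hAm.comp (hθ i).measurable) fun x => ?_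
    rw [abs_of_nonneg (Finset.prod_nonneg fun i _ => (hI _).1)]
    exact Finset.prod_le_one (fun i _ => (hI _).1) fun i _ => (hI _).2
  have hi2 : Integrable (fun x => ∏ i, g (θ i x)) μ := by
    refine hbdd (Finset.measurable_prod _ fun i _ => hgm.comp (hθ i).measurable) fun x => ?_
    rw [abs_of_nonneg (Finset.prod_nonneg fun i _ => hg0 _)]
    exact Finset.prod_le_one (fun i _ => hg0 _) fun i _ => hg1 _
  have hDm : Measurable fun x => |A.indicator (fun _ => (1 : ℝ)) x - g x| :=
    (hAm.sub hgm).abs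
  have hD1 : ∀ x, |A.indicator (fun _ => (1 : ℝ)) x - g x| ≤ 1 := fun x => by
    rw [abs_le]
    constructor <;> linarith [(hI x).1, (hI x).2, hg0 x, hg1 x]
  have hi3 : ∀ i, Integrable (fun x => |A.indicator (fun _ => (1 : ℝ)) (θ i x) - g (θ i x)|) μ :=
    fun i => hbdd (hDm.comp (hθ i).measurable) fun x => by rw [abs_abs]; exact hD1 _
  have h2 : ∀ i, ∫ x, |A.indicator (fun _ => (1 : ℝ)) (θ i x) - g (θ i x)| ∂μ =
      ∫ x, |A.indicator (fun _ => (1 : ℝ)) x - g x| ∂μ := fun i => by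
    conv_rhs => rw [← (hθ i).map_eq]
    rw [integral_map (hθ i).measurable.aemeasurable hDm.aestronglyMeasurable]
  rw [h1, ← integral_sub hi1 hi2]
  refine abs_integral_le_integral_abs.trans ((integral_mono (hi1.sub hi2).abs
    (integrable_finsetSum _ fun i _ => hi3 i) fun x => abs_prod_sub_prod_le _
      (fun i => hI _) fun i => ⟨hg0 _, hg1 _⟩).trans_eq ?_)
  rw [integral_finsetSum _ fun i _ => hi3 i, Finset.sum_congr rfl fun i _ => h2 i]
  simp

end Positivity

section Correspondence

variable {X : Type*} [AddCommGroup X] [TopologicalSpace X] [IsTopologicalAddGroup X]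
  [CompactSpace X] [TopologicalSpace.MetrizableSpace X] [SecondCountableTopology X]
  [MeasurableSpace X] [BorelSpace X] (μ : Measure X) [IsProbabilityMeasure μ]
  [μ.IsAddLeftInvariant] {ι : Type*} [Fintype ι]

/-- If the joint orbits `(θ n i x)_i` equidistribute to a measure that is invariant under the
diagonal and charges the neighbourhoods of `0`, then every set of positive measure is recurrent
along `θ`. -/
theorem eventually_measure_iInter_pos {l : Filter ℤ} {θ : ℤ → ι → X → X}
    (hθ : ∀ n i, MeasurePreserving (θ n i) μ μ) (lam : Measure (ι → X)) [IsProbabilityMeasure lam]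
    (hlam : ∀ x : X, MeasurePreserving (fun y : ι → X => y + fun _ => x) lam lam)
    (hlam0 : ∀ O ∈ nhds (0 : ι → X), lam O ≠ 0)
    (hlim : ∀ F : C(ι → X, ℂ), Filter.Tendsto (fun n => ∫ x, F (fun i => θ n i x) ∂μ) l
      (nhds (∫ y, F y ∂lam)))
    {A : Set X} (hA : MeasurableSet A) (hμA : 0 < μ A) :
    ∀ᶠ n in l, 0 < μ (⋂ i, θ n i ⁻¹' A) := by
  obtain ⟨O, hO, hOA⟩ := exists_nhds_half_le_measure_inter_translates μ hA ι
  have hm : 0 < μ.real A := ENNReal.toReal_pos hμA.ne' (measure_ne_top _ _)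
  obtain ⟨O', hO'O, hO'o, hO'0⟩ := mem_nhds_iff.mp
    (show {y : ι → X | ∀ i, y i ∈ O} ∈ nhds 0 from
      Filter.eventually_all.mpr fun i => (continuous_apply i).continuousAt.preimage_mem_nhds hO)
  set c := lam.real O' with hc
  have hcpos : 0 < c := ENNReal.toReal_pos (hlam0 O' (hO'o.mem_nhds hO'0)) (measure_ne_top _ _)
  have hc1 : c ≤ 1 := measureReal_le_one
  set m := μ.real A with hmdef
  set r : ℝ := (Fintype.card ι : ℝ) with hr
  have hr0 : 0 ≤ r := by positivity
  -- the correlations of `g` tend to at least `c (m / 2 - r η)`, and differ from those of `A` by at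
  -- most `r η`, so it suffices that `r η ≤ c m / 8`
  obtain ⟨g, hg0, hg1, hgA⟩ := exists_continuous_near_indicator μ hA
    (ε := c * m / (8 * (r + 1))) (by positivity)
  set η := ∫ x, |A.indicator (fun _ => (1 : ℝ)) x - g x| ∂μ with hη
  have hrη : r * η ≤ c * m / 8 := by
    have h1 : r * η ≤ r * (c * m / (8 * (r + 1))) := mul_le_mul_of_nonneg_left hgA hr0
    refine h1.trans ?_
    rw [mul_div_assoc', div_le_div_iff₀ (by positivity) (by positivity)]
    nlinarith [mul_pos hcpos hm]
  let G : C(ι → X, ℝ) := ⟨fun y => ∏ i, g (y i), by fun_prop⟩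
  have hG0 : ∀ y, 0 ≤ G y := fun y => Finset.prod_nonneg fun i _ => hg0 _
  have hGint : Integrable (fun y => G y) lam := integrable_continuousMap lam G
  -- the correlations of `g` over small displacements are substantial
  have hinner : ∀ y ∈ O', m / 2 - r * η ≤ ∫ x, G (y + fun _ => x) ∂μ := fun y hy => by
    have h1 := abs_measureReal_iInter_sub_integral_prod_le μ hA hg0 hg1
      (θ := fun i x => y i + x) fun i => measurePreserving_add_left μ (y i)
    have h2 : m / 2 ≤ μ.real (⋂ i, (fun x => y i + x) ⁻¹' A) :=
      (hOA y (hO'O hy)).trans (measureReal_mono Set.inter_subset_right)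
    have h3 := (abs_le.mp h1).2
    change _ ≤ ∫ x, ∏ i, g (y i + x) ∂μ
    linarith
  have hinner0 : ∀ y, 0 ≤ ∫ x, G (y + fun _ => x) ∂μ := fun y => integral_nonneg fun x => hG0 _
  have hjoint : Integrable (fun z : (ι → X) × X => G (z.1 + fun _ => z.2)) (lam.prod μ) :=
    integrable_continuousMap (lam.prod μ)
      (⟨fun z => G (z.1 + fun _ => z.2), by fun_prop⟩ : C((ι → X) × X, ℝ))
  -- the diagonal invariance of `lam` allows to average over the diagonal
  have hfub : ∫ y, G y ∂lam = ∫ y, ∫ x, G (y + fun _ => x) ∂μ ∂lam := by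
    rw [integral_integral_swap hjoint]
    have : ∀ x, ∫ y, G (y + fun _ => x) ∂lam = ∫ y, G y ∂lam := fun x => by
      conv_rhs => rw [← (hlam x).map_eq]
      rw [integral_map (hlam x).measurable.aemeasurable
        G.continuous.measurable.aestronglyMeasurable]
    simp [this]
  have hlow : c * (m / 2 - r * η) ≤ ∫ y, G y ∂lam := by
    rw [hfub]
    have h1 : ∫ y in O', (m / 2 - r * η) ∂lam ≤ ∫ y in O', ∫ x, G (y + fun _ => x) ∂μ ∂lam :=
      setIntegral_mono_on (integrable_const _).integrableOn hjoint.integral_prod_left.integrableOn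
        hO'o.measurableSet hinner
    rw [setIntegral_const, smul_eq_mul] at h1
    exact h1.trans (setIntegral_le_integral hjoint.integral_prod_left (.of_forall hinner0))
  have hlimG : Filter.Tendsto (fun n => ∫ x, G (fun i => θ n i x) ∂μ) l
      (nhds (∫ y, G y ∂lam)) := by
    have h1 := hlim ⟨fun y => (G y : ℂ), by fun_prop⟩
    simp only [ContinuousMap.coe_mk, integral_complex_ofReal] at h1
    exact (Complex.continuous_re.tendsto _).comp h1
  have hlt : ∫ y, G y ∂lam - c * m / 8 < ∫ y, G y ∂lam := by
    have : 0 < c * m / 8 := by positivity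
    linarith
  filter_upwards [hlimG.eventually (lt_mem_nhds hlt)] with n hn
  have h1 := abs_measureReal_iInter_sub_integral_prod_le μ hA hg0 hg1 (hθ n)
  have h2 := (abs_le.mp h1).1
  change _ < ∫ x, ∏ i, g (θ n i x) ∂μ at hn
  have h4 : c * (r * η) ≤ c * m / 8 := by nlinarith [mul_pos hcpos hm]
  have h3 : 0 < μ.real (⋂ i, θ n i ⁻¹' A) := by nlinarith [mul_pos hcpos hm]
  exact (ENNReal.toReal_pos_iff.mp h3).1

end Correspondence

/-- Convergence of integrals of continuous functions can be tested on characters. -/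
theorem tendsto_integral_of_expChar {Y : Type*} [AddCommGroup Y] [TopologicalSpace Y]
    [IsTopologicalAddGroup Y] [CompactSpace Y] [TopologicalSpace.MetrizableSpace Y]
    [MeasurableSpace Y] [BorelSpace Y] (hY : CharactersSeparate Y) {X : Type*}
    [MeasurableSpace X] (μ : Measure X) [IsProbabilityMeasure μ] {l : Filter ℤ}
    {φ : ℤ → X → Y} (hφ : ∀ n, Measurable (φ n)) (lam : Measure Y) [IsProbabilityMeasure lam]
    (h : ∀ χ : Y →ₜ+ UnitAddCircle, Filter.Tendsto (fun n => ∫ x, expChar χ (φ n x) ∂μ) l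
      (nhds (∫ y, expChar χ y ∂lam))) (F : C(Y, ℂ)) :
    Filter.Tendsto (fun n => ∫ x, F (φ n x) ∂μ) l (nhds (∫ y, F y ∂lam)) := by
  have hint : ∀ (F : C(Y, ℂ)) n, Integrable (fun x => F (φ n x)) μ := fun F n =>
    Integrable.of_bound (F.continuous.measurable.comp (hφ n)).aestronglyMeasurable ‖F‖
      (.of_forall fun x => F.norm_coe_le_norm _)
  have hint' : ∀ F : C(Y, ℂ), Integrable (fun y => F y) lam := fun F =>
    integrable_continuousMap lam F
  have hspan : ∀ t ∈ Submodule.span ℂ (Set.range (expChar (X := Y))),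
      Filter.Tendsto (fun n => ∫ x, t (φ n x) ∂μ) l (nhds (∫ y, t y ∂lam)) := by
    intro t ht
    induction ht using Submodule.span_induction with
    | mem t ht =>
      obtain ⟨χ, rfl⟩ := ht
      exact h χ
    | zero => simpa using tendsto_const_nhds
    | add s t _ _ hs ht =>
      simp only [ContinuousMap.add_apply]
      simp_rw [integral_add (hint s _) (hint t _)]
      rw [integral_add (hint' s) (hint' t)]
      exact hs.add ht
    | smul c t _ ht =>
      simp only [ContinuousMap.smul_apply, integral_smul]
      exact ht.const_smul c
  rw [Metric.tendsto_nhds]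
  intro ε hε
  obtain ⟨t, ht, hFt⟩ := exists_trigPoly_near hY F (show 0 < ε / 3 by positivity)
  filter_upwards [Metric.tendsto_nhds.mp (hspan t ht) (ε / 3) (by positivity)] with n hn
  have h1 : dist (∫ x, F (φ n x) ∂μ) (∫ x, t (φ n x) ∂μ) ≤ ‖F - t‖ := by
    rw [dist_eq_norm, ← integral_sub (hint F n) (hint t n)]
    refine (norm_integral_le_of_norm_le_const (C := ‖F - t‖)
      (.of_forall fun x => (F - t).norm_coe_le_norm (φ n x))).trans_eq ?_
    simp
  have h2 : dist (∫ y, t y ∂lam) (∫ y, F y ∂lam) ≤ ‖F - t‖ := by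
    rw [dist_comm, dist_eq_norm, ← integral_sub (hint' F) (hint' t)]
    refine (norm_integral_le_of_norm_le_const (C := ‖F - t‖)
      (.of_forall fun y => (F - t).norm_coe_le_norm y)).trans_eq ?_
    simp
  have h3 := dist_triangle4 (∫ x, F (φ n x) ∂μ) (∫ x, t (φ n x) ∂μ) (∫ y, t y ∂lam)
    (∫ y, F y ∂lam)
  linarith

section Subgroup

variable {Y : Type*} [AddCommGroup Y] [TopologicalSpace Y] [IsTopologicalAddGroup Y]
  [CompactSpace Y] [MeasurableSpace Y] [BorelSpace Y] (H : AddSubgroup Y) [CompactSpace H]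

/-- The Haar probability measure of a closed subgroup, as a measure on the ambient group. -/
def haarSubgroup : Measure Y := (haarProb H).map (↑)

instance : IsProbabilityMeasure (haarSubgroup H) :=
  Measure.isProbabilityMeasure_map continuous_subtype_val.measurable.aemeasurable

theorem haarSubgroup_ne_zero {O : Set Y} (hO : O ∈ nhds 0) : haarSubgroup H O ≠ 0 := by
  obtain ⟨O', hO'O, hO'o, hO'0⟩ := mem_nhds_iff.mp hO
  refine fun h => (hO'o.preimage continuous_subtype_val).measure_ne_zero (haarProb H)
    ⟨(0 : H), hO'0⟩ ?_
  have := measure_mono_null hO'O h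
  rwa [haarSubgroup, Measure.map_apply continuous_subtype_val.measurable hO'o.measurableSet] at this

theorem measurePreserving_add_haarSubgroup {h : Y} (hh : h ∈ H) :
    MeasurePreserving (fun y => y + h) (haarSubgroup H) (haarSubgroup H) := by
  refine ⟨(continuous_add_const h).measurable, ?_⟩
  rw [haarSubgroup, Measure.map_map ((continuous_add_const h).measurable)
    continuous_subtype_val.measurable]
  have h1 := (measurePreserving_add_right (haarProb H) (⟨h, hh⟩ : H)).map_eq
  conv_rhs => rw [← h1]
  rw [Measure.map_map continuous_subtype_val.measurable ((continuous_add_const _).measurable)]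
  rfl

open Classical in
theorem integral_expChar_haarSubgroup (χ : Y →ₜ+ UnitAddCircle) :
    ∫ y, expChar χ y ∂haarSubgroup H = if ∀ h ∈ H, χ h = 0 then 1 else 0 := by
  let ψ : H →ₜ+ UnitAddCircle := ⟨χ.toAddMonoidHom.comp H.subtype,
    (map_continuous χ).comp continuous_subtype_val⟩
  have h1 : ∫ y, expChar χ y ∂haarSubgroup H = ∫ h, expChar ψ h ∂haarProb H :=
    integral_map continuous_subtype_val.measurable.aemeasurable
      (expChar χ).continuous.measurable.aestronglyMeasurable
  rw [h1]
  split_ifs with h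
  · have : ψ = 0 := by
      ext y
      exact h y y.2
    rw [this, integral_expChar_zero]
  · exact integral_expChar_of_ne_zero _ ψ fun h0 => h fun y hy => DFunLike.congr_fun h0 ⟨y, hy⟩

end Subgroup

/-! ### Recurrence of unipotent affine maps of a torus along Bohr sets -/

theorem measurePreserving_zpow_homeomorph {X : Type*} [TopologicalSpace X] [MeasurableSpace X]
    [BorelSpace X] {μ : Measure X} {T : X ≃ₜ X} (hT : MeasurePreserving T μ μ) (m : ℤ) :
    MeasurePreserving (T ^ m : X ≃ₜ X) μ μ := by
  have h1 : ∀ n : ℕ, MeasurePreserving (T ^ n : X ≃ₜ X) μ μ := fun n => by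
    induction n with
    | zero => exact MeasurePreserving.id μ
    | succ n ih =>
      rw [pow_succ]
      exact ih.comp hT
  have h2 : ∀ S : X ≃ₜ X, MeasurePreserving S μ μ → MeasurePreserving (S⁻¹ : X ≃ₜ X) μ μ :=
    fun S hS => MeasurePreserving.symm S.toMeasurableEquiv hS
  rcases m with n | n
  · simpa using h1 n
  · rw [zpow_negSucc]
    exact h2 _ (h1 _)

theorem measurePreserving_affine {X : Type*} [AddCommGroup X] [TopologicalSpace X]
    [IsTopologicalAddGroup X] [CompactSpace X] [MeasurableSpace X] [BorelSpace X]
    (u : X →ₜ+ X) (hu : Function.Surjective u) (b : X) :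
    MeasurePreserving (fun x => b + u x) (haarProb X) (haarProb X) :=
  (measurePreserving_add_left (haarProb X) b).comp
    (AddMonoidHom.measurePreserving (f := u.toAddMonoidHom) (map_continuous u) hu rfl)

section Torus

variable {κ : Type*} [Fintype κ]

instance borelSpace_pi_torus {ι : Type*} [Countable ι] :
    BorelSpace (ι → κ → UnitAddCircle) :=
  Pi.borelSpace (X := fun _ : ι => κ → UnitAddCircle)

/-- The restriction of a character of a power of a group to one of the coordinates. -/
def coordChar {ι X : Type*} [DecidableEq ι] [AddCommGroup X] [TopologicalSpace X]
    (χ : (ι → X) →ₜ+ UnitAddCircle) (i : ι) : X →ₜ+ UnitAddCircle where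
  toFun x := χ (Pi.single i x)
  map_zero' := by simp
  map_add' x y := by rw [Pi.single_add, map_add]
  continuous_toFun := (map_continuous χ).comp (continuous_single (A := fun _ => X) i)

theorem eq_sum_coordChar {ι X : Type*} [Fintype ι] [DecidableEq ι] [AddCommGroup X]
    [TopologicalSpace X] (χ : (ι → X) →ₜ+ UnitAddCircle) (y : ι → X) :
    χ y = ∑ i, coordChar χ i (y i) := by
  conv_lhs => rw [← Finset.univ_sum_single y, map_sum]
  exact Finset.sum_congr rfl fun i _ => rfl

theorem charactersSeparate_pi {ι X : Type*} [AddCommGroup X] [TopologicalSpace X]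
    (hX : CharactersSeparate X) : CharactersSeparate (ι → X) := by
  intro y hy
  obtain ⟨i, hi⟩ := Function.ne_iff.mp hy
  obtain ⟨χ, hχ⟩ := hX _ hi
  exact ⟨⟨χ.toAddMonoidHom.comp (Pi.evalAddMonoidHom _ i),
    (map_continuous χ).comp (continuous_apply i)⟩, hχ⟩

theorem torusChar_sum_zsmul {σ : Type*} (s : Finset σ) (c : σ → ℤ) (k : σ → κ → ℤ)
    (x : κ → UnitAddCircle) :
    torusChar (∑ i ∈ s, c i • k i) x = ∑ i ∈ s, c i • torusChar (k i) x := by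
  simp only [torusChar_apply, Finset.sum_apply, Pi.smul_apply, Finset.sum_smul, Finset.smul_sum,
    smul_assoc]
  exact Finset.sum_comm

/-- A character of a power of a torus along a joint orbit of an affine unipotent map. -/
theorem sum_torusChar_affineFlow (P : Finset IntegralPolynomial) (d : ℕ)
    {N : (κ → UnitAddCircle) →ₜ+ (κ → UnitAddCircle)} {ν : (κ → ℤ) →+ (κ → ℤ)}
    (hν : ∀ k x, torusChar k (N x) = torusChar (ν k) x) (k : Option P → κ → ℤ)
    (b x : κ → UnitAddCircle) (t : ℤ) :
    ∑ i, torusChar (k i) (affineFlow N.toAddMonoidHom b d (optionValue P i t) x) =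
      torusChar (weightSum P d ν k 0 t) x + torusChar (weightSum P d ν k 1 t) b := by
  have hit : ∀ (c : ℤ) e i z, torusChar (k i) (c • (N^[e]) z) = torusChar (c • (ν^[e]) (k i)) z :=
    fun c e i z => by
      rw [map_zsmul, torusChar_iterate hν]
      simp only [torusChar_apply, Finset.smul_sum, Pi.smul_apply, smul_assoc]
  have hsum : ∀ r z, torusChar (weightSum P d ν k r t) z = ∑ i, ∑ e ∈ Finset.range d,
      torusChar (k i) (Ring.choose (optionValue P i t) (e + r) • (N^[e]) z) := fun r z => by
    have h1 : ∀ (σ : Type _) (s : Finset σ) (f : σ → κ → ℤ),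
        torusChar (∑ i ∈ s, f i) z = ∑ i ∈ s, torusChar (f i) z := fun σ s f => by
      simpa using torusChar_sum_zsmul s (fun _ => 1) f z
    simp only [weightSum, hit]
    rw [h1]
    refine Finset.sum_congr rfl fun i _ => ?_
    rw [torusChar_sum_zsmul]
    refine Finset.sum_congr rfl fun e _ => ?_
    simp only [torusChar_apply, Finset.smul_sum, Pi.smul_apply, smul_assoc]
  rw [hsum, hsum, ← Finset.sum_add_distrib]
  refine Finset.sum_congr rfl fun i _ => ?_
  unfold affineFlow
  rw [map_add, map_sum, map_sum]
  rfl

/-- The closed subgroup of `(κ → UnitAddCircle)^{P ∪ {0}}` generated by the joint polynomial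
orbits of the linear part. -/
def orbitSubgroup (P : Finset IntegralPolynomial) (d : ℕ)
    (N : (κ → UnitAddCircle) →ₜ+ (κ → UnitAddCircle)) :
    AddSubgroup (Option P → κ → UnitAddCircle) :=
  (AddSubgroup.closure (Set.range fun z : ℤ × (κ → UnitAddCircle) => fun i =>
    affineFlow N.toAddMonoidHom 0 d (optionValue P i z.1) z.2)).topologicalClosure

theorem affineFlow_mem_orbitSubgroup (P : Finset IntegralPolynomial) (d : ℕ)
    (N : (κ → UnitAddCircle) →ₜ+ (κ → UnitAddCircle)) (t : ℤ) (x : κ → UnitAddCircle) :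
    (fun i => affineFlow N.toAddMonoidHom 0 d (optionValue P i t) x) ∈ orbitSubgroup P d N :=
  AddSubgroup.le_topologicalClosure _ (AddSubgroup.subset_closure ⟨(t, x), rfl⟩)

instance (P : Finset IntegralPolynomial) (d : ℕ)
    (N : (κ → UnitAddCircle) →ₜ+ (κ → UnitAddCircle)) : CompactSpace (orbitSubgroup P d N) :=
  isCompact_iff_compactSpace.mp (AddSubgroup.isClosed_topologicalClosure _).isCompact

theorem forall_orbitSubgroup_iff (P : Finset IntegralPolynomial) (d : ℕ)
    (N : (κ → UnitAddCircle) →ₜ+ (κ → UnitAddCircle))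
    (χ : (Option P → κ → UnitAddCircle) →ₜ+ UnitAddCircle) :
    (∀ h ∈ orbitSubgroup P d N, χ h = 0) ↔
      ∀ t x, χ (fun i => affineFlow N.toAddMonoidHom 0 d (optionValue P i t) x) = 0 := by
  refine ⟨fun h t x => h _ (affineFlow_mem_orbitSubgroup P d N t x), fun h => ?_⟩
  have hle : orbitSubgroup P d N ≤ χ.toAddMonoidHom.ker := by
    refine AddSubgroup.topologicalClosure_minimal _ ?_
      (isClosed_singleton.preimage (map_continuous χ))
    rw [AddSubgroup.closure_le]
    rintro _ ⟨z, rfl⟩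
    exact h z.1 z.2
  exact fun y hy => hle hy

/-- Equidistribution of the joint orbits along Bohr sets: a character that is nontrivial on
`orbitSubgroup` has integral `0` for all but finitely many `n`, and a character that is trivial on
it is evaluated by Weyl polynomials. -/
theorem tendsto_integral_affineFlow {P : Finset IntegralPolynomial}
    (hP : ∀ p ∈ P, p.1.coeff 0 = 0) {d : ℕ}
    (N : (κ → UnitAddCircle) →ₜ+ (κ → UnitAddCircle)) (hN : ∀ x, (N^[d + 1]) x = 0)
    (b : κ → UnitAddCircle) (F : C(Option P → κ → UnitAddCircle, ℂ)) :
    Filter.Tendsto (fun n => ∫ x, F (fun i =>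
        affineFlow N.toAddMonoidHom b (d + 1) (optionValue P i n) x) ∂haarProb (κ → UnitAddCircle))
      (bohrFilter (weylPolynomials P (d + 1)) ⊓ Filter.cofinite)
      (nhds (∫ y, F y ∂haarSubgroup (orbitSubgroup P (d + 1) N))) := by
  classical
  obtain ⟨ν, hν⟩ := exists_dual N
  have hν0 : ∀ k, (ν^[d + 1]) k = 0 := fun k => torusChar_injective (by
    ext x
    rw [← torusChar_iterate hν, hN, map_zero, torusChar_apply]
    simp)
  have hcont : ∀ n, Continuous fun (x : κ → UnitAddCircle) (i : Option P) =>
      affineFlow N.toAddMonoidHom b (d + 1) (optionValue P i n) x := fun n => by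
    refine continuous_pi fun i => ?_
    unfold affineFlow
    refine (continuous_finsetSum _ fun e _ => ?_).add continuous_const
    exact ((map_continuous N).iterate e).const_smul (Ring.choose (optionValue P i n) e)
  refine tendsto_integral_of_expChar (charactersSeparate_pi charactersSeparate_torus) _
    (fun n => (hcont n).measurable) _ (fun χ => ?_) F
  have hk : ∀ i, ∃ k, coordChar χ i = torusChar k := fun i => exists_eq_torusChar _
  choose k hk using hk
  have hχ : ∀ b x n, χ (fun i => affineFlow N.toAddMonoidHom b (d + 1) (optionValue P i n) x) =
      torusChar (weightSum P (d + 1) ν k 0 n) x + torusChar (weightSum P (d + 1) ν k 1 n) b :=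
    fun b x n => by
      rw [eq_sum_coordChar]
      simp only [hk]
      exact sum_torusChar_affineFlow P (d + 1) hν k b x n
  have hJ : ∀ n, ∫ x, expChar χ (fun i => affineFlow N.toAddMonoidHom b (d + 1)
      (optionValue P i n) x) ∂haarProb (κ → UnitAddCircle) =
      (∫ x, expChar (torusChar (weightSum P (d + 1) ν k 0 n)) x ∂haarProb (κ → UnitAddCircle)) *
        expChar (torusChar (weightSum P (d + 1) ν k 1 n)) b := fun n => by
    rw [← integral_mul_const]
    refine integral_congr_ae (.of_forall fun x => ?_)
    simp only [expChar_apply, hχ, AddCircle.toCircle_add, Circle.coe_mul]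
  simp only [hJ]
  have h0 : ∀ x : κ → UnitAddCircle, torusChar (0 : κ → ℤ) x = 0 := fun x => by
    simp [torusChar_apply]
  have h00 : torusChar (0 : κ → ℤ) = 0 := ContinuousAddMonoidHom.ext h0
  have hiff : (∀ h ∈ orbitSubgroup P (d + 1) N, χ h = 0) ↔
      ∀ t, weightSum P (d + 1) ν k 0 t = 0 := by
    rw [forall_orbitSubgroup_iff]
    simp only [hχ, map_zero, add_zero]
    exact ⟨fun h t => torusChar_injective (by rw [h00]; exact ContinuousAddMonoidHom.ext (h t)),
      fun h t x => by rw [h, h0]⟩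
  rw [integral_expChar_haarSubgroup]
  split_ifs with hH
  · rw [hiff] at hH
    have hq := weightSum_one_mem_weylPolynomials hP hν0 hH
    choose q hqW hq using hq
    have h1 : ∀ n, torusChar (weightSum P (d + 1) ν k 1 n) b = ∑ c, (q c).value n • b c :=
      fun n => by simp only [torusChar_apply, hq]
    have h2 : Filter.Tendsto (fun n => torusChar (weightSum P (d + 1) ν k 1 n) b)
        (bohrFilter (weylPolynomials P (d + 1))) (nhds 0) := by
      simp only [h1]
      have := tendsto_finsetSum Finset.univ fun c _ => tendsto_bohrFilter (hqW c) (b c)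
      simpa using this
    have h3 : Filter.Tendsto (fun n => expChar (torusChar (weightSum P (d + 1) ν k 1 n)) b)
        (bohrFilter (weylPolynomials P (d + 1))) (nhds 1) := by
      have h4 : Continuous fun z : UnitAddCircle => (AddCircle.toCircle z : ℂ) :=
        continuous_subtype_val.comp AddCircle.continuous_toCircle
      have := (h4.tendsto 0).comp h2
      rw [AddCircle.toCircle_zero, Circle.coe_one] at this
      exact this
    simp only [hH, h00, integral_expChar_zero, one_mul]
    exact h3.mono_left inf_le_left
  · rw [hiff] at hH
    push Not at hH
    obtain ⟨t₀, ht₀⟩ := hH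
    refine tendsto_const_nhds.congr' ?_
    have hfin := finite_weightSum_eq_zero P (d + 1) ν k ht₀
    filter_upwards [Filter.mem_inf_of_right hfin.compl_mem_cofinite] with n hn
    rw [integral_expChar_of_ne_zero _ _ fun h => hn (torusChar_injective (h.trans h00.symm)),
      zero_mul]

/-- Recurrence for unipotent affine maps of tori, together with a divisibility condition on the
return times. -/
theorem exists_return_torus {P : Finset IntegralPolynomial}
    (hP : ∀ p ∈ P, p.1.coeff 0 = 0) {d : ℕ} {R : Set ℤ}
    (hR : BohrRecurrence R (weylPolynomials P (d + 1)))
    (N : (κ → UnitAddCircle) →ₜ+ (κ → UnitAddCircle)) (hN : ∀ x, (N^[d + 1]) x = 0)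
    (b : κ → UnitAddCircle) (S : (κ → UnitAddCircle) ≃ₜ (κ → UnitAddCircle))
    (hS : ∀ x, S x = b + x + N x) {A : Set (κ → UnitAddCircle)} (hA : MeasurableSet A)
    (hμA : 0 < haarProb (κ → UnitAddCircle) A) {M : ℕ} (hM : 0 < M) :
    ∃ n ∈ R, (∀ p ∈ P, (M : ℤ) ∣ p.value n) ∧
      0 < haarProb (κ → UnitAddCircle) (A ∩ ⋂ p ∈ P, (S ^ p.value n) ⁻¹' A) := by
  have hfreq := hR.frequently
  have hPW : ∀ p ∈ P, p.toReal ∈ weylPolynomials P (d + 1) := fun p hp =>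
    toReal_mem_weylPolynomials hp d
  -- equidistribution needs infinitely many `n`; otherwise all `p(n)` vanish for some `n ∈ R`
  by_cases h0 : ∃ n ∈ R, ∀ p ∈ P, p.value n = 0
  · obtain ⟨n, hn, hpn⟩ := h0
    refine ⟨n, hn, fun p hp => by simp [hpn p hp], hμA.trans_le (measure_mono fun x hx => ?_)⟩
    refine ⟨hx, Set.mem_iInter₂.mpr fun p hp => ?_⟩
    rw [hpn p hp]
    exact hx
  have hflow := homeomorph_zpow_eq_affineFlow S N.toAddMonoidHom b hS (Nat.le_add_left 1 d) hN
  have hSmp : MeasurePreserving S (haarProb (κ → UnitAddCircle))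
      (haarProb (κ → UnitAddCircle)) := by
    let u : (κ → UnitAddCircle) →ₜ+ (κ → UnitAddCircle) := ContinuousAddMonoidHom.id _ + N
    have hu : ∀ x, u x = x + N x := fun x => rfl
    have hSu : ⇑S = fun x => b + u x := by
      funext x
      rw [hS, hu, add_assoc]
    rw [hSu]
    refine measurePreserving_affine u (fun y => ?_) b
    obtain ⟨x, hx⟩ := S.surjective (b + y)
    exact ⟨x, add_left_cancel (a := b) (by rw [← hx, hSu])⟩
  have hfreq' := frequently_bohrFilter_cofinite hfreq hPW h0
  have hpos := eventually_measure_iInter_pos (haarProb (κ → UnitAddCircle))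
    (θ := fun n (i : Option P) x => affineFlow N.toAddMonoidHom b (d + 1) (optionValue P i n) x)
    (fun n i => by
      have := measurePreserving_zpow_homeomorph hSmp (optionValue P i n)
      rwa [show ⇑(S ^ optionValue P i n) = _ from funext (hflow _)] at this)
    (haarSubgroup (orbitSubgroup P (d + 1) N))
    -- the orbit subgroup contains the diagonal: these are the orbits at the times `p(0) = 0`
    (fun x => measurePreserving_add_haarSubgroup _ (by
      have h1 := affineFlow_mem_orbitSubgroup P (d + 1) N 0 x
      have h2 : ∀ i, optionValue P i 0 = 0 := by
        rintro (_ | p)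
        · rfl
        · exact value_zero (hP p.1 p.2)
      simpa only [h2, affineFlow_zero _ _ (Nat.le_add_left 1 d)] using h1))
    (fun O hO => haarSubgroup_ne_zero _ hO)
    (tendsto_integral_affineFlow hP N hN b) hA hμA
  have hdvd : ∀ᶠ n in bohrFilter (weylPolynomials P (d + 1)), ∀ p ∈ P, (M : ℤ) ∣ p.value n :=
    (Filter.eventually_all_finset P).mpr fun p hp => eventually_dvd_bohrFilter (hPW p hp) hM
  obtain ⟨n, hnR, hn, hd⟩ := (hfreq'.and_eventually
    (hpos.and (hdvd.filter_mono inf_le_left))).exists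
  refine ⟨n, hnR, hd, hn.trans_le (measure_mono fun x hx => ?_)⟩
  rw [Set.mem_iInter] at hx
  refine ⟨?_, Set.mem_iInter₂.mpr fun p hp => ?_⟩
  · have := hx none
    rwa [Set.mem_preimage, show optionValue P none n = 0 from rfl,
      affineFlow_zero _ _ (Nat.le_add_left 1 d)] at this
  · have := hx (some ⟨p, hp⟩)
    rw [Set.mem_preimage] at this ⊢
    rwa [hflow]

end Torus

/-! ### Reduction of Weyl systems to tori -/

theorem homeomorph_zpow_semiconj {X Y : Type*} [TopologicalSpace X] [TopologicalSpace Y]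
    {W : X ≃ₜ X} {V : Y ≃ₜ Y} {ψ : Y → X} (h : ∀ y, W (ψ y) = ψ (V y)) (k : ℤ) (y : Y) :
    (W ^ k) (ψ y) = ψ ((V ^ k) y) := by
  have := homeomorph_zpow_apply_eq W (fun m => ψ ((V ^ m) y))
    (fun m => by rw [h, add_comm, zpow_one_add]; rfl) k
  simpa using this

theorem homeomorph_pow_apply {X : Type*} [TopologicalSpace X] (T : X ≃ₜ X) (n : ℕ) (x : X) :
    (T ^ n) x = T^[n] x := by
  induction n generalizing x with
  | zero => rfl
  | succ n ih => rw [pow_succ, Function.iterate_succ_apply, ← ih]; rfl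

/-- In a divisible group, `1 + u + ⋯ + u ^ (M - 1)` is onto when `u` is unipotent: it equals
multiplication by `M` up to a nilpotent term. -/
theorem geom_sum_surjective_of_unipotent {Y : Type*} [AddCommGroup Y] {M : ℕ}
    (hdiv : ∀ y : Y, ∃ z : Y, M • z = y) (N : AddMonoid.End Y) {k : ℕ} (hN : N ^ k = 0) :
    Function.Surjective (∑ j ∈ Finset.range M, (1 + N) ^ j : AddMonoid.End Y) := by
  set L : AddMonoid.End Y := ∑ j ∈ Finset.range M, (1 + N) ^ j with hL
  set Q : AddMonoid.End Y :=
    ∑ j ∈ Finset.range M, ∑ i ∈ Finset.range j, (1 + N) ^ i with hQ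
  have hLQ : L = (M : AddMonoid.End Y) + N * Q := by
    have h1 : ∀ j, (1 + N) ^ j = 1 + N * ∑ i ∈ Finset.range j, (1 + N) ^ i := fun j => by
      have := mul_geom_sum (1 + N) j
      rw [add_sub_cancel_left] at this
      rw [this]
      abel
    rw [hL, hQ, Finset.sum_congr rfl fun j _ => h1 j, Finset.sum_add_distrib, Finset.mul_sum]
    simp
  have hcomm : ∀ i, L * N ^ i = (M : AddMonoid.End Y) * N ^ i + N ^ (i + 1) * Q := fun i => by
    have hNL : Commute N L := by
      refine Commute.sum_right _ _ _ fun j _ => ?_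
      exact ((Commute.one_right N).add_right (Commute.refl N)).pow_right j
    rw [← (hNL.pow_left i).eq, hLQ, mul_add, pow_succ, mul_assoc,
      (Nat.cast_commute M (N ^ i)).eq]
  have key : ∀ j ≤ k, ∀ y, ∃ x, L x = (N ^ (k - j)) y := by
    intro j
    induction j with
    | zero => exact fun _ y => ⟨0, by rw [map_zero, Nat.sub_zero, hN]; rfl⟩
    | succ j ih =>
      intro hj y
      obtain ⟨z, hz⟩ := hdiv y
      obtain ⟨x, hx⟩ := ih (by omega) (Q z)
      refine ⟨(N ^ (k - (j + 1))) z - x, ?_⟩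
      have h1 := DFunLike.congr_fun (hcomm (k - (j + 1))) z
      rw [show k - (j + 1) + 1 = k - j by omega] at h1
      change L ((N ^ (k - (j + 1))) z) =
        (M : AddMonoid.End Y) ((N ^ (k - (j + 1))) z) + (N ^ (k - j)) (Q z) at h1
      rw [AddMonoid.End.natCast_apply, ← map_nsmul, hz] at h1
      rw [map_sub, hx, h1, add_sub_cancel_right]
  intro y
  obtain ⟨x, hx⟩ := key k le_rfl y
  exact ⟨x, by simpa using hx⟩

theorem exists_nsmul_eq_torus {κ : Type*} [Fintype κ] {M : ℕ} (hM : 0 < M) (y : κ → UnitAddCircle) :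
    ∃ z : κ → UnitAddCircle, M • z = y := by
  obtain ⟨r, rfl⟩ := toTorus_surjective y
  refine ⟨toTorus κ ((M : ℝ)⁻¹ • r), ?_⟩
  rw [← map_nsmul, ← Nat.cast_smul_eq_nsmul ℝ, smul_smul,
    mul_inv_cancel₀ (Nat.cast_ne_zero.mpr hM.ne'), one_smul]

section LieGroup

variable {X : Type} [AddCommGroup X] [TopologicalSpace X] [IsTopologicalAddGroup X]
  {m : ℕ} {F : Type} [AddCommGroup F] [TopologicalSpace F] [DiscreteTopology F]
  (e : X ≃ₜ+ (Fin m → UnitAddCircle) × F)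

/-- The inclusion of the torus factor, whose image is the identity component. -/
def torusIncl : (Fin m → UnitAddCircle) →ₜ+ X where
  toFun y := e.symm (y, 0)
  map_zero' := map_zero e.symm
  map_add' y z := by rw [← map_add, Prod.mk_add_mk, add_zero]
  continuous_toFun := e.symm.continuous.comp (by fun_prop)

theorem equiv_torusIncl (y : Fin m → UnitAddCircle) : e (torusIncl e y) = (y, 0) :=
  e.apply_symm_apply _

theorem torusIncl_of_snd_eq_zero {x : X} (hx : (e x).2 = 0) : torusIncl e (e x).1 = x := by
  apply e.injective
  rw [equiv_torusIncl, ← hx]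

theorem torusIncl_mem_connectedComponent (y : Fin m → UnitAddCircle) :
    torusIncl e y ∈ connectedComponent (0 : X) := by
  refine (isPreconnected_range (map_continuous (torusIncl e))).subset_connectedComponent
    ⟨0, map_zero _⟩ ⟨y, rfl⟩

theorem snd_eq_zero_of_mem_connectedComponent {x : X} (hx : x ∈ connectedComponent (0 : X)) :
    (e x).2 = 0 := by
  have hc : Continuous fun z : X => (e z).2 := continuous_snd.comp e.continuous
  have h1 := (isPreconnected_connectedComponent (x := (0 : X))).image _ hc.continuousOn
  have := h1.subsingleton ⟨x, hx, rfl⟩ ⟨0, mem_connectedComponent, rfl⟩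
  simpa using this

/-- An automorphism maps the identity component to itself. -/
theorem exists_torus_hom (U : X ≃ₜ+ X) : ∃ u : (Fin m → UnitAddCircle) →ₜ+ (Fin m → UnitAddCircle),
    ∀ y, torusIncl e (u y) = U (torusIncl e y) := by
  have h : ∀ y, (e (U (torusIncl e y))).2 = 0 := fun y => by
    refine snd_eq_zero_of_mem_connectedComponent e ?_
    refine (isPreconnected_range (U.continuous.comp
      (map_continuous (torusIncl e)))).subset_connectedComponent
      ⟨0, by simp⟩ ⟨y, rfl⟩
  refine ⟨⟨⟨⟨fun y => (e (U (torusIncl e y))).1, by simp⟩, fun y z => by simp⟩, ?_⟩, fun y =>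
    torusIncl_of_snd_eq_zero e (h y)⟩
  exact continuous_fst.comp (e.continuous.comp (U.continuous.comp (map_continuous (torusIncl e))))

theorem torusIncl_injective : Function.Injective (torusIncl e) := fun y z h => by
  have := congrArg e h
  rw [equiv_torusIncl, equiv_torusIncl] at this
  exact congrArg Prod.fst this

/-- The sets of positive Haar measure in the torus are those whose copy in a coset of the identity
component has positive Haar measure, if that coset has positive measure. -/
theorem haarProb_torus_pos_iff [T2Space X] [MeasurableSpace X] [BorelSpace X] (μ : Measure X)
    [IsFiniteMeasure μ] [μ.IsAddLeftInvariant] (c : X)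
    (hc : μ (Set.range fun y => c + torusIncl e y) ≠ 0) (B : Set (Fin m → UnitAddCircle)) :
    0 < haarProb (Fin m → UnitAddCircle) B ↔ 0 < μ ((fun y => c + torusIncl e y) '' B) := by
  have hψ : MeasurableEmbedding fun y => c + torusIncl e y :=
    (Continuous.isClosedEmbedding (continuous_const.add (map_continuous (torusIncl e)))
      fun y z h => torusIncl_injective e (add_left_cancel h)).measurableEmbedding
  set ν := μ.comap fun y => c + torusIncl e y with hν
  have hνB : ∀ B, ν B = μ ((fun y => c + torusIncl e y) '' B) := fun B => hψ.comap_apply μ B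
  have : IsFiniteMeasure ν := ⟨by rw [hνB]; exact measure_lt_top _ _⟩
  have : ν.IsAddLeftInvariant := ⟨fun y₀ => by
    refine Measure.ext fun B hB => ?_
    rw [Measure.map_apply (measurable_const_add y₀) hB, hνB, hνB,
      ← measure_preimage_add μ (torusIncl e y₀) ((fun y => c + torusIncl e y) '' B)]
    congr 1
    ext z
    constructor
    · rintro ⟨y, hy, rfl⟩
      refine ⟨y₀ + y, hy, ?_⟩
      simp only [map_add]
      abel
    · rintro ⟨y, hy, hz⟩
      refine ⟨y - y₀, by simpa using hy, ?_⟩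
      simp only [map_sub] at hz ⊢
      rw [add_sub, hz, add_sub_cancel_left]⟩
  have h1 := Measure.isAddLeftInvariant_eq_smul ν (haarProb (Fin m → UnitAddCircle))
  set r := ν.addHaarScalarFactor (haarProb (Fin m → UnitAddCircle))
  have hr : r ≠ 0 := fun hr => hc (by
    rw [← Set.image_univ, ← hνB, h1, hr, zero_smul]
    rfl)
  rw [← hνB, h1, Measure.smul_apply, pos_iff_ne_zero, pos_iff_ne_zero, ne_eq, ne_eq,
    ENNReal.smul_def, smul_eq_mul, mul_eq_zero, ENNReal.coe_eq_zero]
  simp [hr]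

end LieGroup

/-- Bohr recurrence for the Weyl polynomials implies measurable recurrence for Weyl systems. On the
identity component of a `d`-step Weyl system the linear part is unipotent of degree `d`, and a
power of the transformation maps a coset of positive measure to itself. -/
theorem measurableRecurrence_weyl_of_bohr {P : Finset IntegralPolynomial}
    (hP : ∀ p ∈ P, p.1.coeff 0 = 0) {d : ℕ} {R : Set ℤ}
    (hR : BohrRecurrence R (weylPolynomials P (d + 1))) :
    MeasurableRecurrence R P (weylSystems (d + 1)) := by
  rintro S ⟨⟨_, _, ⟨m, F, _, _, _, _, ⟨e⟩⟩, _, -, a, U, hTU, k, hk⟩, hnil⟩ A hA hμA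
  obtain ⟨u, hu⟩ := exists_torus_hom e U
  obtain ⟨v, hv⟩ := exists_torus_hom e U.symm
  have huv : ∀ y, u (v y) = y := fun y => torusIncl_injective e (by rw [hu, hv]; simp)
  have hvu : ∀ y, v (u y) = y := fun y => torusIncl_injective e (by rw [hv, hu]; simp)
  let N : (Fin m → UnitAddCircle) →ₜ+ (Fin m → UnitAddCircle) := u - ContinuousAddMonoidHom.id _
  have hNu : ∀ y, N y = u y - y := fun y => rfl
  have huN : ∀ y, u y = y + N y := fun y => by rw [hNu]; abel
  have hNk : ∀ y, (N^[k]) y = 0 := fun y => by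
    have h1 : ∀ j, torusIncl e ((N^[j]) y) = (fun z => U z - z)^[j] (torusIncl e y) := fun j => by
      induction j with
      | zero => rfl
      | succ j ih =>
        rw [Function.iterate_succ_apply', Function.iterate_succ_apply', ← ih, hNu, map_sub, hu]
    refine torusIncl_injective e ?_
    rw [h1, hk _ (torusIncl_mem_connectedComponent e y), map_zero]
  have hui : ∀ j y, torusIncl e ((u^[j]) y) = (U.toAddMonoidHom^[j]) (torusIncl e y) := fun j y => by
    induction j with
    | zero => rfl
    | succ j ih =>
      rw [Function.iterate_succ_apply', Function.iterate_succ_apply', ← ih, hu]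
      rfl
  -- the degree of unipotency comes from the realization as a nilsystem
  have hNd : ∀ y, (N^[d + 1]) y = 0 := by
    refine iterate_eq_zero_of_small_paths u N huN hNk fun y hyc hy0 hsmall O hO => ?_
    have hcont : Continuous fun z : S.X => (e z).1 := continuous_fst.comp e.continuous
    have h1 := eventually_iterate_mem_of_isStepNilsystem (U := U.toAddMonoidHom) hTU
      (Nat.le_add_left 1 d) hnil id
      (fun s t => torusIncl e (y s t)) (fun s => (map_continuous (torusIncl e)).comp (hyc s))
      (fun s => by rw [hy0, map_zero])
      (fun j hj O hO => by
        have h2 : (torusIncl e) ⁻¹' O ∈ nhds 0 :=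
          (map_continuous (torusIncl e)).continuousAt.preimage_mem_nhds (by rwa [map_zero])
        filter_upwards [hsmall j hj _ h2] with s hs t
        rw [id_eq, ← hui]
        exact hs t)
      (O := (fun z => (e z).1) ⁻¹' O)
      (hcont.continuousAt.preimage_mem_nhds (by simpa using hO))
    filter_upwards [h1] with s hs
    rw [id_eq, ← hui, Set.mem_preimage, equiv_torusIncl] at hs
    exact hs
  -- a coset of the identity component that meets `A` in positive measure
  obtain ⟨f, hf⟩ : ∃ f : F, 0 < S.μ (A ∩ {z | (e z).2 = f}) := by
    by_contra! h
    refine hμA.ne' (measure_mono_null (t := ⋃ f, A ∩ {z | (e z).2 = f}) (fun z hz =>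
      Set.mem_iUnion.mpr ⟨(e z).2, hz, rfl⟩) (measure_iUnion_null fun f => ?_))
    exact nonpos_iff_eq_zero.mp (h f)
  let c : S.X := e.symm (0, f)
  have hec : e c = (0, f) := e.apply_symm_apply _
  have hcoset : ∀ z, (e z).2 = f → z = c + torusIncl e (e z).1 := fun z hz => by
    apply e.injective
    rw [map_add, hec, equiv_torusIncl, Prod.mk_add_mk, zero_add, add_zero, ← hz]
  have hrange : {z | (e z).2 = f} ⊆ Set.range fun y => c + torusIncl e y := fun z hz =>
    ⟨(e z).1, (hcoset z hz).symm⟩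
  -- a power of `T` maps this coset to itself
  have hσ : ∀ z w, (e z).2 = (e w).2 → (e (S.T z)).2 = (e (S.T w)).2 := fun z w h => by
    have h1 : (e (z - w)).2 = 0 := by rw [map_sub, Prod.snd_sub, h, sub_self]
    have h2 : S.T z = S.T w + torusIncl e (u (e (z - w)).1) := by
      rw [hu, torusIncl_of_snd_eq_zero e h1, hTU, hTU, map_sub]
      abel
    rw [h2, map_add, equiv_torusIncl, Prod.snd_add, add_zero]
  let σ : F → F := fun g => (e (S.T (e.symm (0, g)))).2
  have hσT : ∀ z, σ (e z).2 = (e (S.T z)).2 := fun z => hσ _ _ (by simp)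
  have hσs : Function.Surjective σ := fun g => by
    refine ⟨(e (S.T.symm (e.symm (0, g)))).2, ?_⟩
    rw [hσT]
    simp
  have hσi : ∀ j, (σ^[j]) f = (e (S.T^[j] c)).2 := fun j => by
    induction j with
    | zero => rw [Function.iterate_zero_apply, Function.iterate_zero_apply, hec]
    | succ j ih => rw [Function.iterate_succ_apply', Function.iterate_succ_apply', ih, hσT]
  obtain ⟨M, hM, hMf⟩ := Function.mem_periodicPts.mp
    ((Finite.injective_iff_surjective.mpr hσs).mem_periodicPts f)
  have hTc : S.T^[M] c = c + torusIncl e (e (S.T^[M] c)).1 :=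
    hcoset _ (by rw [← hσi]; exact hMf)
  -- the translation part `b` is chosen such that the `M`-th power of the affine map `y ↦ b + u y` of
  -- the torus is `T ^ M` on the coset
  let Nend : AddMonoid.End (Fin m → UnitAddCircle) := N.toAddMonoidHom
  have hNend : Nend ^ k = 0 := by
    ext1 y
    rw [AddMonoid.End.coe_pow]
    exact hNk y
  obtain ⟨b, hb⟩ := geom_sum_surjective_of_unipotent (exists_nsmul_eq_torus hM) Nend hNend
    (e (S.T^[M] c)).1
  let S₀ : (Fin m → UnitAddCircle) ≃ₜ (Fin m → UnitAddCircle) :=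
    (Homeomorph.mk ⟨u, v, hvu, huv⟩ (map_continuous u) (map_continuous v)).trans
      (Homeomorph.addLeft b)
  have hS₀ : ∀ y, S₀ y = b + u y := fun y => rfl
  have huend : ∀ y, u y = (1 + Nend) y := huN
  have hS₀i : ∀ j y, (S₀^[j]) y =
      (∑ i ∈ Finset.range j, (1 + Nend) ^ i : AddMonoid.End _) b + (u^[j]) y := fun j y => by
    induction j with
    | zero => simp
    | succ j ih =>
      rw [Function.iterate_succ_apply', Function.iterate_succ_apply', ih, hS₀, map_add,
        geom_sum_succ, huend ((∑ i ∈ Finset.range j, (1 + Nend) ^ i : AddMonoid.End _) b),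
        ← Function.iterate_succ_apply' u]
      rw [← add_assoc, add_comm b]
      rfl
  have hTi : ∀ j y, S.T^[j] (c + torusIncl e y) = S.T^[j] c + torusIncl e ((u^[j]) y) :=
    fun j y => by
      induction j with
      | zero => rfl
      | succ j ih =>
        rw [Function.iterate_succ_apply', Function.iterate_succ_apply',
          Function.iterate_succ_apply', ih, hTU, hTU, map_add, hu, add_assoc]
  have hsemi : ∀ y, (S.T ^ M) (c + torusIncl e y) = c + torusIncl e ((S₀ ^ M) y) := fun y => by
    rw [homeomorph_pow_apply, homeomorph_pow_apply, hTi, hTc, hS₀i, hb, map_add, add_assoc]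
  have hsemi' : ∀ (p : ℤ) y, (M : ℤ) ∣ p →
      (S.T ^ p) (c + torusIncl e y) = c + torusIncl e ((S₀ ^ p) y) := by
    rintro _ y ⟨q, rfl⟩
    rw [zpow_mul, zpow_mul, zpow_natCast, zpow_natCast]
    exact homeomorph_zpow_semiconj hsemi q y
  have hψc : Continuous fun y => c + torusIncl e y :=
    continuous_const.add (map_continuous (torusIncl e))
  have hc0 : S.μ (Set.range fun y => c + torusIncl e y) ≠ 0 := fun h =>
    hf.ne' (measure_mono_null (Set.inter_subset_right.trans hrange) h)
  have hA' : MeasurableSet ((fun y => c + torusIncl e y) ⁻¹' A) := hψc.measurable hA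
  have hpos : 0 < haarProb (Fin m → UnitAddCircle) ((fun y => c + torusIncl e y) ⁻¹' A) := by
    rw [haarProb_torus_pos_iff e S.μ c hc0, Set.image_preimage_eq_inter_range]
    exact hf.trans_le (measure_mono (Set.inter_subset_inter_right A hrange))
  obtain ⟨n, hnR, hdvd, hn⟩ := exists_return_torus hP hR N hNd b S₀
    (fun y => by rw [hS₀, huN, add_assoc]) hA' hpos hM
  refine ⟨n, hnR, ?_⟩
  rw [haarProb_torus_pos_iff e S.μ c hc0] at hn
  refine hn.trans_le (measure_mono ?_)
  rintro _ ⟨y, ⟨hyA, hy⟩, rfl⟩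
  refine ⟨hyA, Set.mem_iInter₂.mpr fun p hp => ?_⟩
  rw [Set.mem_preimage, hsemi' _ _ (hdvd p hp)]
  exact Set.mem_iInter₂.mp hy p hp

/-! ### Unipotent affine maps of `𝕋^κ × ℤ/M` as nilsystems -/

/-- The semidirect product `E ⋊ ℤ`, in which `1 ∈ ℤ` acts on `E` by the automorphism `u`. -/
def AffineGroup {E : Type} [NormedAddCommGroup E] [NormedSpace ℝ E] (_u : (E →L[ℝ] E)ˣ) : Type :=
  E × ℤ

namespace AffineGroup

open scoped commutatorElement

variable {E : Type} [NormedAddCommGroup E] [NormedSpace ℝ E] (u : (E →L[ℝ] E)ˣ)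

/-- The action of an integer on `E`. -/
def act (s : ℤ) : E →L[ℝ] E := ((u ^ s : (E →L[ℝ] E)ˣ) : E →L[ℝ] E)

theorem act_zero (v : E) : act u 0 v = v := by simp [act]

theorem act_add (s t : ℤ) (v : E) : act u (s + t) v = act u s (act u t v) := by
  simp [act, zpow_add]

theorem act_one (v : E) : act u 1 v = (u : E →L[ℝ] E) v := by simp [act]

instance : Group (AffineGroup u) where
  mul g h := (g.1 + act u g.2 h.1, g.2 + h.2)
  one := (0, 0)
  inv g := (-act u (-g.2) g.1, -g.2)
  mul_assoc g h k := Prod.ext (by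
    change g.1 + act u g.2 h.1 + act u (g.2 + h.2) k.1 = g.1 + act u g.2 (h.1 + act u h.2 k.1)
    rw [act_add, map_add, add_assoc]) (add_assoc _ _ _)
  one_mul g := Prod.ext (by
    change 0 + act u 0 g.1 = g.1
    rw [act_zero, zero_add]) (zero_add _)
  mul_one g := Prod.ext (by
    change g.1 + act u g.2 0 = g.1
    rw [map_zero, add_zero]) (add_zero _)
  inv_mul_cancel g := Prod.ext (neg_add_cancel _) (neg_add_cancel _)

instance : TopologicalSpace (AffineGroup u) := inferInstanceAs (TopologicalSpace (E × ℤ))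

theorem mul_def (g h : AffineGroup u) : g * h = (g.1 + act u g.2 h.1, g.2 + h.2) := rfl

theorem inv_def (g : AffineGroup u) : g⁻¹ = (-act u (-g.2) g.1, -g.2) := rfl

/-- The manifold structure is that of `E × ℤ`. As `ℤ` is discrete, the multiplication is locally the
sum of a linear map and a translation. -/
theorem isRealLieGroup [FiniteDimensional ℝ E] :
    IsTopologicalGroup (AffineGroup u) ∧ IsRealLieGroup (AffineGroup u) := by
  let _ : ChartedSpace (Fin 0 → ℝ) ℤ := ChartedSpace.ofDiscreteTopology
  have : IsManifold 𝓘(ℝ, Fin 0 → ℝ) ∞ ℤ := IsManifold.of_discreteTopology _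
  let _ : ChartedSpace (ModelProd E (Fin 0 → ℝ)) (AffineGroup u) :=
    inferInstanceAs (ChartedSpace (ModelProd E (Fin 0 → ℝ)) (E × ℤ))
  have : IsManifold (𝓘(ℝ, E).prod 𝓘(ℝ, Fin 0 → ℝ)) ∞ (AffineGroup u) :=
    inferInstanceAs (IsManifold (𝓘(ℝ, E).prod 𝓘(ℝ, Fin 0 → ℝ)) ∞ (E × ℤ))
  let I := 𝓘(ℝ, E).prod 𝓘(ℝ, Fin 0 → ℝ)
  have hfst : ContMDiff I 𝓘(ℝ, E) ∞ (fun g : AffineGroup u => g.1) :=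
    contMDiff_fst (I := 𝓘(ℝ, E)) (J := 𝓘(ℝ, Fin 0 → ℝ)) (M := E) (N := ℤ)
  have hsnd : ContMDiff I 𝓘(ℝ, Fin 0 → ℝ) ∞ (fun g : AffineGroup u => g.2) :=
    contMDiff_snd (I := 𝓘(ℝ, E)) (J := 𝓘(ℝ, Fin 0 → ℝ)) (M := E) (N := ℤ)
  have hcsnd : Continuous fun g : AffineGroup u => g.2 := continuous_snd (X := E) (Y := ℤ)
  have hL : LieGroup I ∞ (AffineGroup u) :=
    { contMDiff_mul := by
        intro z
        have hev : (fun p : AffineGroup u × AffineGroup u => p.1 * p.2) =ᶠ[nhds z]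
            fun p => ((p.1.1 + act u z.1.2 p.2.1, p.1.2 + p.2.2) : E × ℤ) := by
          have h1 : ∀ᶠ p : AffineGroup u × AffineGroup u in nhds z, p.1.2 = z.1.2 :=
            (hcsnd.comp continuous_fst).continuousAt (discreteTopology_iff_singleton_mem_nhds.mp
              inferInstance z.1.2)
          filter_upwards [h1] with p hp
          rw [mul_def, hp]
        refine ContMDiffAt.congr_of_eventuallyEq ?_ hev
        refine ContMDiffAt.prodMk (N' := ℤ) ?_ ?_
        · exact ((hfst.comp contMDiff_fst).add
            ((act u z.1.2).contMDiff.comp (hfst.comp contMDiff_snd))).contMDiffAt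
        · exact ((contMDiff_of_discreteTopology (f := fun q : ℤ × ℤ => q.1 + q.2)
            (I := 𝓘(ℝ, Fin 0 → ℝ).prod 𝓘(ℝ, Fin 0 → ℝ))).comp
            ((hsnd.comp contMDiff_fst).prodMk (hsnd.comp contMDiff_snd))).contMDiffAt
      contMDiff_inv := by
        intro z
        have hev : (fun p : AffineGroup u => p⁻¹) =ᶠ[nhds z]
            fun p => ((-act u (-z.2) p.1, -p.2) : E × ℤ) := by
          have h1 : ∀ᶠ p : AffineGroup u in nhds z, p.2 = z.2 :=
            hcsnd.continuousAt (discreteTopology_iff_singleton_mem_nhds.mp inferInstance z.2)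
          filter_upwards [h1] with p hp
          rw [inv_def, hp]
        refine ContMDiffAt.congr_of_eventuallyEq ?_ hev
        refine ContMDiffAt.prodMk (N' := ℤ) ?_ ?_
        · exact (((act u (-z.2)).contMDiff.comp hfst).neg).contMDiffAt
        · exact ((contMDiff_of_discreteTopology (f := fun q : ℤ => -q)).comp hsnd).contMDiffAt }
  exact ⟨topologicalGroup_of_lieGroup I ∞, E × (Fin 0 → ℝ), inferInstance, inferInstance,
    inferInstance, ModelProd E (Fin 0 → ℝ), inferInstance, I, inferInstance, inferInstance, hL⟩

/-- The unipotent maps `(1 + N) ^ t` differ from `1` by a multiple of `N`. -/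
theorem act_sub_eq {N : E →L[ℝ] E} (hu : (u : E →L[ℝ] E) = 1 + N) (t : ℤ) :
    ∃ C : E →L[ℝ] E, act u t - 1 = N * C ∧ Commute (act u t) N := by
  have hcomm : Commute (u : E →L[ℝ] E) N := by
    rw [hu]
    exact (Commute.one_left N).add_left (Commute.refl N)
  have hN : N = (u : E →L[ℝ] E) - 1 := by rw [hu, add_sub_cancel_left]
  have hc : ∀ t : ℤ, Commute (act u t) N := fun t => hcomm.units_zpow_left t
  refine ⟨?_, ?_, hc t⟩
  · exact t.casesOn (fun n => ∑ i ∈ Finset.range n, (u : E →L[ℝ] E) ^ i)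
      (fun n => -((∑ i ∈ Finset.range (n + 1), (u : E →L[ℝ] E) ^ i) * act u (-(n + 1))))
  · rcases t with n | n
    · change act u n - 1 = N * ∑ i ∈ Finset.range n, (u : E →L[ℝ] E) ^ i
      rw [hN, mul_geom_sum]
      simp [act]
    · change act u (Int.negSucc n) - 1 =
        N * -((∑ i ∈ Finset.range (n + 1), (u : E →L[ℝ] E) ^ i) * act u (-(n + 1)))
      have h1 : (u : E →L[ℝ] E) ^ (n + 1) * act u (-(n + 1)) = 1 := by
        have : (u ^ ((n : ℤ) + 1) * u ^ (-((n : ℤ) + 1)) : (E →L[ℝ] E)ˣ) = 1 := by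
          rw [← zpow_add, add_neg_cancel, zpow_zero]
        have h2 := congrArg Units.val this
        rw [Units.val_mul, Units.val_one] at h2
        rw [← h2]
        congr 1
      rw [mul_neg, ← mul_assoc, hN, mul_geom_sum, sub_mul, h1, one_mul, neg_sub, Int.negSucc_eq]

theorem act_range {N : E →L[ℝ] E} (hu : (u : E →L[ℝ] E) = 1 + N) (t : ℤ) (l : ℕ) (w : E) :
    ∃ w', act u t ((N ^ l) w) - (N ^ l) w = (N ^ (l + 1)) w' := by
  obtain ⟨C, hC, hcomm⟩ := act_sub_eq u hu t
  refine ⟨C w, ?_⟩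
  have h1 : act u t * N ^ l - N ^ l = N ^ (l + 1) * C := by
    rw [(hcomm.pow_right l).eq, pow_succ, mul_assoc, ← hC, mul_sub, mul_one]
  exact DFunLike.congr_fun h1 w

/-- The subgroup of the elements `(N ^ l w, 0)`, which bounds the lower central series. -/
def level (N : E →L[ℝ] E) (l : ℕ) : Subgroup (AffineGroup u) where
  carrier := {g | g.2 = 0 ∧ ∃ w, g.1 = (N ^ l) w}
  mul_mem' := by
    rintro g h ⟨hg, w, hw⟩ ⟨hh, w', hw'⟩
    refine ⟨by rw [mul_def, hg, hh]; rfl, w + w', ?_⟩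
    rw [mul_def, hg, act_zero, map_add, hw, hw']
  one_mem' := ⟨rfl, 0, (map_zero _).symm⟩
  inv_mem' := by
    rintro g ⟨hg, w, hw⟩
    refine ⟨by rw [inv_def, hg]; rfl, -w, ?_⟩
    rw [inv_def, hg, neg_zero, act_zero, hw, map_neg]

theorem commutator_eq (g h : AffineGroup u) :
    ⁅g, h⁆ = (g.1 - act u h.2 g.1 + (act u g.2 h.1 - h.1), 0) := by
  rw [commutatorElement_def]
  refine Prod.ext ?_ ?_
  · change g.1 + act u g.2 h.1 + act u (g.2 + h.2) (-act u (-g.2) g.1) +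
      act u (g.2 + h.2 + -g.2) (-act u (-h.2) h.1) = _
    rw [map_neg, map_neg, ← act_add, ← act_add, show g.2 + h.2 + -g.2 = h.2 by ring,
      add_neg_cancel, act_zero]
    abel_nf
  · change g.2 + h.2 + -g.2 + -h.2 = 0
    ring

theorem lowerCentralSeries_le {N : E →L[ℝ] E} (hu : (u : E →L[ℝ] E) = 1 + N) (l : ℕ) :
    (⊤ : Subgroup (AffineGroup u)).lowerCentralSeries (l + 1) ≤ level u N (l + 1) := by
  induction l with
  | zero =>
    refine Subgroup.commutator_le.mpr fun g _ h _ => ⟨by rw [commutator_eq], ?_⟩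
    rw [commutator_eq]
    obtain ⟨w, hw⟩ := act_range u hu h.2 0 g.1
    obtain ⟨w', hw'⟩ := act_range u hu g.2 0 h.1
    refine ⟨w' - w, ?_⟩
    rw [map_sub, ← hw, ← hw']
    simp only [pow_zero, one_apply_eq_self]
    abel
  | succ l ih =>
    refine Subgroup.commutator_le.mpr fun g hg h _ => ⟨by rw [commutator_eq], ?_⟩
    obtain ⟨hg0, w, hw⟩ := ih hg
    rw [commutator_eq, hg0, act_zero, hw]
    obtain ⟨w', hw'⟩ := act_range u hu h.2 (l + 1) w
    refine ⟨-w', ?_⟩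
    rw [map_neg, ← hw']
    abel_nf

end AffineGroup

section Nilsystem

variable {κ : Type} [Fintype κ]

theorem isOpenMap_toTorus : IsOpenMap (toTorus κ) := by
  have h : IsOpenMap (Pi.map fun (_ : κ) (r : ℝ) => (r : UnitAddCircle)) :=
    IsOpenMap.piMap (fun _ => QuotientAddGroup.isOpenMap_coe) (.of_forall fun _ =>
      QuotientAddGroup.mk_surjective)
  exact h

/-- The lattice of integer vectors is discrete. -/
theorem eq_zero_of_toTorus_eq_zero {v : κ → ℝ} (hv : toTorus κ v = 0) (h : ∀ i, |v i| < 1) :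
    v = 0 := by
  funext i
  obtain ⟨n, hn⟩ := (AddCircle.coe_eq_zero_iff (1 : ℝ)).mp (congrFun hv i)
  have h1 := h i
  rw [← hn, zsmul_one, ← Int.cast_abs, ← Int.cast_one, Int.cast_lt, Int.abs_lt_one_iff] at h1
  rw [← hn, h1, zero_smul]
  rfl

theorem iterate_toTorus {N : (κ → ℝ) →L[ℝ] (κ → ℝ)}
    {N' : (κ → UnitAddCircle) →ₜ+ (κ → UnitAddCircle)}
    (hNN' : ∀ v, toTorus κ (N v) = N' (toTorus κ v)) (j : ℕ) (v : κ → ℝ) :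
    (N'^[j]) (toTorus κ v) = toTorus κ ((N ^ j) v) := by
  induction j with
  | zero => rfl
  | succ j ih => rw [Function.iterate_succ_apply', ih, ← hNN', pow_succ']; rfl

/-- A unipotent affine map of `𝕋^κ × ℤ/M` that translates the second factor by `1` is a nilsystem:
it is a translation on the quotient of `ℝ^κ ⋊ ℤ` by `ℤ^κ ⋊ Mℤ`. -/
theorem isStepNilsystem_affine {N : (κ → ℝ) →L[ℝ] (κ → ℝ)}
    {N' : (κ → UnitAddCircle) →ₜ+ (κ → UnitAddCircle)}
    (hNN' : ∀ v, toTorus κ (N v) = N' (toTorus κ v)) {k : ℕ} (hN : N ^ (k + 1) = 0)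
    {M : ℕ} [NeZero M] (a : κ → UnitAddCircle)
    (T : ((κ → UnitAddCircle) × ZMod M) ≃ₜ ((κ → UnitAddCircle) × ZMod M))
    (hT : ∀ x, T x = (a + x.1 + N' x.1, x.2 + 1)) : IsStepNilsystem (k + 1) T := by
  let u : ((κ → ℝ) →L[ℝ] (κ → ℝ))ˣ := (IsNilpotent.isUnit_one_add ⟨k + 1, hN⟩).unit
  have hu : (u : (κ → ℝ) →L[ℝ] (κ → ℝ)) = 1 + N := rfl
  obtain ⟨hG, hLie⟩ := AffineGroup.isRealLieGroup u
  have hnil : ∀ x, x + N' x = 0 → x = 0 := fun x hx => by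
    have h2 : N' x = -x := by rw [eq_neg_iff_add_eq_zero, add_comm]; exact hx
    have h3 : ∀ j, (N'^[j]) x = 0 → x = 0 := fun j hj => by
      induction j with
      | zero => exact hj
      | succ j ih =>
        rw [Function.iterate_succ_apply, h2, iterate_map_neg, neg_eq_zero] at hj
        exact ih hj
    obtain ⟨v, rfl⟩ := toTorus_surjective x
    refine h3 (k + 1) ?_
    rw [iterate_toTorus hNN', hN]
    exact map_zero _
  -- the integer vectors are preserved by the action of `ℤ`; for negative powers this uses `hnil`
  have hact : ∀ v, toTorus κ v = 0 → ∀ s : ℤ, toTorus κ (AffineGroup.act u s v) = 0 := by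
    have hstep : ∀ v, toTorus κ (AffineGroup.act u 1 v) = toTorus κ v + N' (toTorus κ v) :=
      fun v => by
        rw [AffineGroup.act_one, hu, ← hNN', ← map_add]
        rfl
    intro v hv s
    induction s using Int.induction_on with
    | zero => rwa [AffineGroup.act_zero]
    | succ s ih => rw [add_comm, AffineGroup.act_add, hstep, ih, map_zero, add_zero]
    | pred s ih =>
      refine hnil _ ?_
      rw [← hstep, ← AffineGroup.act_add, add_sub_cancel]
      exact ih
  let f : AffineGroup u → (κ → UnitAddCircle) × ZMod M := fun g =>
    (toTorus κ g.1, ((g.2 : ℤ) : ZMod M))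
  have hfc : Continuous f :=
    (continuous_toTorus.comp (continuous_fst (X := κ → ℝ) (Y := ℤ))).prodMk
      ((continuous_of_discreteTopology (f := fun s : ℤ => (s : ZMod M))).comp
        (continuous_snd (X := κ → ℝ) (Y := ℤ)))
  have hfo : IsOpenMap f :=
    isOpenMap_toTorus.prodMap (g := fun s : ℤ => (s : ZMod M)) fun _ _ => isOpen_discrete _
  have hfs : Function.Surjective f := by
    rintro ⟨x, r⟩
    obtain ⟨v, rfl⟩ := toTorus_surjective x
    obtain ⟨s, rfl⟩ := ZMod.intCast_surjective r
    exact ⟨(v, s), rfl⟩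
  let Γ : Subgroup (AffineGroup u) :=
    { carrier := {g | f g = 0}
      mul_mem' := by
        intro g h hg hh
        have hg1 := congrArg Prod.fst hg
        have hg2 := congrArg Prod.snd hg
        have hh1 := congrArg Prod.fst hh
        have hh2 := congrArg Prod.snd hh
        refine Prod.ext ?_ ?_
        · change toTorus κ (g.1 + AffineGroup.act u g.2 h.1) = 0
          rw [map_add, hact _ hh1, add_zero]
          exact hg1
        · change ((g.2 + h.2 : ℤ) : ZMod M) = 0
          rw [Int.cast_add]
          exact (congrArg₂ (· + ·) hg2 hh2).trans (add_zero 0)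
      one_mem' := Prod.ext (map_zero _) Int.cast_zero
      inv_mem' := by
        intro g hg
        have hg1 := congrArg Prod.fst hg
        have hg2 := congrArg Prod.snd hg
        refine Prod.ext ?_ ?_
        · change toTorus κ (-AffineGroup.act u (-g.2) g.1) = 0
          rw [map_neg, hact _ hg1, neg_zero]
        · change ((-g.2 : ℤ) : ZMod M) = 0
          rw [Int.cast_neg]
          exact (congrArg Neg.neg hg2).trans neg_zero }
  -- the cosets of `Γ` are the fibres of `f`
  have hfΓ : ∀ g h : AffineGroup u, g⁻¹ * h ∈ Γ ↔ f g = f h := fun g h => by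
    have h1 : g⁻¹ * h = (AffineGroup.act u (-g.2) (h.1 - g.1), h.2 - g.2) := by
      rw [AffineGroup.mul_def, AffineGroup.inv_def]
      exact Prod.ext (by rw [map_sub]; exact neg_add_eq_sub _ _) (neg_add_eq_sub _ _)
    have h2 : toTorus κ (AffineGroup.act u (-g.2) (h.1 - g.1)) = 0 ↔
        toTorus κ g.1 = toTorus κ h.1 := by
      rw [eq_comm (b := toTorus κ h.1), ← sub_eq_zero (a := toTorus κ h.1), ← map_sub]
      refine ⟨fun h0 => ?_, fun h0 => hact _ h0 _⟩
      have := hact _ h0 g.2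
      rwa [← AffineGroup.act_add, add_neg_cancel, AffineGroup.act_zero] at this
    have h3 : ((h.2 - g.2 : ℤ) : ZMod M) = 0 ↔ ((g.2 : ℤ) : ZMod M) = ((h.2 : ℤ) : ZMod M) := by
      rw [Int.cast_sub, sub_eq_zero, eq_comm]
    change f (g⁻¹ * h) = 0 ↔ _
    rw [h1, Prod.ext_iff, Prod.ext_iff]
    exact and_congr h2 h3
  let φ : AffineGroup u ⧸ Γ → (κ → UnitAddCircle) × ZMod M :=
    Quotient.lift f fun g h hgh => (hfΓ g h).mp (QuotientGroup.leftRel_apply.mp hgh)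
  have hφ : Function.Bijective φ := by
    refine ⟨?_, fun x => ?_⟩
    · rintro ⟨g⟩ ⟨h⟩ hgh
      exact Quotient.sound (QuotientGroup.leftRel_apply.mpr ((hfΓ g h).mpr hgh))
    · obtain ⟨g, rfl⟩ := hfs x
      exact ⟨(g : AffineGroup u ⧸ Γ), rfl⟩
  let Φ : AffineGroup u ⧸ Γ ≃ₜ (κ → UnitAddCircle) × ZMod M :=
    (Equiv.ofBijective φ hφ).toHomeomorphOfContinuousOpen (hfc.quotient_lift _) (by
      intro V hV
      have h1 : φ '' V = f '' ((↑) ⁻¹' V) := by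
        ext x
        constructor
        · rintro ⟨⟨g⟩, hg, rfl⟩
          exact ⟨g, hg, rfl⟩
        · rintro ⟨g, hg, rfl⟩
          exact ⟨_, hg, rfl⟩
      change IsOpen (φ '' V)
      rw [h1]
      exact hfo _ (hV.preimage continuous_quotient_mk'))
  obtain ⟨v, hv⟩ := toTorus_surjective a
  refine ⟨AffineGroup u, inferInstance, inferInstance, hG, hLie, ?_, Γ, ?_, ?_,
    ((v, 1) : (κ → ℝ) × ℤ), Φ, ?_⟩
  · refine le_bot_iff.mp ((AffineGroup.lowerCentralSeries_le u hu k).trans ?_)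
    rintro g ⟨hg, w, hw⟩
    refine Subgroup.mem_bot.mpr (Prod.ext ?_ hg)
    rw [hw, hN]
    rfl
  · refine discreteTopology_of_isOpen_singleton_one ?_
    have hW : IsOpen {g : AffineGroup u | (∀ i, |g.1 i| < 1) ∧ g.2 = 0} := by
      refine IsOpen.prod (X := κ → ℝ) (Y := ℤ) (s := {v | ∀ i, |v i| < 1}) (t := {0}) ?_
        (isOpen_discrete _)
      simp only [Set.ofPred_forall]
      exact isOpen_iInter_of_finite fun i => isOpen_lt (continuous_apply i).abs continuous_const
    convert hW.preimage continuous_subtype_val using 1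
    ext g
    constructor
    · rintro rfl
      exact ⟨fun i => by
        change |(0 : ℝ)| < 1
        rw [abs_zero]
        exact one_pos, rfl⟩
    · rintro ⟨h1, h2⟩
      exact Subtype.ext (Prod.ext
        (eq_zero_of_toTorus_eq_zero (congrArg Prod.fst g.2) h1) h2)
  · exact Φ.symm.compactSpace
  · rintro ⟨g⟩
    change f ((show AffineGroup u from ((v, 1) : (κ → ℝ) × ℤ)) * g) = T (f g)
    rw [hT]
    refine Prod.ext ?_ ?_
    · change toTorus κ (v + AffineGroup.act u 1 g.1) = a + toTorus κ g.1 + N' (toTorus κ g.1)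
      rw [AffineGroup.act_one, hu, ← hNN', map_add, hv, add_assoc, ← map_add]
      rfl
    · change ((1 + g.2 : ℤ) : ZMod M) = ((g.2 : ℤ) : ZMod M) + 1
      push_cast
      ring

end Nilsystem

/-! ### Unipotent affine maps of `𝕋^κ × ℤ/M` as Weyl systems -/

/-- A unipotent endomorphism `V` of an abelian group moves each point that it does not fix along an
injective sequence, provided that no nonzero value of `V - 1` is a torsion element. -/
theorem injective_iterate_of_unipotent {A : Type*} [AddCommGroup A] (V : A → A) (D : A →+ A)
    (hV : ∀ x, V x = x + D x) {k : ℕ} (hD : ∀ x, (D^[k]) x = 0)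
    (htors : ∀ (n : ℤ) x, n • D x = 0 → n = 0 ∨ D x = 0) {x : A} (hx : D x ≠ 0) :
    Function.Injective fun n : ℕ => V^[n] x := by
  classical
  have hex : ∃ e, (D^[e + 1]) x = 0 := ⟨k, by rw [Function.iterate_succ_apply]; exact hD _⟩
  obtain ⟨e, he⟩ : ∃ e, Nat.find hex = e + 1 := Nat.exists_eq_add_one_of_ne_zero fun h0 =>
    hx (by
      have := Nat.find_spec hex
      rw [h0] at this
      exact this)
  -- `w` is moved by `D` exactly once
  set w := (D^[e]) x with hw
  have hw1 : D w ≠ 0 := by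
    have := Nat.find_min hex (m := e) (by omega)
    rwa [Function.iterate_succ_apply'] at this
  have hw2 : D (D w) = 0 := by
    have := Nat.find_spec hex
    rwa [he, Function.iterate_succ_apply', Function.iterate_succ_apply'] at this
  have hcomm : ∀ n y, (D^[e]) (V^[n] y) = V^[n] ((D^[e]) y) := fun n y =>
    (Function.Commute.iterate_iterate (f := D) (g := V) (fun z => by
      rw [hV, hV, map_add]) e n).eq y
  have hlin : ∀ n : ℕ, V^[n] w = w + n • D w := fun n => by
    induction n with
    | zero => simp
    | succ n ih =>
      rw [Function.iterate_succ_apply', ih, hV, map_add, map_nsmul, hw2, smul_zero, add_zero,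
        succ_nsmul, add_assoc]
  intro m n hmn
  have h1 : V^[m] w = V^[n] w := by rw [hw, ← hcomm, ← hcomm]; exact congrArg _ hmn
  rw [hlin, hlin, add_right_inj, ← natCast_zsmul, ← natCast_zsmul, ← sub_eq_zero, ← sub_smul] at h1
  rcases htors _ _ h1 with h | h
  · omega
  · exact absurd h hw1

section WeylSystem

variable {κ : Type} [Fintype κ]

theorem charactersSeparate_prod_zmod (M : ℕ) [NeZero M] :
    CharactersSeparate ((κ → UnitAddCircle) × ZMod M) := by
  rintro ⟨x, r⟩ h
  by_cases hx : x = 0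
  · have hr : r ≠ 0 := fun hr => h (by rw [hx, hr]; rfl)
    refine ⟨⟨(ZMod.toAddCircle (N := M)).comp (AddMonoidHom.snd _ _),
      (continuous_of_discreteTopology (f := ZMod.toAddCircle (N := M))).comp continuous_snd⟩,
      fun h0 => hr ?_⟩
    exact ZMod.toAddCircle_injective M (h0.trans (map_zero _).symm)
  · obtain ⟨χ, hχ⟩ := charactersSeparate_torus x hx
    exact ⟨⟨χ.toAddMonoidHom.comp (AddMonoidHom.fst _ _),
      (map_continuous χ).comp continuous_fst⟩, hχ⟩

theorem isCompactAbelianLieGroup_prod (M : ℕ) [NeZero M] :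
    IsCompactAbelianLieGroup ((κ → UnitAddCircle) × ZMod M) := by
  let σ := Fintype.equivFin κ
  refine ⟨Fintype.card κ, ZMod M, inferInstance, inferInstance, inferInstance, inferInstance,
    ⟨{ toFun := fun x => (fun i => x.1 (σ.symm i), x.2)
       invFun := fun x => (fun i => x.1 (σ i), x.2)
       left_inv := fun x => by simp
       right_inv := fun x => by simp
       map_add' := fun x y => rfl
       continuous_toFun := by fun_prop
       continuous_invFun := by fun_prop }⟩⟩

variable {N' : (κ → UnitAddCircle) →ₜ+ (κ → UnitAddCircle)} {k : ℕ} {M : ℕ} [NeZero M]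
  {a : κ → UnitAddCircle}

/-- Ergodicity of a unipotent affine map: the characters that are fixed by the linear part must be
nontrivial at the translation, also after multiplication by `M`. -/
theorem ergodic_affine_prod (hN' : ∀ x, (N'^[k + 1]) x = 0)
    (ha : ∀ l : κ → ℤ, l ≠ 0 → (∀ x, torusChar l (N' x) = 0) → M • torusChar l a ≠ 0)
    [MeasurableSpace ((κ → UnitAddCircle) × ZMod M)] [BorelSpace ((κ → UnitAddCircle) × ZMod M)]
    (U : ((κ → UnitAddCircle) × ZMod M) →ₜ+ ((κ → UnitAddCircle) × ZMod M))
    (hU : ∀ x, U x = (x.1 + N' x.1, x.2)) (hUs : Function.Surjective U) :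
    Ergodic (fun x => (a, (1 : ZMod M)) + U x) (haarProb ((κ → UnitAddCircle) × ZMod M)) := by
  refine ergodic_affine _ (charactersSeparate_prod_zmod M) (a, 1) U _ (fun _ => rfl)
    (measurePreserving_affine U hUs _) fun χ hχ => ?_
  let inl : (κ → UnitAddCircle) →ₜ+ ((κ → UnitAddCircle) × ZMod M) :=
    ⟨AddMonoidHom.inl _ _, continuous_id.prodMk continuous_const⟩
  have hchar : ∀ χ : ((κ → UnitAddCircle) × ZMod M) →ₜ+ UnitAddCircle,
      ∃ l, ∀ x, χ (x, 0) = torusChar l x := fun χ => by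
    obtain ⟨l, hl⟩ := exists_eq_torusChar (χ.comp inl)
    exact ⟨l, fun x => DFunLike.congr_fun hl x⟩
  -- the nilpotent part of the dual of `U`
  let D : (((κ → UnitAddCircle) × ZMod M) →ₜ+ UnitAddCircle) →+
      (((κ → UnitAddCircle) × ZMod M) →ₜ+ UnitAddCircle) :=
    AddMonoidHom.mk' (fun χ => χ.comp U - χ) fun χ ψ => by
      ext x
      change (χ (U x) + ψ (U x)) - (χ x + ψ x) = (χ (U x) - χ x) + (ψ (U x) - ψ x)
      abel
  have hD : ∀ χ x, D χ x = χ (N' x.1, 0) := fun χ x => by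
    change χ (U x) - χ x = _
    rw [hU, ← map_sub]
    congr 1
    exact Prod.ext (add_sub_cancel_left _ _) (sub_self _)
  have hDi : ∀ j χ x, (D^[j + 1]) χ x = χ ((N'^[j + 1]) x.1, 0) := fun j χ => by
    induction j with
    | zero => exact hD χ
    | succ j ih =>
      intro x
      rw [Function.iterate_succ_apply', hD, ih, Function.iterate_succ_apply N' (j + 1)]
  by_cases hfix : D χ = 0
  · refine Or.inr ⟨sub_eq_zero.mp hfix, fun h0 => hχ ?_⟩
    obtain ⟨l, hl⟩ := hchar χ
    have hsplit : ∀ x r, χ (x, r) = torusChar l x + χ (0, r) := fun x r => by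
      rw [← hl, ← map_add, Prod.mk_add_mk, add_zero, zero_add]
    have hr : ∀ r : ℤ, χ (0, (r : ZMod M)) = r • χ (0, 1) := fun r => by
      rw [← map_zsmul, Prod.smul_mk, smul_zero, zsmul_one]
    have hl0 : l = 0 := by
      by_contra hne
      refine ha l hne (fun x => ?_) ?_
      · rw [← hl]
        have := DFunLike.congr_fun hfix (x, 0)
        rwa [hD] at this
      · rw [hsplit, ← eq_neg_iff_add_eq_zero] at h0
        rw [h0, smul_neg, neg_eq_zero, ← natCast_zsmul, ← hr, Int.cast_natCast,
          ZMod.natCast_self]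
        exact map_zero χ
    have h1 : ∀ x, torusChar l x = 0 := fun x => by rw [hl0]; simp [torusChar_apply]
    ext ⟨x, r⟩
    obtain ⟨r, rfl⟩ := ZMod.intCast_surjective r
    rw [hsplit, h1, zero_add] at h0
    rw [hsplit, h1, zero_add, hr, h0, smul_zero]
    rfl
  · refine Or.inl (injective_iterate_of_unipotent _ D (fun χ => ?_) (k := k + 1) (fun χ => ?_)
      (fun n χ hn => ?_) hfix)
    · exact (add_sub_cancel χ (χ.comp U)).symm
    · ext x
      rw [hDi, hN']
      exact map_zero χ
    · obtain ⟨l, hl⟩ := hchar (D χ)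
      have hl' : ∀ x, D χ x = torusChar l x.1 := fun x => by rw [← hl, hD, hD]
      have h1 : n • l = 0 := torusChar_injective (by
        ext x
        let ev : (((κ → UnitAddCircle) × ZMod M) →ₜ+ UnitAddCircle) →+ UnitAddCircle :=
          AddMonoidHom.mk' (fun ψ => ψ (x, 0)) fun _ _ => rfl
        have : n • D χ (x, 0) = 0 := (map_zsmul ev n (D χ)).symm.trans (DFunLike.congr_fun hn (x, 0))
        rw [hl'] at this
        simp only [torusChar_apply, Pi.smul_apply, Pi.zero_apply, zero_smul,
          Finset.sum_const_zero]
        rw [← this, torusChar_apply, Finset.smul_sum]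
        exact Finset.sum_congr rfl fun i _ => smul_assoc _ _ _)
      rcases smul_eq_zero.mp h1 with h | h
      · exact Or.inl h
      · right
        ext x
        rw [hl', h]
        simp [torusChar_apply]

/-- Topological recurrence for Weyl systems, applied to a unipotent affine map of
`𝕋^κ × ℤ/M`. -/
theorem exists_return_of_topologicalRecurrence_weyl {P : Finset IntegralPolynomial} {R : Set ℤ}
    (h : TopologicalRecurrence R P (weylSystems (k + 1))) {N : (κ → ℝ) →L[ℝ] (κ → ℝ)}
    (hNN' : ∀ v, toTorus κ (N v) = N' (toTorus κ v)) (hN : N ^ (k + 1) = 0)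
    (ha : ∀ l : κ → ℤ, l ≠ 0 → (∀ x, torusChar l (N' x) = 0) → M • torusChar l a ≠ 0)
    {V : Set ((κ → UnitAddCircle) × ZMod M)} (hV : IsOpen V) (hne : V.Nonempty) :
    ∃ n ∈ R, ∃ x ∈ V, ∀ p ∈ P, (affineFlow N'.toAddMonoidHom a (k + 1) (p.value n) x.1,
      x.2 + (p.value n : ZMod M)) ∈ V := by
  have hN' : ∀ x, (N'^[k + 1]) x = 0 := fun x => by
    obtain ⟨v, rfl⟩ := toTorus_surjective x
    rw [iterate_toTorus hNN', hN]
    exact map_zero _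
  let Nend : AddMonoid.End (κ → UnitAddCircle) := N'.toAddMonoidHom
  have hNend : IsNilpotent Nend := ⟨k + 1, by
    ext1 y
    rw [AddMonoid.End.coe_pow]
    exact hN' y⟩
  let w := hNend.isUnit_one_add.unit
  have hw : ∀ x, (w : AddMonoid.End (κ → UnitAddCircle)) x = x + N' x := fun x => rfl
  have hw1 : ∀ x, ((w⁻¹ : (AddMonoid.End (κ → UnitAddCircle))ˣ) :
      AddMonoid.End (κ → UnitAddCircle)) (x + N' x) = x := fun x =>
    DFunLike.congr_fun w.inv_mul x
  have hw2 : ∀ x, ((w⁻¹ : (AddMonoid.End (κ → UnitAddCircle))ˣ) :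
      AddMonoid.End (κ → UnitAddCircle)) x + N' (((w⁻¹ : (AddMonoid.End (κ → UnitAddCircle))ˣ) :
      AddMonoid.End (κ → UnitAddCircle)) x) = x := fun x =>
    DFunLike.congr_fun w.mul_inv x
  let E : ((κ → UnitAddCircle) × ZMod M) ≃+ ((κ → UnitAddCircle) × ZMod M) :=
    { toFun := fun x => (x.1 + N' x.1, x.2)
      invFun := fun x => ((w⁻¹ : (AddMonoid.End (κ → UnitAddCircle))ˣ).val x.1, x.2)
      left_inv := fun x => Prod.ext (hw1 x.1) rfl
      right_inv := fun x => Prod.ext (hw2 x.1) rfl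
      map_add' := fun x y => Prod.ext (by
        change x.1 + y.1 + N' (x.1 + y.1) = (x.1 + N' x.1) + (y.1 + N' y.1)
        rw [map_add]
        abel) rfl }
  have hEc : Continuous E := (continuous_fst.add ((map_continuous N').comp continuous_fst)).prodMk
    continuous_snd
  let U : ((κ → UnitAddCircle) × ZMod M) ≃ₜ+ ((κ → UnitAddCircle) × ZMod M) :=
    { E with
      continuous_toFun := hEc
      continuous_invFun := (hEc.homeoOfEquivCompactToT2 (f := E.toEquiv)).continuous_invFun }
  have hU : ∀ x, U x = (x.1 + N' x.1, x.2) := fun x => rfl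
  let T : ((κ → UnitAddCircle) × ZMod M) ≃ₜ ((κ → UnitAddCircle) × ZMod M) :=
    U.toHomeomorph.trans (Homeomorph.addLeft (a, 1))
  have hTU : ∀ x, T x = (a, 1) + U x := fun x => rfl
  have hT : ∀ x, T x = (a + x.1 + N' x.1, x.2 + 1) := fun x => by
    rw [hTU, hU]
    exact Prod.ext (add_assoc _ _ _).symm (add_comm _ _)
  borelize ((κ → UnitAddCircle) × ZMod M)
  have herg := ergodic_affine_prod hN' ha
    (U : ((κ → UnitAddCircle) × ZMod M) →ₜ+ ((κ → UnitAddCircle) × ZMod M)) hU U.surjective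
  let S : System :=
    { X := (κ → UnitAddCircle) × ZMod M
      μ := haarProb _
      T := T
      invariant := herg.toMeasurePreserving }
  have hS : S ∈ weylSystems (k + 1) := by
    refine ⟨⟨inferInstanceAs (AddCommGroup ((κ → UnitAddCircle) × ZMod M)),
      inferInstanceAs (IsTopologicalAddGroup ((κ → UnitAddCircle) × ZMod M)),
      isCompactAbelianLieGroup_prod M,
      inferInstanceAs (haarProb ((κ → UnitAddCircle) × ZMod M)).IsAddHaarMeasure, herg,
      (a, 1), U, hTU, k + 1, fun x _ => ?_⟩, isStepNilsystem_affine hNN' hN a T hT⟩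
    have h1 : ∀ j x, (fun y => U y - y)^[j + 1] x = ((N'^[j + 1]) x.1, 0) := fun j x => by
      induction j with
      | zero => exact Prod.ext (add_sub_cancel_left _ _) (sub_self _)
      | succ j ih =>
        rw [Function.iterate_succ_apply', ih, Function.iterate_succ_apply' N' (j + 1)]
        exact Prod.ext (add_sub_cancel_left _ _) (sub_self _)
    refine (h1 k x).trans ?_
    rw [hN']
    rfl
  obtain ⟨n, hn, x, hxV, hx⟩ := h S hS V hV hne
  refine ⟨n, hn, x, hxV, fun p hp => ?_⟩
  have h1 := homeomorph_zpow_apply_eq T (fun m => (affineFlow N'.toAddMonoidHom a (k + 1) m x.1,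
    x.2 + (m : ZMod M))) (fun m => by
      rw [hT, affineFlow_succ _ _ (Nat.le_add_left 1 k) hN']
      refine Prod.ext rfl ?_
      change x.2 + ((m + 1 : ℤ) : ZMod M) = x.2 + (m : ZMod M) + 1
      push_cast
      ring) (p.value n)
  have h2 := Set.mem_iInter₂.mp hx p hp
  rw [Set.mem_preimage] at h2
  rw [← h1, affineFlow_zero _ _ (Nat.le_add_left 1 k), Int.cast_zero, add_zero]
  exact h2

end WeylSystem

/-! ### Jordan blocks and the evaluation of Weyl polynomials -/

section Shift

variable {ι : Type} {k : ℕ} {A : Type*} [AddCommGroup A]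

/-- The nilpotent map with one Jordan block of size `k + 1` for each `i : ι`. -/
def shift : (ι × Fin (k + 1) → A) →+ (ι × Fin (k + 1) → A) where
  toFun x c := if 0 < c.2.val then x (c.1, ⟨c.2.val - 1, by omega⟩) else 0
  map_zero' := by
    funext c
    simp
  map_add' x y := by
    funext c
    simp only [Pi.add_apply]
    split_ifs <;> simp

theorem shift_apply (x : ι × Fin (k + 1) → A) (i : ι) (l : Fin (k + 1)) :
    shift x (i, l) = if 0 < l.val then x (i, ⟨l.val - 1, by omega⟩) else 0 := rfl

theorem shift_iterate (e : ℕ) (x : ι × Fin (k + 1) → A) (i : ι) (l : Fin (k + 1)) :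
    (shift^[e]) x (i, l) = if e ≤ l.val then x (i, ⟨l.val - e, by omega⟩) else 0 := by
  induction e generalizing l with
  | zero => simp
  | succ e ih =>
    rw [Function.iterate_succ_apply', shift_apply]
    by_cases hl : 0 < l.val
    · rw [if_pos hl, ih]
      by_cases he : e + 1 ≤ l.val
      · rw [if_pos he, if_pos (show e ≤ l.val - 1 by omega)]
        congr 3
        simp only
        omega
      · rw [if_neg he, if_neg (show ¬e ≤ l.val - 1 by omega)]
    · rw [if_neg hl, if_neg (by omega)]

theorem shift_iterate_eq_zero (x : ι × Fin (k + 1) → A) : (shift^[k + 1]) x = 0 := by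
  funext ⟨i, l⟩
  rw [shift_iterate, if_neg (by have := l.2; omega)]
  rfl

/-- The vector with entries `β i` at the top of each Jordan block. -/
def blockTop (β : ι → A) : ι × Fin (k + 1) → A := fun c => if c.2.val = 0 then β c.1 else 0

/-- The points of an orbit of the affine map with linear part `1 + shift`, at the level `0`. -/
theorem affineFlow_shift_zero (β : ι → A) (x : ι × Fin (k + 1) → A) (m : ℤ) (i : ι) :
    affineFlow shift (blockTop β) (k + 1) m x (i, 0) = x (i, 0) + Ring.choose m 1 • β i := by
  have h : ∀ (c : ℕ → ℤ) (z : ι × Fin (k + 1) → A),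
      (∑ e ∈ Finset.range (k + 1), c e • (shift^[e]) z) (i, 0) = c 0 • z (i, 0) := fun c z => by
    rw [Finset.sum_apply, Finset.sum_eq_single 0]
    · rfl
    · intro e _ he
      rw [Pi.smul_apply, shift_iterate, if_neg (by simpa using he), smul_zero]
    · simp
  unfold affineFlow
  rw [Pi.add_apply, h, h (fun e => Ring.choose m (e + 1))]
  simp [blockTop]

/-- The points of an orbit of the affine map with linear part `1 + shift`, at a positive level. -/
theorem affineFlow_shift_succ (β : ι → A) (x : ι × Fin (k + 1) → A) (m : ℤ) (i : ι) (a : Fin k) :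
    affineFlow shift (blockTop β) (k + 1) m x (i, a.succ) = x (i, a.succ) +
      ∑ s : Fin k, (if s ≤ a then Ring.choose m (a.val - s.val + 1) else 0) • x (i, s.castSucc) +
      Ring.choose m (a + 1 + 1) • β i := by
  unfold affineFlow
  rw [Pi.add_apply]
  congr 1
  · rw [Finset.sum_apply, Finset.sum_range_succ']
    simp only [Pi.smul_apply, shift_iterate, Fin.val_succ]
    rw [add_comm]
    congr 1
    · simp only [Nat.zero_le, if_true, Ring.choose_zero_right, one_smul]
      rfl
    let g : ℕ → A := fun s => if h : s < k + 1 then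
      Ring.choose m (a.val - s + 1) • x (i, ⟨s, h⟩) else 0
    have hR : ∑ s : Fin k, (if s ≤ a then Ring.choose m (a.val - s.val + 1) else 0) •
        x (i, s.castSucc) = ∑ s ∈ Finset.range (a + 1), g s := by
      have h1 : ∀ s : Fin k, (if s ≤ a then Ring.choose m (a.val - s.val + 1) else 0) •
          x (i, s.castSucc) = if s.val ≤ a.val then g s.val else 0 := fun s => by
        by_cases hs : s ≤ a
        · rw [if_pos hs, if_pos (show s.val ≤ a.val from hs)]
          simp only [g]
          rw [dif_pos (by have := s.2; omega)]
          rfl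
        · rw [if_neg hs, if_neg (show ¬s.val ≤ a.val from hs), zero_smul]
      rw [Finset.sum_congr rfl fun s _ => h1 s,
        Fin.sum_univ_eq_sum_range (fun s => if s ≤ a.val then g s else 0) k, ← Finset.sum_filter]
      refine Finset.sum_congr ?_ fun _ _ => rfl
      ext s
      simp only [Finset.mem_filter, Finset.mem_range]
      have := a.2
      omega
    have hL : ∑ e ∈ Finset.range k, Ring.choose m (e + 1) •
        (if e + 1 ≤ a.val + 1 then x (i, ⟨a.val + 1 - (e + 1), by omega⟩) else 0) =
        ∑ e ∈ Finset.range (a + 1), g (a - e) := by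
      have hsub : Finset.range (a + 1) ⊆ Finset.range k := by
        intro e
        simp only [Finset.mem_range]
        have := a.2
        omega
      rw [← Finset.sum_subset hsub]
      · refine Finset.sum_congr rfl fun e he => ?_
        rw [Finset.mem_range] at he
        have := a.2
        rw [if_pos (by omega)]
        simp only [g]
        rw [dif_pos (by omega)]
        congr 2
        · omega
        · congr 2
          omega
      · intro e _ he
        rw [Finset.mem_range] at he
        rw [if_neg (by omega), smul_zero]
    rw [hR]
    refine Eq.trans hL (Finset.sum_flip g)
  · rw [Finset.sum_apply, Finset.sum_eq_single (a.val + 1)]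
    · rw [Pi.smul_apply, shift_iterate, if_pos (by simp)]
      simp [blockTop]
    · intro e _ he
      rw [Pi.smul_apply, shift_iterate]
      split_ifs with h
      · rw [Fin.val_succ] at h
        rw [blockTop, if_neg (by simp only [Fin.val_succ]; omega), smul_zero]
      · rw [smul_zero]
    · intro h
      have := a.2
      simp only [Finset.mem_range] at h
      omega

/-- The displacements along the orbits of the polynomials in `P` combine to a multiple of `β i`:
the orthogonality that defines Weyl polynomials removes the dependence on the initial point. -/
theorem sum_smul_affineFlow_shift_sub {P : Finset IntegralPolynomial} {v : Fin (k + 1) × P → ℤ}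
    {n : ℤ} (hv : ∀ j : Fin k, ∑ a : Fin k × P, v (a.1.succ, a.2) *
      (if j ≤ a.1 then Ring.choose (a.2.1.value n) (a.1.val - j.val + 1) else 0) = 0)
    (β : ι → A) (x : ι × Fin (k + 1) → A) (i : ι) :
    ∑ a, v a • (affineFlow shift (blockTop β) (k + 1) (a.2.1.value n) x (i, a.1) - x (i, a.1)) =
      (∑ a, v a * Ring.choose (a.2.1.value n) (a.1 + 1)) • β i := by
  have hdep : ∑ a : Fin k × P, v (a.1.succ, a.2) • ∑ s : Fin k, (if s ≤ a.1 then
      Ring.choose (a.2.1.value n) (a.1.val - s.val + 1) else 0) • x (i, s.castSucc) = 0 := by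
    simp only [Finset.smul_sum, smul_smul]
    rw [Finset.sum_comm]
    refine Finset.sum_eq_zero fun s _ => ?_
    rw [← Finset.sum_smul, hv, zero_smul]
  rw [Finset.sum_smul, Fintype.sum_prod_type, Fintype.sum_prod_type, Fin.sum_univ_succ,
    Fin.sum_univ_succ]
  congr 1
  · refine Finset.sum_congr rfl fun p _ => ?_
    rw [affineFlow_shift_zero, add_sub_cancel_left, smul_smul]
    rfl
  · rw [Fintype.sum_prod_type] at hdep
    rw [← sub_eq_zero, ← hdep, ← Finset.sum_sub_distrib]
    refine Finset.sum_congr rfl fun a _ => ?_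
    rw [← Finset.sum_sub_distrib]
    refine Finset.sum_congr rfl fun p _ => ?_
    rw [affineFlow_shift_succ, mul_smul, ← smul_sub]
    congr 1
    rw [Fin.val_succ]
    abel

end Shift

/-! ### Denominators of angles and divisibility of binomials -/

theorem exists_common_denominator {σ : Type*} (s : Finset σ) (c : σ → ℚ) :
    ∃ D : ℕ, 0 < D ∧ ∀ i ∈ s, ∃ z : ℤ, (D : ℚ) * c i = z := by
  classical
  refine ⟨∏ i ∈ s, (c i).den, Finset.prod_pos fun i _ => (c i).pos, fun i hi => ?_⟩
  obtain ⟨m, hm⟩ := Finset.dvd_prod_of_mem (fun i => (c i).den) hi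
  refine ⟨m * (c i).num, ?_⟩
  rw [hm]
  push_cast
  rw [mul_comm ((c i).den : ℚ), mul_assoc, Rat.den_mul_eq_num]

/-- Finitely many angles are rational combinations of finitely many reals that are rationally
independent together with `1`. -/
theorem exists_independent_angles (F : Finset UnitAddCircle) :
    ∃ (r : ℕ) (b : Fin r → ℝ) (D : ℕ) (m₀ : UnitAddCircle → ℤ) (m : UnitAddCircle → Fin r → ℤ),
      0 < D ∧ (∀ (c₀ : ℤ) (c : Fin r → ℤ), (c₀ : ℝ) + ∑ i, c i * b i = 0 → c = 0) ∧
      ∀ α ∈ F, α = (((m₀ α + ∑ i, m α i * b i) / D : ℝ) : UnitAddCircle) := by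
  classical
  let K : Submodule ℚ ℝ := Submodule.span ℚ {1}
  let lift : UnitAddCircle → ℝ := fun α => (QuotientAddGroup.mk_surjective α).choose
  have hlift : ∀ α, (lift α : UnitAddCircle) = α := fun α =>
    (QuotientAddGroup.mk_surjective α).choose_spec
  let W : Submodule ℚ (ℝ ⧸ K) := Submodule.span ℚ ((fun α => K.mkQ (lift α)) '' (F : Set _))
  have hW : FiniteDimensional ℚ W :=
    FiniteDimensional.span_of_finite ℚ (F.finite_toSet.image _)
  let B := Module.finBasis ℚ W
  have hb : ∀ i, ∃ b : ℝ, K.mkQ b = B i := fun i => K.mkQ_surjective _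
  choose b hb using hb
  have hcoef : ∀ α : UnitAddCircle, ∃ (c₀ : ℚ) (c : Fin (Module.finrank ℚ W) → ℚ), α ∈ F →
      lift α = c₀ + ∑ i, c i * b i := fun α => by
    by_cases hα : α ∈ F
    · let y : W := ⟨K.mkQ (lift α), Submodule.subset_span ⟨α, hα, rfl⟩⟩
      have h1 : K.mkQ (lift α - ∑ i, B.repr y i • b i) = 0 := by
        rw [map_sub, map_sum]
        simp only [map_smul, hb]
        have h2 := congrArg Subtype.val (B.sum_repr y)
        rw [Submodule.coe_sum] at h2
        rw [sub_eq_zero]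
        exact h2.symm
      rw [Submodule.mkQ_apply, Submodule.Quotient.mk_eq_zero] at h1
      obtain ⟨c₀, hc₀⟩ := Submodule.mem_span_singleton.mp h1
      refine ⟨c₀, fun i => B.repr y i, fun _ => ?_⟩
      rw [Rat.smul_def, mul_one] at hc₀
      rw [hc₀]
      simp [Rat.smul_def]
    · exact ⟨0, 0, fun h => absurd h hα⟩
  choose c₀ c hc using hcoef
  obtain ⟨D, hD, hDc⟩ := exists_common_denominator (F ×ˢ Finset.univ)
    (fun a : UnitAddCircle × Option (Fin (Module.finrank ℚ W)) => a.2.elim (c₀ a.1) (c a.1))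
  have hz₀ : ∀ α, ∃ z : ℤ, α ∈ F → (D : ℚ) * c₀ α = z := fun α => by
    by_cases hα : α ∈ F
    · obtain ⟨z, hz⟩ := hDc (α, none) (by simp [hα])
      exact ⟨z, fun _ => hz⟩
    · exact ⟨0, fun h => absurd h hα⟩
  have hz : ∀ α i, ∃ z : ℤ, α ∈ F → (D : ℚ) * c α i = z := fun α i => by
    by_cases hα : α ∈ F
    · obtain ⟨z, hz⟩ := hDc (α, some i) (by simp [hα])
      exact ⟨z, fun _ => hz⟩
    · exact ⟨0, fun h => absurd h hα⟩
  choose m₀ hm₀ using hz₀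
  choose m hm using hz
  refine ⟨_, b, D, m₀, m, hD, fun e₀ e he => ?_, fun α hα => ?_⟩
  · have h1 : ∑ i, (e i : ℚ) • B i = 0 := by
      have h2 := congrArg K.mkQ he
      rw [map_add, map_zero, map_sum] at h2
      have h3 : K.mkQ (e₀ : ℝ) = 0 := by
        rw [Submodule.mkQ_apply, Submodule.Quotient.mk_eq_zero]
        exact Submodule.mem_span_singleton.mpr ⟨e₀, by simp [Rat.smul_def]⟩
      rw [h3, zero_add] at h2
      refine Subtype.ext ?_
      rw [Submodule.coe_sum]
      refine Eq.trans (Finset.sum_congr rfl fun i _ => ?_) h2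
      rw [Submodule.coe_smul, ← hb, ← map_smul, Rat.smul_def]
      simp
    funext i
    have := Fintype.linearIndependent_iff.mp B.linearIndependent _ h1 i
    exact_mod_cast this
  · have hD' : (D : ℝ) ≠ 0 := Nat.cast_ne_zero.mpr hD.ne'
    conv_lhs => rw [← hlift α]
    congr 1
    rw [eq_div_iff hD', hc α hα, add_mul, Finset.sum_mul]
    congr 1
    · have := hm₀ α hα
      rw [mul_comm]
      exact_mod_cast congrArg (fun q : ℚ => (q : ℝ)) this
    · refine Finset.sum_congr rfl fun i _ => ?_
      have h1 : (D : ℝ) * c α i = m α i := by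
        exact_mod_cast congrArg (fun q : ℚ => (q : ℝ)) (hm α i hα)
      rw [← h1]
      ring

theorem succ_mul_choose_eq (p : ℤ) (e : ℕ) :
    ((e + 1 : ℕ) : ℤ) * Ring.choose p (e + 1) = p * Ring.choose (p - 1) e := by
  have h1 := choose_cast_eq (K := ℚ) p (e + 1)
  have h2 := choose_cast_eq (K := ℚ) (p - 1) e
  rw [descPochhammer_succ_left, Polynomial.eval_mul, Polynomial.eval_X, Polynomial.eval_comp] at h1
  have h3 : (((e + 1 : ℕ) : ℤ) : ℚ) * ((Ring.choose p (e + 1) : ℤ) : ℚ) =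
      (p : ℚ) * ((Ring.choose (p - 1) e : ℤ) : ℚ) := by
    rw [← h1, ← h2, Nat.factorial_succ]
    have h4 : ((e.factorial : ℕ) : ℚ) ≠ 0 := Nat.cast_ne_zero.mpr e.factorial_ne_zero
    have h5 : ((e : ℚ) + 1) ≠ 0 := by positivity
    simp only [Polynomial.eval_sub, Polynomial.eval_X, Polynomial.eval_one]
    push_cast
    field_simp
  rw [← Int.cast_mul, ← Int.cast_mul] at h3
  exact Int.cast_injective h3

/-- Binomial coefficients of numbers that are divisible by `D d!` are divisible by `D`. -/
theorem dvd_choose_of_dvd {D d e : ℕ} {p : ℤ} (hp : ((D * d.factorial : ℕ) : ℤ) ∣ p)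
    (he : e + 1 ≤ d) : (D : ℤ) ∣ Ring.choose p (e + 1) := by
  obtain ⟨g, hg⟩ := Nat.dvd_factorial (Nat.succ_pos e) he
  obtain ⟨z, rfl⟩ := hp
  have h := succ_mul_choose_eq (((D * d.factorial : ℕ) : ℤ) * z) e
  refine ⟨g * z * Ring.choose (((D * d.factorial : ℕ) : ℤ) * z - 1) e, ?_⟩
  refine mul_left_cancel₀ (show ((e + 1 : ℕ) : ℤ) ≠ 0 by positivity) (h.trans ?_)
  rw [hg]
  push_cast
  ring

/-! ### Recurrence for Weyl systems implies Bohr recurrence -/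

/-- The shift as a continuous endomorphism of a torus. -/
def torusShift (r k : ℕ) :
    (Fin r × Fin (k + 1) → UnitAddCircle) →ₜ+ (Fin r × Fin (k + 1) → UnitAddCircle) where
  toAddMonoidHom := shift
  continuous_toFun := continuous_pi fun c => by
    change Continuous fun x : Fin r × Fin (k + 1) → UnitAddCircle =>
      if 0 < c.2.val then x (c.1, ⟨c.2.val - 1, by omega⟩) else 0
    split_ifs
    · exact continuous_apply _
    · exact continuous_const

/-- The shift as a linear map. -/
def linearShift (r k : ℕ) :
    (Fin r × Fin (k + 1) → ℝ) →L[ℝ] (Fin r × Fin (k + 1) → ℝ) where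
  toFun := shift
  map_add' := map_add shift
  map_smul' t x := by
    funext ⟨i, l⟩
    rw [Pi.smul_apply, shift_apply, shift_apply]
    simp
  cont := continuous_pi fun c => by
    change Continuous fun x : Fin r × Fin (k + 1) → ℝ =>
      if 0 < c.2.val then x (c.1, ⟨c.2.val - 1, by omega⟩) else 0
    split_ifs
    · exact continuous_apply _
    · exact continuous_const

theorem toTorus_linearShift (r k : ℕ) (v : Fin r × Fin (k + 1) → ℝ) :
    toTorus _ (linearShift r k v) = torusShift r k (toTorus _ v) := by
  funext c
  change ((if 0 < c.2.val then v (c.1, ⟨c.2.val - 1, by omega⟩) else 0 : ℝ) : UnitAddCircle) =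
    if 0 < c.2.val then (v (c.1, ⟨c.2.val - 1, by omega⟩) : UnitAddCircle) else 0
  split_ifs <;> rfl

theorem linearShift_pow_eq_zero (r k : ℕ) : linearShift r k ^ (k + 1) = 0 := by
  ext1 v
  have h : ∀ j, (linearShift r k ^ j) v = (shift^[j]) v := fun j => by
    induction j with
    | zero => rfl
    | succ j ih => rw [Function.iterate_succ_apply', ← ih, pow_succ']; rfl
  rw [h, shift_iterate_eq_zero]
  rfl

/-- A character that is annihilated by the dual of the shift only involves the tops of the
blocks. -/
theorem torusChar_eq_of_torusShift {r k : ℕ} {l : Fin r × Fin (k + 1) → ℤ}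
    (hl : ∀ x, torusChar l (torusShift r k x) = 0) (i : Fin r) (j : Fin k) : l (i, j.succ) = 0 := by
  classical
  obtain ⟨α, hα⟩ := exists_zsmul_ne_zero
  refine hα _ ?_
  have h1 := hl (Pi.single (i, j.castSucc) α)
  have h2 : torusShift r k (Pi.single (i, j.castSucc) α) = Pi.single (i, j.succ) α := by
    funext ⟨i', l'⟩
    change (if 0 < l'.val then (Pi.single (i, j.castSucc) α :
      Fin r × Fin (k + 1) → UnitAddCircle) (i', ⟨l'.val - 1, by omega⟩) else 0) = _
    rcases Fin.eq_zero_or_eq_succ l' with rfl | ⟨l', rfl⟩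
    · rw [if_neg (by simp), Pi.single_eq_of_ne]
      exact fun h => Fin.succ_ne_zero j (congrArg Prod.snd h).symm
    · rw [if_pos (by simp)]
      simp only [Pi.single_apply, Prod.mk.injEq, Fin.ext_iff, Fin.val_succ, Fin.val_castSucc,
        Nat.add_sub_cancel, Nat.add_right_cancel_iff]
  rw [h2, torusChar_apply, Finset.sum_eq_single (i, j.succ)] at h1
  · simpa using h1
  · intro c _ hc
    rw [Pi.single_eq_of_ne hc, smul_zero]
  · simp

theorem eventually_nhds_pi_of_forall {ι Y : Type*} [Finite ι] [TopologicalSpace Y] {y : Y}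
    {s : Set (ι → Y)} (hs : s ∈ nhds (fun _ => y)) :
    ∃ V ∈ nhds y, ∀ z : ι → Y, (∀ i, z i ∈ V) → z ∈ s := by
  rw [nhds_pi, Filter.mem_pi'] at hs
  obtain ⟨I, t, ht, hts⟩ := hs
  exact ⟨⋂ i, t i, Filter.iInter_mem.mpr ht, fun z hz => hts fun i _ => Set.mem_iInter.mp (hz i) i⟩

/-- Topological recurrence for `d`-step Weyl systems implies Bohr recurrence for the `d`-Weyl
polynomials: in a Jordan block over `β` the displacements along the orbits of `p ∈ P` combine to
`D q(n) β`. The finite factor `ℤ/M` takes care of the rational parts of the angles. -/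
theorem bohr_of_topologicalRecurrence_weyl {P : Finset IntegralPolynomial} {k : ℕ} {R : Set ℤ}
    (h : TopologicalRecurrence R P (weylSystems (k + 1))) :
    BohrRecurrence R (weylPolynomials P (k + 1)) := by
  classical
  intro Q hQ F U hU
  have hw : ∀ q : IntegralPolynomial, ∃ (D : ℕ) (v : Fin (k + 1) × P → ℤ), 0 < D ∧ (q ∈ Q →
      (∀ t : ℤ, D * q.value t = ∑ a, v a * Ring.choose (a.2.1.value t) (a.1 + 1)) ∧
      ∀ (j : Fin k) (t : ℤ), ∑ a : Fin k × P, v (a.1.succ, a.2) *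
        (if j ≤ a.1 then Ring.choose (a.2.1.value t) (a.1.val - j.val + 1) else 0) = 0) :=
      fun q => by
    by_cases hq : q ∈ Q
    · obtain ⟨D, v, hD, hv⟩ := exists_int_weights (hQ q hq)
      exact ⟨D, v, hD, fun _ => hv⟩
    · exact ⟨1, 0, one_pos, fun h => absurd h hq⟩
  choose D v hD hv using hw
  obtain ⟨r, b, D', m₀, m, hD', hind, hF⟩ := exists_independent_angles F
  -- one denominator for all the polynomials and angles
  let C : ℕ := (∏ q ∈ Q, D q) * D'
  have hC : 0 < C := Nat.mul_pos (Finset.prod_pos fun q _ => hD q) hD'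
  have hCR : (C : ℝ) ≠ 0 := Nat.cast_ne_zero.mpr hC.ne'
  -- returns in `ℤ/M` make the binomials of the times divisible by `C`, see `dvd_choose_of_dvd`
  let M : ℕ := C * (k + 1).factorial
  have hM : 0 < M := Nat.mul_pos hC (Nat.factorial_pos _)
  have : NeZero M := ⟨hM.ne'⟩
  let β : Fin r → UnitAddCircle := fun i => ((b i / C : ℝ) : UnitAddCircle)
  -- ergodicity: the angles `b i` and `1` are rationally independent
  have hβ : ∀ l : Fin r × Fin (k + 1) → ℤ, l ≠ 0 → (∀ x, torusChar l (torusShift r k x) = 0) →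
      M • torusChar l (blockTop β) ≠ 0 := by
    intro l hl0 hl hM0
    have htop : torusChar l (blockTop β) = ((∑ i, l (i, 0) * (b i / C) : ℝ) : UnitAddCircle) := by
      rw [torusChar_apply, Fintype.sum_prod_type]
      simp only [Fin.sum_univ_succ, torusChar_eq_of_torusShift hl, zero_smul,
        Finset.sum_const_zero, add_zero]
      have h1 : ∀ f : Fin r → ℝ, ((∑ i, f i : ℝ) : UnitAddCircle) = ∑ i, (f i : UnitAddCircle) :=
        fun f => map_sum (QuotientAddGroup.mk' _) f Finset.univ
      rw [h1]
      refine Finset.sum_congr rfl fun i _ => ?_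
      rw [← zsmul_eq_mul]
      rfl
    rw [htop] at hM0
    obtain ⟨z, hz⟩ := (AddCircle.coe_eq_zero_iff (1 : ℝ)).mp
      ((AddCircle.coe_nsmul (p := (1 : ℝ)) (n := M) (x := ∑ i, l (i, 0) * (b i / C))).trans hM0)
    have h2 : ((-(z * C) : ℤ) : ℝ) + ∑ i, ((M * l (i, 0) : ℤ) : ℝ) * b i = 0 := by
      rw [zsmul_one, nsmul_eq_mul, Finset.mul_sum] at hz
      push_cast
      rw [hz, Finset.sum_mul, neg_add_eq_zero]
      refine Finset.sum_congr rfl fun i _ => ?_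
      field_simp
    have h3 := hind _ _ h2
    refine hl0 (funext fun c => ?_)
    obtain ⟨i, j⟩ := c
    rcases Fin.eq_zero_or_eq_succ j with rfl | ⟨j, rfl⟩
    · have := congrFun h3 i
      simpa [hM.ne'] using this
    · exact torusChar_eq_of_torusShift hl i j
  have hDC : ∀ q : IntegralPolynomial, ∃ c : ℕ, q ∈ Q → C = D q * D' * c := fun q => by
    by_cases hq : q ∈ Q
    · obtain ⟨c, hc⟩ := Finset.dvd_prod_of_mem D hq
      exact ⟨c, fun _ => by simp only [C]; rw [hc]; ring⟩
    · exact ⟨0, fun h => absurd h hq⟩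
  choose cof hcof using hDC
  -- `q(n) α` as a continuous function of the points of the orbit at the times `0` and `p(n)`
  let G : IntegralPolynomial → UnitAddCircle →
      (Option P → Fin r × Fin (k + 1) → UnitAddCircle) → UnitAddCircle := fun q α z =>
    cof q • ∑ i, m α i • ∑ a, v q a • (z (some a.2) (i, a.1) - z none (i, a.1))
  have hGc : ∀ q α, Continuous (G q α) := fun q α => by
    have h1 : ∀ (o : Option P) (c : Fin r × Fin (k + 1)), Continuous
        fun z : Option P → Fin r × Fin (k + 1) → UnitAddCircle => z o c := fun o c =>
      (continuous_apply c).comp (continuous_apply o)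
    exact (continuous_finsetSum _ fun i _ => (continuous_finsetSum _ fun a _ =>
      ((h1 _ _).sub (h1 _ _)).const_smul (v q a)).const_smul (m α i)).const_smul (cof q)
  have hG0 : ∀ q α, G q α (fun _ => 0) = 0 := fun q α => by simp [G]
  obtain ⟨V, hV, hVG⟩ := eventually_nhds_pi_of_forall
    (s := {z | ∀ q ∈ Q, ∀ α ∈ F, G q α z ∈ U}) (y := 0) (by
      refine (Filter.eventually_all_finset Q).mpr fun q _ =>
        (Filter.eventually_all_finset F).mpr fun α _ => ?_
      exact (hGc q α).continuousAt.preimage_mem_nhds (by rwa [hG0]))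
  obtain ⟨V', hV'V, hV'o, hV'0⟩ := mem_nhds_iff.mp hV
  obtain ⟨n, hnR, x, hx, hxn⟩ := exists_return_of_topologicalRecurrence_weyl (M := M)
    (a := blockTop β) h (toTorus_linearShift r k) (linearShift_pow_eq_zero r k) hβ
    (V := V' ×ˢ {0}) (hV'o.prod (isOpen_discrete _)) ⟨(0, 0), hV'0, rfl⟩
  refine ⟨n, hnR, fun q hq α hα => ?_⟩
  have hdvd : ∀ p ∈ P, ((C * (k + 1).factorial : ℕ) : ℤ) ∣ p.value n := fun p hp => by
    have h1 : x.2 + (p.value n : ZMod M) = 0 := (hxn p hp).2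
    rw [show x.2 = 0 from hx.2, zero_add] at h1
    exact (ZMod.intCast_zmod_eq_zero_iff_dvd _ _).mp h1
  obtain ⟨hvq, hvo⟩ := hv q hq
  -- so `q(n)` annihilates the rational part of the angle
  obtain ⟨w, hw⟩ : (D' : ℤ) ∣ q.value n := by
    have h1 : (C : ℤ) ∣ D q * q.value n := by
      rw [hvq]
      exact Finset.dvd_sum fun a _ => (dvd_choose_of_dvd (hdvd _ a.2.2)
        (by have := a.1.2; omega)).mul_left _
    rw [hcof q hq] at h1
    push_cast at h1
    exact Int.dvd_of_mul_dvd_mul_left (Nat.cast_ne_zero.mpr (hD q).ne')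
      ((dvd_mul_right _ _).trans h1)
  let z : Option P → Fin r × Fin (k + 1) → UnitAddCircle := fun o => o.elim x.1 fun p =>
    affineFlow shift (blockTop β) (k + 1) (p.1.value n) x.1
  have hzU : G q α z ∈ U := by
    refine hVG z ?_ q hq α hα
    rintro (_ | p)
    · exact hV'V hx.1
    · exact hV'V (hxn p.1 p.2).1
  have hGz : G q α z = cof q • ∑ i, m α i • ((D q : ℤ) * q.value n) • β i := by
    change cof q • ∑ i, m α i • ∑ a, v q a •
      (affineFlow shift (blockTop β) (k + 1) (a.2.1.value n) x.1 (i, a.1) - x.1 (i, a.1)) = _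
    simp only [sum_smul_affineFlow_shift_sub (fun j => hvo j n), hvq]
  have hcoe : ∀ f : Fin r → ℝ, ((∑ i, f i : ℝ) : UnitAddCircle) = ∑ i, (f i : UnitAddCircle) :=
    fun f => map_sum (QuotientAddGroup.mk' _) f Finset.univ
  have hGr : G q α z = ((cof q • ∑ i, m α i • ((D q : ℤ) * q.value n) • (b i / C) : ℝ) :
      UnitAddCircle) := by
    rw [hGz, AddCircle.coe_nsmul, hcoe]
    simp only [AddCircle.coe_zsmul]
    rfl
  have hreal : q.value n • ((m₀ α + ∑ i, m α i * b i) / D' : ℝ) =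
      (w * m₀ α) • (1 : ℝ) + cof q • ∑ i, m α i • ((D q : ℤ) * q.value n) • (b i / C) := by
    have hD'R : (D' : ℝ) ≠ 0 := Nat.cast_ne_zero.mpr hD'.ne'
    have hCc : (C : ℝ) = D q * D' * cof q := by
      exact_mod_cast congrArg (Nat.cast (R := ℝ)) (hcof q hq)
    have hterm : ∀ i, (cof q : ℝ) * (m α i * (((D q : ℤ) * q.value n : ℤ) * (b i / C))) =
        w * (m α i * b i) := fun i => by
      rw [hw]
      push_cast
      have h0 := hCR
      rw [hCc] at h0 ⊢
      have h2 := right_ne_zero_of_mul h0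
      have h3 := left_ne_zero_of_mul (left_ne_zero_of_mul h0)
      field_simp
    rw [nsmul_eq_mul, zsmul_eq_mul, zsmul_eq_mul, Finset.mul_sum]
    simp only [zsmul_eq_mul, hterm]
    rw [← Finset.mul_sum, hw]
    push_cast
    field_simp
  have hfinal : q.value n • α = G q α z := by
    conv_lhs => rw [hF α hα]
    rw [← AddCircle.coe_zsmul, hreal, AddCircle.coe_add, ← hGr, add_eq_right,
      AddCircle.coe_zsmul, AddCircle.coe_period, smul_zero]
  rw [hfinal]
  exact hzU

end WeylRecurrence

end

open WeylRecurrence in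
theorem mainTheorem2 (d : ℕ) (hd : 1 ≤ d) (P : Finset WeylRecurrence.IntegralPolynomial)
    (hP : ∀ p ∈ P, p.1.coeff 0 = 0) (R : Set ℤ) :
    List.TFAE [
      WeylRecurrence.MeasurableRecurrence R P (WeylRecurrence.weylSystems d),
      WeylRecurrence.TopologicalRecurrence R P (WeylRecurrence.weylSystems d),
      WeylRecurrence.MeasurableRecurrenceReal R (WeylRecurrence.weylPolynomials P d)
        WeylRecurrence.kroneckerSystems,
      WeylRecurrence.TopologicalRecurrenceReal R (WeylRecurrence.weylPolynomials P d)
        WeylRecurrence.kroneckerSystems] := by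
  obtain ⟨k, rfl⟩ := Nat.exists_eq_add_of_le' hd
  tfae_have 1 → 2 := topologicalRecurrence_of_measurable fun S hS => isOpenPosMeasure_of_isWeyl hS.1
  tfae_have 2 → 3 := fun h =>
    measurableRecurrence_kronecker_of_bohr (bohr_of_topologicalRecurrence_weyl h)
  tfae_have 3 → 4 := fun h Q hQ =>
    topologicalRecurrence_of_measurable (fun S hS => isOpenPosMeasure_of_isKronecker hS) (h Q hQ)
  tfae_have 4 → 1 := fun h =>
    measurableRecurrence_weyl_of_bohr hP (bohr_of_topologicalRecurrence_kronecker h)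
  tfae_finish
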